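/- \textbf{Proposition (Tightness).} A \emph{rooted metric boundedly finite measure tree} $(T,r,\rho,\nu)$ is a Heine--Borel metric space $(T,r)$ (closed bounded sets are compact) with a point $\rho\in T$ such that $r(x_1,x_2)+r(x_3,x_4)\le\max\{r(x_1,x_3)+r(x_2,x_4),\,r(x_1,x_4)+r(x_2,x_3)\}$ for all $x_1,\dots,x_4\in T$, and such that for all $x_1,x_2,x_3\in T$ there is $c\in T$ with $r(x_i,c)+r(x_j,c)=r(x_i,x_j)$ for $i\neq j$, together with a Borel measure $\nu$ on $T$ which is finite on bounded sets and has full support. Put $[a,b]:=\{x\in T: r(a,x)+r(x,b)=r(a,b)\}$, and write $x\sim y$ if $x\ne y$ and $[x,y]=\{x,y\}$. \emph{Speed-$\nu$ random walk.} Let $T^o$ be the union of the set of isolated points different from $\rho$ and of all $[\rho,a]\setminus\{\rho,a\}$, $a\in T$, and let $\lambda$ be the length measure, i.e.\ the unique $\sigma$-finite Borel measure with $\lambda(T\setminus T^o)=0$ and $\lambda([\rho,a]\setminus\{\rho\})=r(\rho,a)$ for all $a\in T$. The gradient $\nabla f$ of $f$ is the ($\lambda$-a.e.\ unique) function $g$,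 integrable on each $[\rho,a]$, with $f(y)-f(x)=\int_{[\rho,y]}g\,d\lambda-\int_{[\rho,x]}g\,d\lambda$ for all $x,y\in T$. Let $\mathcal E(f,g):=\frac12\int\nabla f\,\nabla g\,d\lambda$ on the set $\mathcal D(\mathcal E)$ of all continuous functions $f\in L^2(\nu)$ vanishing at infinity with $\nabla f\in L^2(\lambda)$ which are locally absolutely continuous (for all $\varepsilon>0$ and $S\subseteq T$ with $\lambda(S)<\infty$ there is $\delta>0$ such that $\sum_i|f(x_i)-f(y_i)|<\varepsilon$ for all finite families of disjoint arcs $[x_i,y_i]\subseteq S$ with $\sum_i r(x_i,y_i)<\delta$). If $(T,r)$ is discrete, the speed-$\nu$ random walk on $(T,r)$ is the Markov process with c\`adl\`ag paths in $T\cup\{\infty\}$, the point $\infty$ being the cemetery, which is associated with the closure of $(\mathcal E,\mathcal D(\mathcal E))$ in $L^2(\nu)$, in the sense that its resolvent is the resolvent of this closed form. (It is the nearest neighbour chain, killed at its explosion time, which jumps from $v$ to $v'\sim v$ at rate $(2\,\nu(\{v\})\,r(v,v'))^{-1}$.) \emph{Statement.} Let $\mathcal X=(T,r,\rho,\nu)$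 and $\mathcal X_n=(T_n,r_n,\rho_n,\nu_n)$, $n\in\mathbb N$, be rooted metric boundedly finite measure trees such that every $(T_n,r_n)$ is discrete. Assume: \begin{itemize} \item[(A0)] For all $R>0$, $\limsup_{n\to\infty}\sup\{r_n(x,z): x,z\in T_n,\ r_n(\rho_n,x)<R,\ x\sim z\}<\infty$. \item[(A1)] $\mathcal X_n\to\mathcal X$ in the pointed Gromov-vague topology, i.e.\ there are a complete separable metric space $(E_0,d_0)$, a point $\rho_0\in E_0$ and isometric embeddings of $T$ and of all $T_n$ into $E_0$ which map the roots to $\rho_0$, such that for all but countably many $R>0$ the image measures of $\nu_n$, restricted to the closed ball $\overline B(\rho_0,R)$, converge weakly to the image measure of $\nu$ restricted to this ball. \item[(A2)] For all $\delta,R>0$, $\inf_{n\in\mathbb N}\inf\{\nu_n(\overline B(x,\delta)): x\in T_n,\ r_n(\rho_n,x)<R\}>0$. \end{itemize} Then there are a Heine--Borel space $(E,d)$, a point $\rho_E\in E$ and isometric embeddings of $T$ and of all $T_n$ into $E$ which map the roots to $\rho_E$ and along which the measures converge as in (A1), such that the following holds. For all initial distributions $\mu_n$ on $T_n$, $n\in\mathbb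 N$, the sequence of speed-$\nu_n$ random walks $X^n$ on $(T_n,r_n)$ with initial distributions $\mu_n$, regarded as processes in the one-point compactification $E\cup\{\infty\}$ which take the value $\infty$ after their lifetimes, is tight in the Skorohod space $D([0,\infty),E\cup\{\infty\})$. -/

import Mathlib

open MeasureTheory ProbabilityTheory Filter Topology Set
open scoped NNReal ENNReal BoundedContinuousFunction

noncomputable section

namespace SpeedWalk

universe u

/-! ### Rooted metric boundedly finite measure trees -/

/-- A rooted metric boundedly finite measure tree `(T, r, ρ, ν)`: a Heine-Borel space
(`ProperSpace`) which is `0`-hyperbolic and contains all its branch points, with a root `ρ` and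
a Borel measure `ν` of full support which is finite on bounded sets. -/
structure RootedMeasureTree where
  carrier : Type u
  [metricSpace : MetricSpace carrier]
  [properSpace : ProperSpace carrier]
  [measurableSpace : MeasurableSpace carrier]
  [borelSpace : BorelSpace carrier]
  root : carrier
  four_point : ∀ x₁ x₂ x₃ x₄ : carrier,
    dist x₁ x₂ + dist x₃ x₄ ≤ max (dist x₁ x₃ + dist x₂ x₄) (dist x₁ x₄ + dist x₂ x₃)
  exists_branch_point : ∀ x₁ x₂ x₃ : carrier, ∃ c : carrier,
    dist x₁ c + dist x₂ c = dist x₁ x₂ ∧ dist x₁ c + dist x₃ c = dist x₁ x₃ ∧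
      dist x₂ c + dist x₃ c = dist x₂ x₃
  ν : Measure carrier
  finite_of_isBounded : ∀ s : Set carrier, Bornology.IsBounded s → ν s < ∞
  full_support : ∀ U : Set carrier, IsOpen U → U.Nonempty → 0 < ν U

instance : CoeSort RootedMeasureTree.{u} (Type u) := ⟨RootedMeasureTree.carrier⟩

attribute [instance] RootedMeasureTree.metricSpace RootedMeasureTree.properSpace
  RootedMeasureTree.measurableSpace RootedMeasureTree.borelSpace

/-- The interval `[a, b] = {x | r(a,x) + r(x,b) = r(a,b)}`. -/
def arc {T : Type u} [MetricSpace T] (a b : T) : Set T :=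
  {x | dist a x + dist x b = dist a b}

/-- `x ∼ y`: the points `x` and `y` are connected by an edge. -/
def IsEdge {T : Type u} [MetricSpace T] (x y : T) : Prop :=
  x ≠ y ∧ arc x y = {x, y}

/-! ### Convergence of trees and the assumptions on the sequence -/

/-- The images under `φ n` of the measures `ν_n`, restricted to the closed ball of radius `R`
around `ρE`, converge weakly to those of `ν` under `φ'`, for all but countably many `R > 0`. -/
def VagueConvergence {E : Type u} [MetricSpace E] (ρE : E)
    (𝒳 : ℕ → RootedMeasureTree.{u}) (𝒴 : RootedMeasureTree.{u})
    (φ : ∀ n, 𝒳 n → E) (φ' : 𝒴 → E) : Prop :=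
  letI : MeasurableSpace E := borel E
  ∃ C : Set ℝ, C.Countable ∧ ∀ R : ℝ, 0 < R → R ∉ C → ∀ f : E →ᵇ ℝ,
    Tendsto (fun n => ∫ y in Metric.closedBall ρE R, f y ∂((𝒳 n).ν.map (φ n))) atTop
      (𝓝 (∫ y in Metric.closedBall ρE R, f y ∂(𝒴.ν.map φ')))

/-- Convergence in the pointed Gromov-vague topology. -/
def TendstoGromovVague (𝒳 : ℕ → RootedMeasureTree.{u}) (𝒴 : RootedMeasureTree.{u}) : Prop :=
  ∃ (E : Type u) (_ : MetricSpace E) (_ : CompleteSpace E)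
    (_ : TopologicalSpace.SeparableSpace E) (ρE : E) (φ : ∀ n, 𝒳 n → E) (φ' : 𝒴 → E),
    (∀ n, Isometry (φ n) ∧ φ n (𝒳 n).root = ρE) ∧ Isometry φ' ∧ φ' 𝒴.root = ρE ∧
      VagueConvergence ρE 𝒳 𝒴 φ φ'

/-- For every `R > 0`, the lengths of the edges of `T_n` with an end point in the `R`-ball around
the root stay bounded as `n → ∞`. -/
def EdgeLengthBound (𝒳 : ℕ → RootedMeasureTree.{u}) : Prop :=
  ∀ R : ℝ, 0 < R →
    limsup (fun n => ⨆ x ∈ Metric.ball (𝒳 n).root R, ⨆ z : 𝒳 n, ⨆ _ : IsEdge x z, edist x z)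
      atTop < ∞

/-- The local lower mass-bound property, uniformly in `n`. -/
def LocalLowerMassBound (𝒳 : ℕ → RootedMeasureTree.{u}) : Prop :=
  ∀ δ R : ℝ, 0 < δ → 0 < R →
    0 < ⨅ n, ⨅ x ∈ Metric.ball (𝒳 n).root R, (𝒳 n).ν (Metric.closedBall x δ)

/-! ### The Dirichlet form -/

section DirichletForm

variable (𝒳 : RootedMeasureTree.{u})

/-- The skeleton: the isolated points other than the root, and all open intervals `(ρ, a)`. -/
def skeleton : Set 𝒳 :=
  {x | x ≠ 𝒳.root ∧ IsOpen {x}} ∪ ⋃ a : 𝒳, arc 𝒳.root a \ {𝒳.root, a}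

/-- `l` is the length measure of the rooted tree (it is unique). -/
def IsLengthMeasure (l : Measure 𝒳) : Prop :=
  SigmaFinite l ∧ l (skeleton 𝒳)ᶜ = 0 ∧
    ∀ a : 𝒳, l (arc 𝒳.root a \ {𝒳.root}) = ENNReal.ofReal (dist 𝒳.root a)

/-- Local absolute continuity with respect to the length measure `l`. -/
def LocallyAbsolutelyContinuous (l : Measure 𝒳) (f : 𝒳 → ℝ) : Prop :=
  ∀ ε : ℝ, 0 < ε → ∀ S : Set 𝒳, l S < ∞ → ∃ δ : ℝ, 0 < δ ∧
    ∀ (m : ℕ) (x y : Fin m → 𝒳), (∀ i, arc (x i) (y i) ⊆ S) →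
      Pairwise (fun i j => Disjoint (arc (x i) (y i)) (arc (x j) (y j))) →
      ∑ i, dist (x i) (y i) < δ → ∑ i, |f (x i) - f (y i)| < ε

/-- `g` is a gradient of `f`. -/
def IsGradient (l : Measure 𝒳) (f g : 𝒳 → ℝ) : Prop :=
  (∀ a : 𝒳, IntegrableOn g (arc 𝒳.root a) l) ∧
    ∀ x y : 𝒳, f y - f x = (∫ z in arc 𝒳.root y, g z ∂l) - ∫ z in arc 𝒳.root x, g z ∂l

open Classical in
/-- The gradient of `f`, unique up to `l`-null sets (and `0` if `f` has no gradient). -/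
def gradient (l : Measure 𝒳) (f : 𝒳 → ℝ) : 𝒳 → ℝ :=
  if h : ∃ g, IsGradient 𝒳 l f g then h.choose else 0

/-- The form `ℰ(f, g) = ½ ∫ ∇f ∇g dl`. -/
def energy (l : Measure 𝒳) (f g : 𝒳 → ℝ) : ℝ :=
  (1 / 2) * ∫ z, gradient 𝒳 l f z * gradient 𝒳 l g z ∂l

/-- The domain `𝒟(ℰ)`: the continuous, locally absolutely continuous functions in `L²(ν)` which
vanish at infinity and have a gradient in `L²(l)`. -/
def formDomain (l : Measure 𝒳) : Set (𝒳 → ℝ) :=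
  {f | Continuous f ∧ LocallyAbsolutelyContinuous 𝒳 l f ∧ Tendsto f (cocompact 𝒳) (𝓝 0) ∧
    MemLp f 2 𝒳.ν ∧ (∃ g, IsGradient 𝒳 l f g) ∧ MemLp (gradient 𝒳 l f) 2 l}

/-- `v` lies in the closure of `𝒟(ℰ)` with respect to `ℰ₁ = ℰ + ⟨·,·⟩_ν`, as the limit of the
sequence `u`: the `u k ∈ 𝒟(ℰ)` are `ℰ`-Cauchy and converge to `v` in `L²(ν)`. As the form is
closable, the extension of `ℰ` to the closure is then given by `ℰ(v, h) = lim ℰ(u k, h)`. -/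
def IsFormLimit (l : Measure 𝒳) (u : ℕ → 𝒳 → ℝ) (v : 𝒳 → ℝ) : Prop :=
  (∀ k, u k ∈ formDomain 𝒳 l) ∧
    (∀ ε : ℝ, 0 < ε → ∃ N, ∀ j ≥ N, ∀ k ≥ N,
      energy 𝒳 l (u j - u k) (u j - u k) < ε) ∧
    Tendsto (fun k => eLpNorm (u k - v) 2 𝒳.ν) atTop (𝓝 0)

end DirichletForm

/-! ### Path space -/

/-- The space `D([0, ∞), S)` of càdlàg paths. -/
structure CadlagPath (S : Type u) [TopologicalSpace S] where
  toFun : ℝ≥0 → S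
  rightCts : ∀ t, ContinuousWithinAt toFun (Ici t) t
  leftLim : ∀ t, ∃ a, Tendsto toFun (𝓝[<] t) (𝓝 a)

instance (S : Type u) [TopologicalSpace S] : CoeFun (CadlagPath S) (fun _ => ℝ≥0 → S) :=
  ⟨CadlagPath.toFun⟩

/-- The σ-algebra on path space generated by the evaluations. -/
instance (S : Type u) [TopologicalSpace S] [MeasurableSpace S] :
    MeasurableSpace (CadlagPath S) :=
  ⨆ t : ℝ≥0, MeasurableSpace.comap (fun w : CadlagPath S => w t) inferInstance

/-- The σ-algebra generated by the path up to time `s`. -/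
abbrev pathPast (S : Type u) [TopologicalSpace S] [MeasurableSpace S] (s : ℝ≥0) :
    MeasurableSpace (CadlagPath S) :=
  ⨆ (t : ℝ≥0) (_ : t ≤ s), MeasurableSpace.comap (fun w : CadlagPath S => w t) inferInstance

/-- A basic Skorohod neighbourhood of the path `x`: the paths which are `V`-close to a time
change of `x` up to time `t`, where the time change is `ε`-close to the identity up to time `t`. -/
def skorohodNhd {S : Type u} [TopologicalSpace S] (x : CadlagPath S) (t : ℝ≥0) (ε : ℝ)
    (V : Set (S × S)) : Set (CadlagPath S) :=
  {y | ∃ c : ℝ≥0 ≃o ℝ≥0, ∀ s ≤ t, dist (c s) s < ε ∧ (x (c s), y s) ∈ V}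

/-- The Skorohod (J1) topology on `D([0, ∞), S)` for a compact metrizable space `S`. The
entourages of the unique uniformity of `S` are the neighbourhoods of the diagonal. A sequence
`x_n` converges to `x` iff for every `t` there are increasing bijections `c_n` of `[0, ∞)` with
`c_n(s) → s` and `d(x_n(s), x(c_n(s))) → 0`, uniformly in `s ≤ t`. -/
instance skorohodTopology (S : Type u) [TopologicalSpace S] :
    TopologicalSpace (CadlagPath S) where
  IsOpen U := ∀ x ∈ U, ∃ (t : ℝ≥0) (ε : ℝ) (V : Set (S × S)),
    0 < ε ∧ V ∈ 𝓝ˢ (diagonal S) ∧ skorohodNhd x t ε V ⊆ U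
  isOpen_univ := fun _ _ => ⟨0, 1, univ, one_pos, univ_mem, subset_univ _⟩
  isOpen_inter := by
    rintro U U' hU hU' x ⟨hx, hx'⟩
    obtain ⟨t, ε, V, hε, hV, h⟩ := hU x hx
    obtain ⟨t', ε', V', hε', hV', h'⟩ := hU' x hx'
    refine ⟨max t t', min ε ε', V ∩ V', lt_min hε hε', inter_mem hV hV', ?_⟩
    rintro y ⟨c, hc⟩
    exact ⟨h ⟨c, fun s hs => ⟨((hc s (hs.trans (le_max_left _ _))).1).trans_le (min_le_left _ _),
        (hc s (hs.trans (le_max_left _ _))).2.1⟩⟩,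
      h' ⟨c, fun s hs => ⟨((hc s (hs.trans (le_max_right _ _))).1).trans_le (min_le_right _ _),
        (hc s (hs.trans (le_max_right _ _))).2.2⟩⟩⟩
  isOpen_sUnion := by
    rintro 𝒰 h𝒰 x ⟨U, hU, hx⟩
    obtain ⟨t, ε, V, hε, hV, h⟩ := h𝒰 U hU x hx
    exact ⟨t, ε, V, hε, hV, h.trans (subset_sUnion_of_mem hU)⟩

instance (X : Type u) [TopologicalSpace X] : MeasurableSpace (OnePoint X) := borel _

instance (X : Type u) [TopologicalSpace X] : BorelSpace (OnePoint X) := ⟨rfl⟩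

/-- An isometric embedding `φ` of Heine-Borel spaces acts on paths in the one-point
compactifications; the point at infinity is mapped to the point at infinity. -/
def mapPath {T E : Type u} [MetricSpace T] [ProperSpace T] [MetricSpace E] [ProperSpace E]
    (φ : T → E) (hφ : Isometry φ) (w : CadlagPath (OnePoint T)) : CadlagPath (OnePoint E) where
  toFun t := OnePoint.map φ (w t)
  rightCts t := by
    have hc : Continuous (OnePoint.map φ) := by
      refine OnePoint.continuous_map hφ.continuous ?_
      rw [coclosedCompact_eq_cocompact, coclosedCompact_eq_cocompact]
      exact hφ.isClosedEmbedding.tendsto_cocompact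
    exact hc.continuousAt.comp_continuousWithinAt (w.rightCts t)
  leftLim t := by
    have hc : Continuous (OnePoint.map φ) := by
      refine OnePoint.continuous_map hφ.continuous ?_
      rw [coclosedCompact_eq_cocompact, coclosedCompact_eq_cocompact]
      exact hφ.isClosedEmbedding.tendsto_cocompact
    obtain ⟨a, ha⟩ := w.leftLim t
    exact ⟨OnePoint.map φ a, (hc.tendsto a).comp ha⟩

theorem measurable_mapPath {T E : Type u} [MetricSpace T] [ProperSpace T] [MetricSpace E]
    [ProperSpace E] (φ : T → E) (hφ : Isometry φ) : Measurable (mapPath φ hφ) := by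
  have hc : Continuous (OnePoint.map φ) := by
    refine OnePoint.continuous_map hφ.continuous ?_
    rw [coclosedCompact_eq_cocompact, coclosedCompact_eq_cocompact]
    exact hφ.isClosedEmbedding.tendsto_cocompact
  refine measurable_iff_comap_le.2 ?_
  change MeasurableSpace.comap (mapPath φ hφ) (⨆ t : ℝ≥0, MeasurableSpace.comap
    (fun w : CadlagPath (OnePoint E) => w t) inferInstance) ≤ _
  rw [MeasurableSpace.comap_iSup]
  refine iSup_le fun t => ?_
  rw [MeasurableSpace.comap_comp]
  have h : Measurable (fun w : CadlagPath (OnePoint T) => w t) :=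
    measurable_iff_comap_le.2
      (le_iSup (fun t : ℝ≥0 => MeasurableSpace.comap
        (fun w : CadlagPath (OnePoint T) => w t) inferInstance) t)
  exact (hc.measurable.comp h).comap_le

/-! ### The speed-`ν` motion -/

/-- A function on `T`, extended by `0` to the cemetery. -/
def extendZero {T : Type u} (f : T → ℝ) : OnePoint T → ℝ := OnePoint.rec 0 f

/-- The resolvent `G_α f(x) = 𝔼^x ∫₀^∞ e^{-αt} f(X_t) dt`, with `f = 0` at the cemetery. -/
def resolvent (𝒳 : RootedMeasureTree.{u})
    (Q : Kernel (OnePoint 𝒳) (CadlagPath (OnePoint 𝒳))) (α : ℝ) (f : 𝒳 → ℝ) (x : 𝒳) : ℝ :=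
  ∫ t in Ioi (0 : ℝ), Real.exp (-α * t) * ∫ w, extendZero f (w t.toNNReal) ∂(Q x)

/-- The family of laws `Q x = ℙ^x` on path space is the speed-`ν` motion: a (normal) Markov
process with cemetery `∞` whose resolvent is the resolvent of the closure of `(ℰ, 𝒟(ℰ))` on
`L²(ν)`, i.e. `G_α f` lies in the closure of the domain and
`ℰ(G_α f, h) + α ⟨G_α f, h⟩_ν = ⟨f, h⟩_ν` for `h ∈ 𝒟(ℰ)`. (In the discrete case this determines
all `Q x`; symmetry, and the strong Markov property, are consequences.) -/
structure IsSpeedMotion (𝒳 : RootedMeasureTree.{u})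
    (Q : Kernel (OnePoint 𝒳) (CadlagPath (OnePoint 𝒳))) : Prop where
  isMarkovKernel : IsMarkovKernel Q
  initial : ∀ x, ∀ᵐ w ∂(Q x), w 0 = x
  absorbed : ∀ᵐ w ∂(Q OnePoint.infty), ∀ t, w t = OnePoint.infty
  markov : ∀ (x : OnePoint 𝒳) (s t : ℝ≥0) (A : Set (CadlagPath (OnePoint 𝒳)))
    (B : Set (OnePoint 𝒳)), MeasurableSet[pathPast (OnePoint 𝒳) s] A → MeasurableSet B →
    Q x (A ∩ {w | w (s + t) ∈ B}) = ∫⁻ w in A, Q (w s) {w' | w' t ∈ B} ∂(Q x)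
  associated : ∃ l : Measure 𝒳, IsLengthMeasure 𝒳 l ∧
    ∀ (α : ℝ) (f : 𝒳 → ℝ), 0 < α → Measurable f → (∃ C, ∀ x, |f x| ≤ C) → MemLp f 2 𝒳.ν →
      ∃ u : ℕ → 𝒳 → ℝ, IsFormLimit 𝒳 l u (resolvent 𝒳 Q α f) ∧
        ∀ h ∈ formDomain 𝒳 l,
          Tendsto (fun k => energy 𝒳 l (u k) h + α * ∫ x, resolvent 𝒳 Q α f x * h x ∂𝒳.ν)
            atTop (𝓝 (∫ x, f x * h x ∂𝒳.ν))

/-- The law on path space of the process `(Q x)` with initial distribution `μ` on `T`. -/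
def walkLaw (𝒳 : RootedMeasureTree.{u})
    (Q : Kernel (OnePoint 𝒳) (CadlagPath (OnePoint 𝒳))) (μ : Measure 𝒳) :
    Measure (CadlagPath (OnePoint 𝒳)) :=
  (μ.map (fun x : 𝒳 => (x : OnePoint 𝒳))).bind Q

end SpeedWalk

end

noncomputable section

namespace SpeedWalk

universe u

/-! ### Partitions of the half line and time changes -/

/-! Paths form a relatively compact set in Skorohod space once, for every oscillation bound and time
horizon, they can all be cut into intervals of length at least some common δ on which they oscillate
little (`isCompact_partitioned`). `isTightMeasureSet_of_dyadicGood` reduces tightness to the same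
property along dyadic time grids, where the events are measurable and only finite pieces of Markov
chains occur. Finitely many laws may be disregarded, since a single law always satisfies the
condition.

For a Markov chain such partitions follow from a one-time estimate that is uniform in the starting
point: Ottaviani's inequality turns it into a bound for early exits, and an induction over first
exits (`IsMarkovChain.measure_not_gridGood_le`) bounds the probability that no partition exists. The
state space is the compact space E ∪ {∞}, so no compact containment is needed, and finitely many
tent functions, extended by 0 at ∞, control its metric up to a given error. What remains is that
|f(x) - f(X_s)| is small in probability for tent functions f, uniformly in the starting point x, in
small s and in large n. By Chebyshev's inequality for f and f² it suffices that the semigroup moves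
such functions little (`measure_lt_abs_sub_le`), and this follows if α G_α f is uniformly close to f
for one α (`abs_semigroup_sub_le`).

The resolvent estimate is where the trees enter. Write D for the Dirichlet integral. Testing the
weak equation for G = G_α F with v = α G - F gives, up to approximation, α∫v² ≤ D(F) and D(v) ≤ 2
D(F). The second bound makes v Hölder continuous of order 1/2, and the lower mass bound (A2) then
converts the small L² norm into a small supremum on a ball (`IsWeakResolvent.abs_sub_le`). Outside
the support of F the maximum principle bounds G by its values at the first vertices outside, which
stay in a fixed ball by (A0). Since the total length of a ball of T_n need not be bounded in n, a
Lipschitz function f may have unbounded energy. It is replaced by f ∘ π, where π retracts the tree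
onto the subtree spanned by a finite net; (A1) and (A2) bound the size of the net and hence the
energy (`exists_net`, `exists_mem_formDomain_near`).

The common Heine-Borel space is the closure of the union of the embedded trees: by (A2), points of
T_n far from the limit tree would carry mass that contradicts weak convergence
(`eventually_infDist_le`). -/

/-- The sequence `t` cuts `[0, ∞)` into intervals of length at least `δ`. -/
structure IsPartition (δ : ℝ≥0) (t : ℕ → ℝ≥0) : Prop where
  zero : t 0 = 0
  gap : ∀ i, t i + δ ≤ t (i + 1)

namespace IsPartition

variable {δ : ℝ≥0} {t : ℕ → ℝ≥0}

theorem mul_le (h : IsPartition δ t) (i : ℕ) : i * δ ≤ t i := by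
  induction i with
  | zero => simp
  | succ i ih =>
    refine le_trans ?_ (h.gap i)
    push_cast
    rw [add_mul, one_mul]
    gcongr

theorem strictMono (h : IsPartition δ t) (hδ : 0 < δ) : StrictMono t :=
  strictMono_nat_of_lt_succ fun i => (lt_add_of_pos_right _ hδ).trans_le (h.gap i)

theorem exists_gt (h : IsPartition δ t) (hδ : 0 < δ) (s : ℝ≥0) : ∃ k : ℕ, s < t k := by
  obtain ⟨k, hk⟩ := exists_nat_gt (s / δ)
  exact ⟨k, ((div_lt_iff₀ hδ).1 hk).trans_le (h.mul_le k)⟩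

theorem exists_mem_Ico (h : IsPartition δ t) (hδ : 0 < δ) (s : ℝ≥0) :
    ∃ i, t i ≤ s ∧ s < t (i + 1) := by
  classical
  have hex := h.exists_gt hδ s
  have h1 := Nat.find_spec hex
  have h0 : Nat.find hex ≠ 0 := by
    intro h0
    rw [h0, h.zero] at h1
    exact not_lt_zero h1
  obtain ⟨i, hi⟩ := Nat.exists_eq_succ_of_ne_zero h0
  refine ⟨i, ?_, by rw [hi] at h1; exact h1⟩
  exact not_lt.1 (Nat.find_min hex (by omega))

theorem exists_mem_Ioc (h : IsPartition δ t) (hδ : 0 < δ) {s : ℝ≥0} (hs : 0 < s) :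
    ∃ i, t i < s ∧ s ≤ t (i + 1) := by
  obtain ⟨i, hi, hi'⟩ := h.exists_mem_Ico hδ s
  rcases hi.lt_or_eq with h1 | h1
  · exact ⟨i, h1, hi'.le⟩
  · cases i with
    | zero => rw [h.zero] at h1; exact absurd h1 hs.ne
    | succ i => exact ⟨i, (h.strictMono hδ (Nat.lt_succ_self i)).trans_le hi, h1.ge⟩

end IsPartition

/-- The order isomorphism of `[0, ∞)` which is the identity up to `a` and has slope `q`
afterwards. -/
def stretch (a q : ℝ≥0) (hq : 0 < q) : ℝ≥0 ≃o ℝ≥0 :=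
  Equiv.toOrderIso
    { toFun := fun s => min s a + q * (s - a)
      invFun := fun s => min s a + q⁻¹ * (s - a)
      left_inv := by
        intro s
        rcases le_total s a with h | h
        · simp [h, tsub_eq_zero_of_le h]
        · simp only [min_eq_right h]
          rw [min_eq_right (le_add_right le_rfl), add_tsub_cancel_left, ← mul_assoc,
            inv_mul_cancel₀ hq.ne', one_mul, add_tsub_cancel_of_le h]
      right_inv := by
        intro s
        rcases le_total s a with h | h
        · simp [h, tsub_eq_zero_of_le h]
        · simp only [min_eq_right h]
          rw [min_eq_right (le_add_right le_rfl), add_tsub_cancel_left, ← mul_assoc,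
            mul_inv_cancel₀ hq.ne', one_mul, add_tsub_cancel_of_le h] }
    (fun s s' h => add_le_add (min_le_min_right _ h) (by gcongr))
    (fun s s' h => add_le_add (min_le_min_right _ h) (by gcongr))

theorem stretch_of_le {a q s : ℝ≥0} (hq : 0 < q) (h : s ≤ a) : stretch a q hq s = s := by
  change min s a + q * (s - a) = s
  simp [h, tsub_eq_zero_of_le h]

theorem stretch_add {a q : ℝ≥0} (hq : 0 < q) (s : ℝ≥0) :
    stretch a q hq (a + s) = a + q * s := by
  change min (a + s) a + q * (a + s - a) = _
  simp

/-- The piecewise linear time change which maps one partition to another one. -/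
theorem exists_timeChange {t τ : ℕ → ℝ≥0} (ht : StrictMono t) (hτ : StrictMono τ)
    (ht0 : t 0 = 0) (hτ0 : τ 0 = 0) {γ : ℝ} (k : ℕ) (h : ∀ i ≤ k, dist (τ i) (t i) ≤ γ) :
    ∃ c : ℝ≥0 ≃o ℝ≥0, (∀ i ≤ k, c (t i) = τ i) ∧ (∀ s ≤ t k, dist (c s) s ≤ γ) ∧
      ∀ s, c (t k + s) = τ k + s := by
  induction k with
  | zero =>
    refine ⟨OrderIso.refl _, ?_, ?_, ?_⟩
    · intro i hi
      obtain rfl : i = 0 := by omega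
      simp [ht0, hτ0]
    · intro s _
      simpa using le_trans dist_nonneg (h 0 le_rfl)
    · intro s
      simp [ht0, hτ0]
  | succ k ih =>
    obtain ⟨c, hc1, hc2, hc3⟩ := ih fun i hi => h i (by omega)
    have hlt := ht (Nat.lt_succ_self k)
    have hlτ := hτ (Nat.lt_succ_self k)
    obtain ⟨x, hx⟩ := exists_add_of_le hlt.le
    obtain ⟨y, hy⟩ := exists_add_of_le hlτ.le
    have hx0 : 0 < x := by
      rcases eq_or_ne x 0 with rfl | hne
      · simp at hx; exact absurd hx hlt.ne'
      · exact pos_iff_ne_zero.2 hne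
    have hy0 : 0 < y := by
      rcases eq_or_ne y 0 with rfl | hne
      · simp at hy; exact absurd hy hlτ.ne'
      · exact pos_iff_ne_zero.2 hne
    have hq : 0 < y / x := div_pos hy0 hx0
    have hq' : 0 < x / y := div_pos hx0 hy0
    -- The map `e` is the identity up to `t k`, has slope `y / x` on the next interval and slope 1
    -- afterwards. As `c` is a translation beyond `t k`, composing with `e` moves `t (k + 1)` to `τ
    -- (k + 1)` and leaves the earlier part unchanged.
    set e := (stretch (t k) (y / x) hq).trans (stretch (t k + y) (x / y) hq') with he
    have e1 : ∀ s ≤ t k, e s = s := fun s hs => by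
      rw [he, OrderIso.trans_apply, stretch_of_le _ hs,
        stretch_of_le _ (hs.trans (le_add_right le_rfl))]
    have e2 : ∀ s ≤ x, e (t k + s) = t k + y / x * s := fun s hs => by
      rw [he, OrderIso.trans_apply, stretch_add, stretch_of_le]
      gcongr
      calc y / x * s ≤ y / x * x := by gcongr
        _ = y := div_mul_cancel₀ _ hx0.ne'
    have e3 : ∀ s, e (t k + x + s) = t k + y + s := fun s => by
      rw [he, OrderIso.trans_apply, add_assoc, stretch_add]
      have : y / x * (x + s) = y + y / x * s := by
        rw [mul_add, div_mul_cancel₀ _ hx0.ne']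
      rw [this, ← add_assoc, stretch_add]
      congr 1
      field_simp
    refine ⟨e.trans c, ?_, ?_, ?_⟩
    · intro i hi
      rcases hi.lt_or_eq with hi | rfl
      · rw [OrderIso.trans_apply, e1 _ (ht.monotone (by omega)), hc1 i (by omega)]
      · have := e3 0
        rw [add_zero, add_zero] at this
        rw [OrderIso.trans_apply, hx, this, hc3, hy]
    · intro s hs
      rcases le_total s (t k) with h1 | h1
      · rw [OrderIso.trans_apply, e1 _ h1]
        exact hc2 s h1
      · obtain ⟨s, rfl⟩ := exists_add_of_le h1
        have hsx : s ≤ x := by rw [hx] at hs; exact le_of_add_le_add_left hs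
        rw [OrderIso.trans_apply, e2 _ hsx, hc3]
        have hA := h k (by omega)
        have hB := h (k + 1) le_rfl
        rw [hx, hy] at hB
        rw [NNReal.dist_eq] at hA hB ⊢
        push_cast at hA hB ⊢
        have hx0' : (0 : ℝ) < x := hx0
        set p : ℝ := s / x with hp
        have hp0 : 0 ≤ p := by positivity
        have hp1 : p ≤ 1 := by
          rw [hp, div_le_one hx0']; exact hsx
        have hs' : (s : ℝ) = p * x := by rw [hp]; field_simp
        -- On a linear piece the displacement is a convex combination of the displacements at the
        -- two ends.
        have : ((τ k : ℝ) + y / x * s - (t k + s))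
            = (1 - p) * (τ k - t k) + p * (τ k + y - (t k + x)) := by
          rw [hs']; field_simp; ring
        rw [this]
        rw [abs_le] at hA hB ⊢
        constructor <;> nlinarith
    · intro s
      rw [OrderIso.trans_apply, hx, e3, add_assoc, hc3, hy, add_assoc]

/-! ### Paths with a partition -/

section Path

variable {S : Type u} [MetricSpace S]

/-- Up to time `T`, the function `w` oscillates by at most `η` on each interval of some partition
into intervals of length at least `δ`. -/
def Partitioned (η : ℝ) (T δ : ℝ≥0) (w : ℝ≥0 → S) : Prop :=
  ∃ t, IsPartition δ t ∧ ∀ i s s', t i ≤ s → s < t (i + 1) → t i ≤ s' → s' < t (i + 1) →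
    s < T → s' < T → dist (w s) (w s') ≤ η

theorem Partitioned.mono {η : ℝ} {T δ δ' : ℝ≥0} {w : ℝ≥0 → S} (h : Partitioned η T δ w)
    (hδ : δ' ≤ δ) : Partitioned η T δ' w := by
  obtain ⟨t, ht, h⟩ := h
  exact ⟨t, ⟨ht.zero, fun i => (by gcongr : t i + δ' ≤ t i + δ).trans (ht.gap i)⟩, h⟩

/-- Cut points beyond the horizon are irrelevant and can be lowered to `T + i * δ` without
destroying the gaps. Each cut point then ranges over a compact interval, as the ultrafilter limits
below require. -/
theorem Partitioned.exists_bounded {η : ℝ} {T δ : ℝ≥0} {w : ℝ≥0 → S}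
    (h : Partitioned η T δ w) :
    ∃ t, IsPartition δ t ∧ (∀ i, t i ≤ T + i * δ) ∧
      ∀ i s s', t i ≤ s → s < t (i + 1) → t i ≤ s' → s' < t (i + 1) →
        s < T → s' < T → dist (w s) (w s') ≤ η := by
  obtain ⟨t, ht, h⟩ := h
  have hsucc : ∀ i : ℕ, T + ((i + 1 : ℕ) : ℝ≥0) * δ = T + i * δ + δ := fun i => by
    push_cast; ring
  refine ⟨fun i => min (t i) (T + i * δ), ⟨by simp [ht.zero], fun i => ?_⟩,
    fun i => min_le_right _ _, ?_⟩
  · simp only [hsucc]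
    rw [le_min_iff]
    exact ⟨(by gcongr; exact min_le_left _ _ : _ ≤ t i + δ).trans (ht.gap i),
      by gcongr; exact min_le_right _ _⟩
  · intro i s s' h1 h2 h3 h4 h5 h6
    beta_reduce at h1 h2 h3 h4
    have hle : t i ≤ T + i * δ := by
      by_contra hcon
      rw [min_eq_right (not_le.1 hcon).le] at h1
      exact absurd (h1.trans_lt h5) (not_lt.2 (le_add_right le_rfl))
    simp only [min_eq_left hle] at h1 h3
    exact h i s s' h1 (h2.trans_le (min_le_left _ _)) h3 (h4.trans_le (min_le_left _ _)) h5 h6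

/-- The set `A` of end points of finite partitions contains its supremum, if that is finite, because
of the left limit there, and can be prolonged beyond any of its points by right continuity. So it is
unbounded. -/
theorem CadlagPath.exists_partitioned (w : CadlagPath S) {η : ℝ} (hη : 0 < η) (T : ℝ≥0) :
    ∃ δ, 0 < δ ∧ Partitioned η T δ w := by
  set A : Set ℝ≥0 := {b | ∃ δ : ℝ≥0, 0 < δ ∧ ∃ (t : ℕ → ℝ≥0) (k : ℕ), IsPartition δ t ∧
    t k = b ∧ ∀ i < k, ∀ s s', t i ≤ s → s < t (i + 1) → t i ≤ s' → s' < t (i + 1) →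
      dist (w s) (w s') ≤ η} with hA
  have h0 : (0 : ℝ≥0) ∈ A := by
    refine ⟨1, one_pos, fun i => i, 0, ⟨by simp, fun i => by simp⟩, by simp, ?_⟩
    intro i hi
    omega
  have hext : ∀ b ∈ A, ∀ b', b < b' → (∀ s s', b ≤ s → s < b' → b ≤ s' → s' < b' →
      dist (w s) (w s') ≤ η) → b' ∈ A := by
    rintro b ⟨δ, hδ, t, k, ht, rfl, h⟩ b' hb hosc
    obtain ⟨x, rfl⟩ := exists_add_of_le hb.le
    have hx0 : 0 < x := by
      rcases eq_or_ne x 0 with rfl | hne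
      · simp at hb
      · exact pos_iff_ne_zero.2 hne
    refine ⟨min δ x, lt_min hδ hx0, fun i => if i ≤ k then t i else t k + (i - k : ℕ) * x,
      k + 1, ⟨by simp [ht.zero], fun i => ?_⟩, by simp, ?_⟩
    · by_cases h1 : i + 1 ≤ k
      · rw [if_pos (by omega), if_pos h1]
        exact (by gcongr; exact min_le_left _ _ : _ ≤ t i + δ).trans (ht.gap i)
      · rw [if_neg h1]
        by_cases h2 : i ≤ k
        · obtain rfl : i = k := by omega
          simp
        · rw [if_neg h2]
          have : i + 1 - k = (i - k) + 1 := by omega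
          rw [this]
          push_cast
          rw [add_mul, one_mul, add_assoc]
          gcongr
          exact min_le_right _ _
    · intro i hi s s'
      beta_reduce
      by_cases h1 : i + 1 ≤ k
      · rw [if_pos (by omega), if_pos h1]
        exact h i (by omega) s s'
      · obtain rfl : i = k := by omega
        simp only [le_refl, if_true, if_neg h1, add_tsub_cancel_left, Nat.cast_one, one_mul]
        exact hosc s s'
  have hright : ∀ b ∈ A, ∃ b' ∈ A, b < b' := by
    intro b hb
    have h1 := (w.rightCts b).tendsto
    have h2 := h1.eventually (Metric.ball_mem_nhds (w b) (half_pos hη))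
    obtain ⟨b', hb', hsub⟩ := mem_nhdsGE_iff_exists_Ico_subset.1 h2
    refine ⟨b', hext b hb b' hb' ?_, hb'⟩
    intro s s' h1 h2 h3 h4
    have e1 : dist (w s) (w b) < η / 2 := hsub ⟨h1, h2⟩
    have e2 : dist (w s') (w b) < η / 2 := hsub ⟨h3, h4⟩
    linarith [dist_triangle_right (w s) (w s') (w b)]
  have hunb : ¬ BddAbove A := by
    intro hbdd
    set c := sSup A with hc
    have hcA : c ∈ A := by
      by_contra hcA
      obtain ⟨a, ha⟩ := w.leftLim c
      have hcpos : 0 < c := by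
        rcases eq_or_ne c 0 with h | h
        · rw [h] at hcA; exact absurd h0 hcA
        · exact pos_iff_ne_zero.2 h
      have h2 := ha.eventually (Metric.ball_mem_nhds a (half_pos hη))
      obtain ⟨l, hl, hsub⟩ := (mem_nhdsLT_iff_exists_Ioo_subset' hcpos).1 h2
      obtain ⟨b, hb, hlb⟩ := exists_lt_of_lt_csSup ⟨0, h0⟩ hl
      have hbc : b < c := lt_of_le_of_ne (le_csSup hbdd hb) (fun h => hcA (h ▸ hb))
      refine hcA (hext b hb c hbc ?_)
      intro s s' h1 h2 h3 h4
      have e1 : dist (w s) a < η / 2 := hsub ⟨hlb.trans_le h1, h2⟩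
      have e2 : dist (w s') a < η / 2 := hsub ⟨hlb.trans_le h3, h4⟩
      linarith [dist_triangle_right (w s) (w s') a]
    obtain ⟨b', hb', hlt⟩ := hright c hcA
    exact absurd (le_csSup hbdd hb') (not_le.2 hlt)
  obtain ⟨b, hb, hTb⟩ := not_bddAbove_iff.1 hunb T
  obtain ⟨δ, hδ, t, k, ht, rfl, h⟩ := hb
  refine ⟨δ, hδ, t, ht, fun i s s' h1 h2 h3 h4 h5 h6 => h i ?_ s s' h1 h2 h3 h4⟩
  exact (ht.strictMono hδ).lt_iff_lt.1 (h1.trans_lt (h5.trans hTb))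

end Path

/-! ### Compact sets of paths -/

section Compact

variable {S : Type u} [MetricSpace S]

/-- The oscillation on open intervals passes to right limits, on half-open intervals. -/
theorem dist_le_of_tendsto_right {x z : ℝ≥0 → S} (hx : ∀ t, Tendsto z (𝓝[>] t) (𝓝 (x t)))
    {a b T : ℝ≥0} {η : ℝ} {p : S} (h : ∀ s, a < s → s < b → s < T → dist (z s) p ≤ η)
    {s : ℝ≥0} (h1 : a ≤ s) (h2 : s < b) (h3 : s < T) : dist (x s) p ≤ η := by
  refine le_of_tendsto ((hx s).dist tendsto_const_nhds) ?_
  filter_upwards [Ioo_mem_nhdsGT (lt_min h2 h3)] with s' hs'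
  have := lt_min_iff.1 hs'.2
  exact h s' (h1.trans_lt hs'.1) this.1 this.2

/-- The right limit is taken in one argument at a time; cut points, where `z` is not controlled,
become harmless. -/
theorem partitioned_of_tendsto_right {x z : ℝ≥0 → S}
    (hx : ∀ t, Tendsto z (𝓝[>] t) (𝓝 (x t))) {δ T : ℝ≥0} {η : ℝ} {τ : ℕ → ℝ≥0}
    (hτ : IsPartition δ τ) (h : ∀ i s s', τ i < s → s < τ (i + 1) → τ i < s' →
      s' < τ (i + 1) → s < T → s' < T → dist (z s) (z s') ≤ η) : Partitioned η T δ x := by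
  refine ⟨τ, hτ, fun i s s' h1 h2 h3 h4 h5 h6 => ?_⟩
  refine dist_le_of_tendsto_right hx (fun r hr1 hr2 hr3 => ?_) h1 h2 h5
  rw [dist_comm]
  refine dist_le_of_tendsto_right hx (fun r' hr1' hr2' hr3' => ?_) h3 h4 h6
  exact h i r' r hr1' hr2' hr1 hr2 hr3' hr3

variable [CompactSpace S]

theorem exists_nat_one_div_lt_and_lt {ε : ℝ} (hε : 0 < ε) (T : ℝ≥0) :
    ∃ l : ℕ, 1 / ((l : ℝ) + 1) < ε ∧ T < l := by
  obtain ⟨k, hk⟩ := exists_nat_one_div_lt hε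
  obtain ⟨k', hk'⟩ := exists_nat_gt T
  refine ⟨max k k', lt_of_le_of_lt ?_ hk, hk'.trans_le (by exact_mod_cast le_max_right _ _)⟩
  apply one_div_le_one_div_of_le
  · positivity
  · push_cast
    gcongr
    exact le_max_left _ _

/-- A function which has small oscillations on open intervals of partitions has a càdlàg
regularization. -/
theorem exists_cadlag_of_partitions {z : ℝ≥0 → S} {δ : ℕ → ℝ≥0} (hδ : ∀ l, 0 < δ l)
    {τ : ℕ → ℕ → ℝ≥0} (hτ : ∀ l, IsPartition (δ l) (τ l))
    (hz : ∀ (l i : ℕ) (s s' : ℝ≥0), τ l i < s → s < τ l (i + 1) → τ l i < s' →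
      s' < τ l (i + 1) → s < l → s' < l → dist (z s) (z s') ≤ 1 / ((l : ℝ) + 1)) :
    ∃ x : CadlagPath S, ∀ t, Tendsto z (𝓝[>] t) (𝓝 (x t)) := by
  -- A punctured right neighbourhood of `t` lies inside a single open interval of each partition, so
  -- `z` is Cauchy there.
  have hlim : ∀ t, ∃ a, Tendsto z (𝓝[>] t) (𝓝 a) := by
    intro t
    rw [← cauchy_map_iff_exists_tendsto, Metric.cauchy_iff]
    refine ⟨inferInstance, fun ε hε => ?_⟩
    obtain ⟨l, hl, htl⟩ := exists_nat_one_div_lt_and_lt hε t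
    obtain ⟨i, hi, hi'⟩ := (hτ l).exists_mem_Ico (hδ l) t
    refine ⟨z '' Ioo t (min (τ l (i + 1)) l),
      image_mem_map (Ioo_mem_nhdsGT (lt_min hi' htl)), ?_⟩
    rintro _ ⟨s, hs, rfl⟩ _ ⟨s', hs', rfl⟩
    have h1 := lt_min_iff.1 hs.2
    have h2 := lt_min_iff.1 hs'.2
    exact (hz l i s s' (hi.trans_lt hs.1) h1.1 (hi.trans_lt hs'.1) h2.1 h1.2 h2.2).trans_lt hl
  choose x hx using hlim
  have hpt : ∀ (l i : ℕ) (s : ℝ≥0) (p : S), τ l i ≤ s → s < τ l (i + 1) → s < l →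
      (∀ s', τ l i < s' → s' < τ l (i + 1) → s' < l → dist (z s') p ≤ 1 / ((l : ℝ) + 1)) →
      dist (x s) p ≤ 1 / ((l : ℝ) + 1) := by
    intro l i s p h1 h2 h3 h
    refine le_of_tendsto ((hx s).dist tendsto_const_nhds) ?_
    filter_upwards [Ioo_mem_nhdsGT (lt_min h2 h3)] with s' hs'
    have := lt_min_iff.1 hs'.2
    exact h s' (h1.trans_lt hs'.1) this.1 this.2
  have hosc : ∀ (l i : ℕ) (s s' : ℝ≥0), τ l i ≤ s → s < τ l (i + 1) → τ l i ≤ s' →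
      s' < τ l (i + 1) → s < l → s' < l → dist (x s) (x s') ≤ 1 / ((l : ℝ) + 1) := by
    intro l i s s' h1 h2 h3 h4 h5 h6
    refine hpt l i s _ h1 h2 h5 fun r hr1 hr2 hr3 => ?_
    rw [dist_comm]
    refine hpt l i s' _ h3 h4 h6 fun r' hr1' hr2' hr3' => ?_
    exact hz l i r' r hr1' hr2' hr1 hr2 hr3' hr3
  refine ⟨⟨x, fun t => ?_, fun t => ?_⟩, hx⟩
  · rw [ContinuousWithinAt, Metric.tendsto_nhds]
    intro ε hε
    obtain ⟨l, hl, htl⟩ := exists_nat_one_div_lt_and_lt hε t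
    obtain ⟨i, hi, hi'⟩ := (hτ l).exists_mem_Ico (hδ l) t
    filter_upwards [Ico_mem_nhdsGE (lt_min hi' htl)] with s hs
    have := lt_min_iff.1 hs.2
    exact (hosc l i s t (hi.trans hs.1) this.1 hi hi' this.2 htl).trans_lt hl
  · rcases eq_or_ne t 0 with rfl | ht
    · refine ⟨x 0, ?_⟩
      have : (𝓝[<] (0 : ℝ≥0)) = ⊥ := by simp
      rw [this]
      exact tendsto_bot
    have ht0 : 0 < t := pos_iff_ne_zero.2 ht
    have : (𝓝[<] t).NeBot := nhdsLT_neBot_of_exists_lt ⟨0, ht0⟩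
    rw [← cauchy_map_iff_exists_tendsto, Metric.cauchy_iff]
    refine ⟨inferInstance, fun ε hε => ?_⟩
    obtain ⟨l, hl, htl⟩ := exists_nat_one_div_lt_and_lt hε t
    -- For left limits the relevant interval is the one that may have `t` as its right end point.
    obtain ⟨i, hi, hi'⟩ := (hτ l).exists_mem_Ioc (hδ l) ht0
    refine ⟨x '' Ioo (τ l i) t, image_mem_map (Ioo_mem_nhdsLT hi), ?_⟩
    rintro _ ⟨s, hs, rfl⟩ _ ⟨s', hs', rfl⟩
    exact (hosc l i s s' hs.1.le (hs.2.trans_le hi') hs'.1.le (hs'.2.trans_le hi')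
      (hs.2.trans htl) (hs'.2.trans htl)).trans_lt hl

/-- Along an ultrafilter the paths converge pointwise to some `z` and their cut points converge to
limit partitions. Strict inequalities between times and limit cut points persist, so `z` inherits
the oscillation bounds on open intervals and has a càdlàg regularization `x`. Time changes that
match the cut points give Skorohod convergence to `x`. -/
theorem isCompact_partitioned (δ : ℕ → ℝ≥0) (hδ : ∀ l, 0 < δ l) :
    IsCompact {w : CadlagPath S | ∀ l : ℕ, Partitioned (1 / ((l : ℝ) + 1)) l (δ l) w} := by
  set K := {w : CadlagPath S | ∀ l : ℕ, Partitioned (1 / ((l : ℝ) + 1)) l (δ l) w} with hK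
  rw [isCompact_iff_ultrafilter_le_nhds]
  intro f hf
  have hfK : ∀ᶠ y in f, y ∈ K := le_principal_iff.1 hf
  have hzex : ∀ s : ℝ≥0, ∃ a, Tendsto (fun y : CadlagPath S => y s) f (𝓝 a) := by
    intro s
    obtain ⟨a, -, ha⟩ := isCompact_univ.ultrafilter_le_nhds
      (f.map fun y : CadlagPath S => y s) (by simp)
    exact ⟨a, ha⟩
  choose z hz using hzex
  have htex : ∀ (l : ℕ) (y : CadlagPath S), ∃ t : ℕ → ℝ≥0, y ∈ K →
      (IsPartition (δ l) t ∧ (∀ i, t i ≤ l + i * δ l) ∧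
        ∀ i s s', t i ≤ s → s < t (i + 1) → t i ≤ s' → s' < t (i + 1) →
          s < l → s' < l → dist (y s) (y s') ≤ 1 / ((l : ℝ) + 1)) := by
    intro l y
    by_cases hy : y ∈ K
    · obtain ⟨t, ht⟩ := (hy l).exists_bounded
      exact ⟨t, fun _ => ht⟩
    · exact ⟨0, fun h => absurd h hy⟩
  choose t ht using htex
  have hτex : ∀ l i : ℕ, ∃ a, Tendsto (fun y => t l y i) f (𝓝 a) := by
    intro l i
    obtain ⟨a, -, ha⟩ := (isCompact_Icc (a := (0 : ℝ≥0)) (b := l + i * δ l)).ultrafilter_le_nhds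
      (f.map fun y => t l y i) (by
        rw [le_principal_iff]
        change ∀ᶠ y in (f : Filter (CadlagPath S)), t l y i ∈ Icc 0 (l + i * δ l)
        filter_upwards [hfK] with y hy
        exact ⟨zero_le, (ht l y hy).2.1 i⟩)
    exact ⟨a, ha⟩
  choose τ hτ using hτex
  have hτp : ∀ l, IsPartition (δ l) (τ l) := by
    intro l
    refine ⟨tendsto_nhds_unique (hτ l 0) ?_, fun i => ?_⟩
    · refine tendsto_const_nhds.congr' ?_
      filter_upwards [hfK] with y hy
      exact (ht l y hy).1.zero.symm
    · refine le_of_tendsto_of_tendsto ((hτ l i).add_const (δ l)) (hτ l (i + 1)) ?_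
      filter_upwards [hfK] with y hy
      exact (ht l y hy).1.gap i
  have hzosc : ∀ (l i : ℕ) (s s' : ℝ≥0), τ l i < s → s < τ l (i + 1) → τ l i < s' →
      s' < τ l (i + 1) → s < l → s' < l → dist (z s) (z s') ≤ 1 / ((l : ℝ) + 1) := by
    intro l i s s' h1 h2 h3 h4 h5 h6
    refine le_of_tendsto ((hz s).dist (hz s')) ?_
    filter_upwards [hfK, (hτ l i).eventually (gt_mem_nhds h1),
      (hτ l i).eventually (gt_mem_nhds h3), (hτ l (i + 1)).eventually (lt_mem_nhds h2),
      (hτ l (i + 1)).eventually (lt_mem_nhds h4)] with y hy g1 g3 g2 g4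
    exact (ht l y hy).2.2 i s s' g1.le g2 g3.le g4 h5 h6
  obtain ⟨x, hx⟩ := exists_cadlag_of_partitions hδ hτp hzosc
  refine ⟨x, fun l => partitioned_of_tendsto_right hx (hτp l) (hzosc l), ?_⟩
  rw [le_nhds_iff]
  intro U hxU hU
  obtain ⟨t₀, ε, V, hε, hV, hsub⟩ := hU x hxU
  refine mem_of_superset ?_ hsub
  rw [nhdsSet_diagonal_eq_uniformity] at hV
  obtain ⟨η, hη, hVη⟩ := Metric.mem_uniformity_dist.1 hV
  -- Three errors will be added, hence `η / 3`; the summand `ε.toNNReal` keeps the time `c s` below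
  -- `l` as well.
  obtain ⟨l, hl, htl⟩ := exists_nat_one_div_lt_and_lt (ε := η / 3) (by positivity)
    (t₀ + ε.toNNReal)
  obtain ⟨k, hk⟩ := exists_nat_gt (t₀ / δ l)
  have hk : t₀ < k * δ l := (div_lt_iff₀ (hδ l)).1 hk
  have hmono := (hτp l).strictMono (hδ l)
  -- One sample time inside each limit interval suffices: closeness of `y` and `z` at finitely many
  -- times spreads over the intervals by the oscillation bounds.
  have hrex : ∀ i, ∃ r, τ l i < l → τ l i < r ∧ r < τ l (i + 1) ∧ r < l := by
    intro i
    by_cases hi : τ l i < l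
    · obtain ⟨r, hr1, hr2⟩ := exists_between (lt_min (hmono (Nat.lt_succ_self i)) hi)
      exact ⟨r, fun _ => ⟨hr1, (lt_min_iff.1 hr2).1, (lt_min_iff.1 hr2).2⟩⟩
    · exact ⟨0, fun h => absurd h hi⟩
  choose r hr using hrex
  have hE1 : ∀ᶠ y in f, ∀ i ∈ Finset.range (k + 1), dist (τ l i) (t l y i) ≤ ε / 2 := by
    rw [Filter.eventually_all_finset]
    intro i _
    filter_upwards [(hτ l i).eventually (Metric.closedBall_mem_nhds _ (half_pos hε))] with y hy
    rw [dist_comm]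
    exact hy
  have hE2 : ∀ᶠ y in f, ∀ i ∈ Finset.range (k + 1), τ l i < l →
      t l y i < r i ∧ r i < t l y (i + 1) ∧ dist (z (r i)) (y (r i)) ≤ 1 / ((l : ℝ) + 1) := by
    rw [Filter.eventually_all_finset]
    intro i _
    by_cases hi : τ l i < l
    · obtain ⟨h1, h2, -⟩ := hr i hi
      filter_upwards [(hτ l i).eventually (gt_mem_nhds h1),
        (hτ l (i + 1)).eventually (lt_mem_nhds h2), (hz (r i)).eventually
          (Metric.closedBall_mem_nhds _ (by positivity : (0 : ℝ) < 1 / ((l : ℝ) + 1)))]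
        with y g1 g2 g3 _
      refine ⟨g1, g2, ?_⟩
      rw [dist_comm]
      exact g3
    · exact Eventually.of_forall fun y h => absurd h hi
  filter_upwards [hfK, hE1, hE2] with y hy h1 h2
  obtain ⟨htp, -, htosc⟩ := ht l y hy
  have htmono := htp.strictMono (hδ l)
  obtain ⟨c, hc1, hc2, -⟩ := exists_timeChange htmono hmono htp.zero (hτp l).zero k
    (fun i hi => h1 i (Finset.mem_range.2 (by omega)))
  refine ⟨c, fun s hs => ?_⟩
  have hstk : s < t l y k := hs.trans_lt (hk.trans_le (htp.mul_le k))
  have hd := hc2 s hstk.le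
  refine ⟨by linarith, ?_⟩
  obtain ⟨i, hi, hi'⟩ := htp.exists_mem_Ico (hδ l) s
  have hik : i < k := htmono.lt_iff_lt.1 (hi.trans_lt hstk)
  have hci : τ l i ≤ c s := by rw [← hc1 i hik.le]; exact c.monotone hi
  have hci' : c s < τ l (i + 1) := by rw [← hc1 (i + 1) hik]; exact c.strictMono hi'
  have hcl : c s < l := by
    refine lt_of_le_of_lt ?_ htl
    rw [NNReal.dist_eq, abs_le] at hd
    rw [← NNReal.coe_le_coe]
    push_cast
    rw [Real.coe_toNNReal _ hε.le]
    have : (s : ℝ) ≤ t₀ := hs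
    linarith
  have hτl : τ l i < l := hci.trans_lt hcl
  obtain ⟨q1, q2, q3⟩ := hr i hτl
  obtain ⟨p1, p2, p3⟩ := h2 i (Finset.mem_range.2 (by omega)) hτl
  have hsl : s < l := hs.trans_lt (lt_of_le_of_lt (le_add_right le_rfl) htl)
  apply hVη
  have d1 : dist (x (c s)) (z (r i)) ≤ 1 / ((l : ℝ) + 1) :=
    dist_le_of_tendsto_right hx
      (fun s' g1 g2 g3 => hzosc l i s' (r i) g1 g2 q1 q2 g3 q3) hci hci' hcl
  have d2 : dist (y (r i)) (y s) ≤ 1 / ((l : ℝ) + 1) := htosc i _ _ p1.le p2 hi hi' q3 hsl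
  have := dist_triangle4 (x (c s)) (z (r i)) (y (r i)) (y s)
  linarith

end Compact

/-! ### Partitions of discrete time -/

/-- The cut points of the partition of `ℕ` whose `k`-th interval has length `D + L k`, where
`L k = M` beyond the end of the list `L`. -/
def cut (D M : ℕ) (L : List ℕ) (i : ℕ) : ℕ := ∑ k ∈ Finset.range i, (D + L.getD k M)

theorem cut_zero (D M : ℕ) (L : List ℕ) : cut D M L 0 = 0 := by simp [cut]

theorem cut_succ (D M : ℕ) (L : List ℕ) (i : ℕ) :
    cut D M L (i + 1) = cut D M L i + (D + L.getD i M) := by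
  simp [cut, Finset.sum_range_succ]

theorem cut_cons (D M g : ℕ) (L : List ℕ) (i : ℕ) :
    cut D M (g :: L) (i + 1) = D + g + cut D M L i := by
  simp [cut, Finset.sum_range_succ', add_comm]

theorem cut_mono (D M : ℕ) (L : List ℕ) : Monotone (cut D M L) :=
  monotone_nat_of_le_succ fun i => by rw [cut_succ]; omega

/-- Up to time `N`, the sequence `y` oscillates by at most `η` with respect to `ρ` on each
interval of some partition into intervals of length at least `D`. -/
def GridGood {S : Type u} (ρ : S → S → ℝ) (η : ℝ) (D M N : ℕ) (y : ℕ → S) : Prop :=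
  ∃ L : List ℕ, ∀ i a b, cut D M L i ≤ a → a < cut D M L (i + 1) → cut D M L i ≤ b →
    b < cut D M L (i + 1) → a ≤ N → b ≤ N → ρ (y a) (y b) ≤ η

theorem GridGood.imp {S S' : Type u} {ρ : S → S → ℝ} {ρ' : S' → S' → ℝ} {η η' : ℝ}
    {D M N : ℕ} {y : ℕ → S} {y' : ℕ → S'} (h : GridGood ρ η D M N y)
    (hρ : ∀ a b, ρ (y a) (y b) ≤ η → ρ' (y' a) (y' b) ≤ η') : GridGood ρ' η' D M N y' := by
  obtain ⟨L, hL⟩ := h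
  exact ⟨L, fun i a b h1 h2 h3 h4 h5 h6 => hρ a b (hL i a b h1 h2 h3 h4 h5 h6)⟩

section Grid

variable {S : Type u} [MetricSpace S]

/-- The restriction of a path to the grid of mesh `2⁻ᵐ`. -/
def grid (m : ℕ) (w : ℝ≥0 → S) (k : ℕ) : S := w (k / 2 ^ m)

/-- The path `w`, restricted to the grid of mesh `2⁻ᵐ`, has a partition. -/
def DyadicGood (η : ℝ) (T δ : ℝ≥0) (m : ℕ) (w : ℝ≥0 → S) : Prop :=
  GridGood (fun x y : S => dist x y) η ⌈δ * 2 ^ m⌉₊ ⌈T * 2 ^ m⌉₊ ⌈T * 2 ^ m⌉₊ (grid m w)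

/-- Partitions of the grid are encoded by lists of natural numbers, of which there are only
countably many, so the existential quantifier is a countable union. -/
theorem measurableSet_dyadicGood [CompactSpace S] [MeasurableSpace S] [BorelSpace S] (η : ℝ)
    (T δ : ℝ≥0) (m : ℕ) : MeasurableSet {w : CadlagPath S | DyadicGood η T δ m w} := by
  have hev : ∀ t : ℝ≥0, Measurable fun w : CadlagPath S => w t := fun t =>
    measurable_iff_comap_le.2
      (le_iSup (fun t : ℝ≥0 => MeasurableSpace.comap
        (fun w : CadlagPath S => w t) inferInstance) t)
  simp only [DyadicGood, GridGood, grid, Set.ofPred_exists, Set.ofPred_forall]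
  refine MeasurableSet.iUnion fun L => MeasurableSet.iInter fun i => MeasurableSet.iInter fun a =>
    MeasurableSet.iInter fun b => ?_
  repeat refine MeasurableSet.iInter fun _ => ?_
  exact measurableSet_le ((hev _).dist (hev _)) measurable_const

/-- The dyadic points above `s`. -/
theorem tendsto_ceil_div_pow (s : ℝ≥0) :
    Tendsto (fun m : ℕ => ((⌈s * 2 ^ m⌉₊ : ℕ) : ℝ≥0) / 2 ^ m) atTop (𝓝[≥] s) := by
  refine tendsto_nhdsWithin_iff.2 ⟨?_, Eventually.of_forall fun m => ?_⟩
  · have h1 : Tendsto (fun m : ℕ => s + (1 / 2 : ℝ≥0) ^ m) atTop (𝓝 (s + 0)) :=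
      tendsto_const_nhds.add (NNReal.tendsto_pow_atTop_nhds_zero_of_lt_one (by
        rw [div_lt_one] <;> norm_num))
    rw [add_zero] at h1
    refine tendsto_of_tendsto_of_tendsto_of_le_of_le tendsto_const_nhds h1 (fun m => ?_)
      fun m => ?_
    · exact (le_div_iff₀ (by positivity)).2 (Nat.le_ceil _)
    · beta_reduce
      rw [div_le_iff₀ (by positivity), add_mul, div_pow, one_pow,
        div_mul_cancel₀ _ (by positivity : (2 : ℝ≥0) ^ m ≠ 0)]
      exact (Nat.ceil_lt_add_one zero_le).le
  · exact (le_div_iff₀ (by positivity : (0 : ℝ≥0) < 2 ^ m)).2 (Nat.le_ceil _)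

/-- The cut points on the grids converge along an ultrafilter of meshes. Times strictly inside a
limit interval are approximated from above by grid points, and right continuity passes the
oscillation bound to the limit. -/
theorem partitioned_of_frequently_dyadicGood {η : ℝ} {T δ : ℝ≥0} (w : CadlagPath S)
    (h : ∃ᶠ m in atTop, DyadicGood η T δ m w) : Partitioned η T δ w := by
  obtain ⟨F, hFtop, hF⟩ : ∃ F : Ultrafilter ℕ, (F : Filter ℕ) ≤ atTop ∧
      ∀ᶠ m in F, DyadicGood η T δ m w := by
    have : (atTop ⊓ 𝓟 {m | DyadicGood η T δ m w}).NeBot := frequently_iff_neBot.1 h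
    refine ⟨Ultrafilter.of (atTop ⊓ 𝓟 {m | DyadicGood η T δ m w}),
      (Ultrafilter.of_le _).trans inf_le_left, ?_⟩
    exact le_principal_iff.1 ((Ultrafilter.of_le _).trans inf_le_right)
  have hpow : ∀ m : ℕ, (0 : ℝ≥0) < 2 ^ m := fun m => by positivity
  have htex : ∀ m : ℕ, ∃ t : ℕ → ℝ≥0, DyadicGood η T δ m w →
      (IsPartition δ t ∧ (∀ i, t i ≤ T + i * δ) ∧
        ∀ i s s', t i ≤ s → s < t (i + 1) → t i ≤ s' → s' < t (i + 1) →
          s < T → s' < T → (∃ a : ℕ, s = a / 2 ^ m) → (∃ a : ℕ, s' = a / 2 ^ m) →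
            dist (w s) (w s') ≤ η) := by
    intro m
    by_cases hm : DyadicGood η T δ m w
    swap
    · exact ⟨0, fun h => absurd h hm⟩
    obtain ⟨L, hL⟩ := hm
    set D := ⌈δ * 2 ^ m⌉₊ with hD
    set M := ⌈T * 2 ^ m⌉₊ with hM
    set q : ℕ → ℝ≥0 := fun i => (cut D M L i : ℝ≥0) / 2 ^ m with hq
    have hq0 : q 0 = 0 := by simp [hq, cut_zero]
    have hqgap : ∀ i, q i + δ ≤ q (i + 1) := by
      intro i
      simp only [hq]
      rw [cut_succ, le_div_iff₀ (hpow m), add_mul, div_mul_cancel₀ _ (hpow m).ne']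
      push_cast
      gcongr
      refine le_trans (Nat.le_ceil _) ?_
      exact le_add_right le_rfl
    have hsucc : ∀ i : ℕ, T + ((i + 1 : ℕ) : ℝ≥0) * δ = T + i * δ + δ := fun i => by
      push_cast; ring
    refine ⟨fun i => min (q i) (T + i * δ), fun _ => ⟨⟨by simp [hq0], fun i => ?_⟩,
      fun i => min_le_right _ _, ?_⟩⟩
    · simp only [hsucc]
      rw [le_min_iff]
      exact ⟨(by gcongr; exact min_le_left _ _ : _ ≤ q i + δ).trans (hqgap i),
        by gcongr; exact min_le_right _ _⟩
    · rintro i _ _ h1 h2 h3 h4 h5 h6 ⟨a, rfl⟩ ⟨b, rfl⟩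
      beta_reduce at h1 h2 h3 h4
      have hle : q i ≤ T + i * δ := by
        by_contra hcon
        rw [min_eq_right (not_le.1 hcon).le] at h1
        exact absurd (h1.trans_lt h5) (not_lt.2 (le_add_right le_rfl))
      rw [min_eq_left hle] at h1 h3
      have h2 := (lt_min_iff.1 h2).1
      have h4 := (lt_min_iff.1 h4).1
      simp only [hq] at h1 h2 h3 h4
      rw [div_le_div_iff_of_pos_right (hpow m)] at h1 h3
      rw [div_lt_div_iff_of_pos_right (hpow m)] at h2 h4
      rw [div_lt_iff₀ (hpow m)] at h5 h6
      refine hL i a b (by exact_mod_cast h1) (by exact_mod_cast h2) (by exact_mod_cast h3)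
        (by exact_mod_cast h4) ?_ ?_
      · exact Nat.cast_le.1 (h5.le.trans (Nat.le_ceil _))
      · exact Nat.cast_le.1 (h6.le.trans (Nat.le_ceil _))
  choose t ht using htex
  have hτex : ∀ i : ℕ, ∃ a, Tendsto (fun m => t m i) F (𝓝 a) := by
    intro i
    obtain ⟨a, -, ha⟩ := (isCompact_Icc (a := (0 : ℝ≥0)) (b := T + i * δ)).ultrafilter_le_nhds
      (F.map fun m => t m i) (by
        rw [le_principal_iff]
        change ∀ᶠ m in (F : Filter ℕ), t m i ∈ Icc 0 (T + i * δ)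
        filter_upwards [hF] with m hm
        exact ⟨zero_le, (ht m hm).2.1 i⟩)
    exact ⟨a, ha⟩
  choose τ hτ using hτex
  have hτp : IsPartition δ τ := by
    refine ⟨tendsto_nhds_unique (hτ 0) ?_, fun i => ?_⟩
    · refine tendsto_const_nhds.congr' ?_
      filter_upwards [hF] with m hm
      exact (ht m hm).1.zero.symm
    · refine le_of_tendsto_of_tendsto ((hτ i).add_const δ) (hτ (i + 1)) ?_
      filter_upwards [hF] with m hm
      exact (ht m hm).1.gap i
  have hright : ∀ s, Tendsto w (𝓝[>] s) (𝓝 (w s)) := fun s =>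
    (w.rightCts s).mono Ioi_subset_Ici_self
  refine partitioned_of_tendsto_right hright hτp ?_
  intro i s s' h1 h2 h3 h4 h5 h6
  have hconv : ∀ s, Tendsto (fun m : ℕ => ((⌈s * 2 ^ m⌉₊ : ℕ) : ℝ≥0) / 2 ^ m) F (𝓝 s) :=
    fun s => ((tendsto_ceil_div_pow s).mono_left hFtop).mono_right nhdsWithin_le_nhds
  have hwconv : ∀ s, Tendsto (fun m : ℕ => w (((⌈s * 2 ^ m⌉₊ : ℕ) : ℝ≥0) / 2 ^ m)) F
      (𝓝 (w s)) := fun s => (w.rightCts s).tendsto.comp ((tendsto_ceil_div_pow s).mono_left hFtop)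
  refine le_of_tendsto ((hwconv s).dist (hwconv s')) ?_
  filter_upwards [hF, (hτ i).eventually_lt (hconv s) h1, (hconv s).eventually_lt (hτ (i + 1)) h2,
    (hτ i).eventually_lt (hconv s') h3, (hconv s').eventually_lt (hτ (i + 1)) h4,
    (hconv s).eventually_lt tendsto_const_nhds h5,
    (hconv s').eventually_lt tendsto_const_nhds h6] with m hm g1 g2 g3 g4 g5 g6
  exact (ht m hm).2.2 i _ _ g1.le g2 g3.le g4 g5 g6 ⟨_, rfl⟩ ⟨_, rfl⟩

/-- Rounding the cut points up to the grid shortens gaps by at most a mesh, which the passage from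
`2 * δ` to `δ` absorbs on fine grids; `T + 1` absorbs the rounding of the horizon. -/
theorem eventually_dyadicGood {η : ℝ} {T δ : ℝ≥0} (hδ : 0 < δ) {w : ℝ≥0 → S}
    (h : Partitioned η (T + 1) (2 * δ) w) : ∀ᶠ m in atTop, DyadicGood η T δ m w := by
  obtain ⟨t, ht, h⟩ := h
  have hev : ∀ᶠ m : ℕ in atTop, 2 / δ ≤ 2 ^ m :=
    (tendsto_pow_atTop_atTop_of_one_lt (one_lt_two : (1 : ℝ≥0) < 2)).eventually_ge_atTop _
  filter_upwards [hev] with m hm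
  have hpow : (0 : ℝ≥0) < 2 ^ m := by positivity
  have hm' : 2 ≤ δ * 2 ^ m := by
    rw [div_le_iff₀ hδ] at hm
    rwa [mul_comm]
  set D := ⌈δ * 2 ^ m⌉₊ with hD
  set M := ⌈T * 2 ^ m⌉₊ with hM
  set j : ℕ → ℕ := fun i => ⌈t i * 2 ^ m⌉₊ with hj
  have hj0 : j 0 = 0 := by simp [hj, ht.zero]
  have hgap : ∀ i, j i + D ≤ j (i + 1) := by
    intro i
    have h1 : ((j i : ℕ) : ℝ≥0) < t i * 2 ^ m + 1 := Nat.ceil_lt_add_one zero_le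
    have h2 : ((D : ℕ) : ℝ≥0) < δ * 2 ^ m + 1 := Nat.ceil_lt_add_one zero_le
    have h3 : t (i + 1) * 2 ^ m ≤ ((j (i + 1) : ℕ) : ℝ≥0) := Nat.le_ceil _
    have h4 : (t i + 2 * δ) * 2 ^ m ≤ t (i + 1) * 2 ^ m := by gcongr; exact ht.gap i
    have : ((j i + D : ℕ) : ℝ≥0) < ((j (i + 1) : ℕ) : ℝ≥0) := by
      push_cast
      calc (j i : ℝ≥0) + D < (t i * 2 ^ m + 1) + (δ * 2 ^ m + 1) := add_lt_add h1 h2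
        _ = t i * 2 ^ m + δ * 2 ^ m + 2 := by ring
        _ ≤ t i * 2 ^ m + δ * 2 ^ m + δ * 2 ^ m := by gcongr
        _ = (t i + 2 * δ) * 2 ^ m := by ring
        _ ≤ _ := h4.trans h3
    exact le_of_lt (by exact_mod_cast this)
  have hD1 : 1 ≤ D := by
    have : 0 < D := Nat.ceil_pos.2 (by positivity)
    omega
  -- The list records how much each interval exceeds the minimal length `D`. Since `i ≤ j i`, the
  -- first `M + 1` intervals already cover all times up to `M`.
  set L : List ℕ := (List.range (M + 1)).map fun i => j (i + 1) - j i - D with hL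
  have hcut : ∀ i ≤ M + 1, cut D M L i = j i := by
    intro i
    induction i with
    | zero => intro _; rw [cut_zero, hj0]
    | succ i ih =>
      intro hi
      have hget : L.getD i M = j (i + 1) - j i - D := by
        have hlen : i < L.length := by rw [hL, List.length_map, List.length_range]; omega
        rw [List.getD_eq_getElem _ _ hlen]
        simp [hL]
      rw [cut_succ, ih (by omega), hget]
      have := hgap i
      omega
  have hjge : ∀ i, i ≤ j i := by
    intro i
    induction i with
    | zero => omega
    | succ i ih => have := hgap i; omega
  change GridGood _ η D M M _
  refine ⟨L, fun i a b h1 h2 h3 h4 h5 h6 => ?_⟩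
  have hi : i ≤ M := by
    by_contra hcon
    have := (cut_mono D M L) (show M + 1 ≤ i by omega)
    rw [hcut (M + 1) le_rfl] at this
    have := hjge (M + 1)
    omega
  rw [hcut i (by omega)] at h1 h3
  rw [hcut (i + 1) (by omega)] at h2 h4
  have hlt : ∀ a : ℕ, a ≤ M → (a : ℝ≥0) / 2 ^ m < T + 1 := by
    intro a ha
    rw [div_lt_iff₀ hpow]
    calc (a : ℝ≥0) ≤ M := by exact_mod_cast ha
      _ < T * 2 ^ m + 1 := Nat.ceil_lt_add_one zero_le
      _ ≤ T * 2 ^ m + 1 * 2 ^ m := by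
        gcongr
        rw [one_mul]
        exact one_le_pow₀ one_le_two
      _ = (T + 1) * 2 ^ m := by ring
  have hle : ∀ a : ℕ, j i ≤ a → t i ≤ (a : ℝ≥0) / 2 ^ m := by
    intro a ha
    rw [le_div_iff₀ hpow]
    exact Nat.ceil_le.1 ha
  have hlt' : ∀ a : ℕ, a < j (i + 1) → (a : ℝ≥0) / 2 ^ m < t (i + 1) := by
    intro a ha
    rw [div_lt_iff₀ hpow]
    exact Nat.lt_ceil.1 ha
  exact h i _ _ (hle a h1) (hlt' a h2) (hle b h3) (hlt' b h4) (hlt a h5) (hlt b h6)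

end Grid

/-! ### A criterion for tightness -/

section Tight

variable {S : Type u} [MetricSpace S] [CompactSpace S] [MeasurableSpace S] [BorelSpace S]

/-- Every path is eventually good on the grids for some level `d k`. The complements `C K` therefore
decrease to the empty set, and continuity from above applies to these measurable events instead of
to `Partitioned` itself. -/
theorem exists_measure_not_partitioned_le (P : Measure (CadlagPath S)) [IsFiniteMeasure P]
    {η : ℝ} (hη : 0 < η) (T : ℝ≥0) {ε : ℝ≥0∞} (hε : 0 < ε) :
    ∃ δ : ℝ≥0, 0 < δ ∧ P {w | ¬ Partitioned η T δ w} ≤ ε := by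
  set d : ℕ → ℝ≥0 := fun k => 1 / ((k : ℝ≥0) + 1) with hd
  have hd0 : ∀ k, 0 < d k := fun k => by positivity
  have hdanti : ∀ {k k' : ℕ}, k ≤ k' → d k' ≤ d k := fun {k k'} h =>
    one_div_le_one_div_of_le (by positivity) (by gcongr)
  set H : ℕ → Set (CadlagPath S) := fun k => ⋃ m₀ : ℕ, ⋂ m : ℕ, ⋂ _ : m₀ ≤ m,
    {w | DyadicGood η T (d k) m w} with hH
  have hHmeas : ∀ k, MeasurableSet (H k) := fun k => MeasurableSet.iUnion fun m₀ =>
    MeasurableSet.iInter fun m => MeasurableSet.iInter fun _ => measurableSet_dyadicGood _ _ _ _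
  have hHmem : ∀ k (w : CadlagPath S), w ∈ H k ↔ ∀ᶠ m in atTop, DyadicGood η T (d k) m w := by
    intro k w
    simp [hH, eventually_atTop]
  have hHall : ∀ w : CadlagPath S, ∃ k, w ∈ H k := by
    intro w
    obtain ⟨δ, hδ, hw⟩ := w.exists_partitioned hη (T + 1)
    obtain ⟨k, hk⟩ := exists_nat_one_div_lt (show (0 : ℝ) < δ / 2 by positivity)
    refine ⟨k, (hHmem k w).2 (eventually_dyadicGood (hd0 k) (hw.mono ?_))⟩
    rw [← NNReal.coe_le_coe]
    simp only [hd]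
    push_cast
    linarith
  set C : ℕ → Set (CadlagPath S) := fun K => (⋃ k ≤ K, H k)ᶜ with hC
  have hCanti : Antitone C := by
    intro K K' h
    apply compl_subset_compl.2
    exact biUnion_subset_biUnion_left fun k hk => le_trans hk h
  have hCmeas : ∀ K, NullMeasurableSet (C K) P := fun K =>
    ((MeasurableSet.iUnion fun k => MeasurableSet.iUnion fun _ => hHmeas k).compl).nullMeasurableSet
  have hCemp : ⋂ K, C K = ∅ := by
    rw [eq_empty_iff_forall_notMem]
    intro w hw
    obtain ⟨k, hk⟩ := hHall w
    exact mem_iInter.1 hw k (mem_iUnion₂.2 ⟨k, le_rfl, hk⟩)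
  have hlim := tendsto_measure_iInter_atTop hCmeas hCanti ⟨0, measure_ne_top P _⟩
  rw [hCemp, measure_empty] at hlim
  obtain ⟨K, hK⟩ := (hlim.eventually (gt_mem_nhds hε)).exists
  refine ⟨d K, hd0 K, (measure_mono ?_).trans hK.le⟩
  intro w hw hw'
  obtain ⟨k, hk, hkw⟩ := mem_iUnion₂.1 hw'
  exact hw ((partitioned_of_frequently_dyadicGood w ((hHmem k w).1 hkw).frequently).mono
    (hdanti hk))

/-- A sequence of laws on path space is tight if, up to finitely many members of the sequence,
the paths have partitions on all dyadic grids with high probability. -/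
theorem isTightMeasureSet_of_dyadicGood (P : ℕ → Measure (CadlagPath S))
    [∀ n, IsFiniteMeasure (P n)]
    (h : ∀ η : ℝ, 0 < η → ∀ (T : ℝ≥0) (ε : ℝ≥0∞), 0 < ε → ∃ δ : ℝ≥0, 0 < δ ∧
      ∀ᶠ n in atTop, ∀ᶠ m in atTop, P n {w | ¬ DyadicGood η T δ m w} ≤ ε) :
    IsTightMeasureSet (range P) := by
  have key : ∀ η : ℝ, 0 < η → ∀ (T : ℝ≥0) (ε : ℝ≥0∞), 0 < ε → ∃ δ : ℝ≥0, 0 < δ ∧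
      ∀ n, P n {w | ¬ Partitioned η T δ w} ≤ ε := by
    intro η hη T ε hε
    obtain ⟨δ, hδ, hn⟩ := h η hη T ε hε
    obtain ⟨n₀, hn₀⟩ := eventually_atTop.1 hn
    have hsingle := fun n => exists_measure_not_partitioned_le (P n) hη T hε
    choose δ' hδ' hP using hsingle
    have hfin : ∀ k : ℕ, ∃ r : ℝ≥0, 0 < r ∧ ∀ n < k, r ≤ δ' n := by
      intro k
      induction k with
      | zero => exact ⟨1, one_pos, by simp⟩
      | succ k ih =>
        obtain ⟨r, hr, hrk⟩ := ih
        refine ⟨min r (δ' k), lt_min hr (hδ' k), fun n hn => ?_⟩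
        rcases Nat.lt_succ_iff_lt_or_eq.1 hn with h1 | rfl
        · exact (min_le_left _ _).trans (hrk n h1)
        · exact min_le_right _ _
    obtain ⟨r, hr, hrn⟩ := hfin n₀
    refine ⟨min r δ, lt_min hr hδ, fun n => ?_⟩
    rcases lt_or_ge n n₀ with hlt | hge
    · refine (measure_mono ?_).trans (hP n)
      exact fun w hw hw' => hw (hw'.mono ((min_le_left _ _).trans (hrn n hlt)))
    · obtain ⟨m₀, hm₀⟩ := eventually_atTop.1 (hn₀ n hge)
      -- A path without partition is bad on all sufficiently fine grids, so it lies in the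
      -- increasing union of the sets `B k`, each of small measure.
      set B : ℕ → Set (CadlagPath S) := fun k => ⋂ m : ℕ, ⋂ _ : k ≤ m,
        {w | ¬ DyadicGood η T δ m w} with hB
      have hBmono : Monotone B := fun k k' hk =>
        biInter_subset_biInter_left fun m hm => le_trans hk hm
      have hsub : {w : CadlagPath S | ¬ Partitioned η T (min r δ) w} ⊆ ⋃ k, B k := by
        intro w hw
        have : ¬ ∃ᶠ m in atTop, DyadicGood η T δ m w := fun hf =>
          hw ((partitioned_of_frequently_dyadicGood w hf).mono (min_le_right _ _))
        rw [not_frequently, eventually_atTop] at this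
        obtain ⟨k, hk⟩ := this
        exact mem_iUnion.2 ⟨k, mem_iInter₂.2 hk⟩
      refine (measure_mono hsub).trans ?_
      rw [hBmono.measure_iUnion]
      refine iSup_le fun k => ?_
      refine (measure_mono ?_).trans (hm₀ (max k m₀) (le_max_right _ _))
      exact fun w hw => mem_iInter₂.1 hw (max k m₀) (le_max_left _ _)
  rw [isTightMeasureSet_iff_exists_isCompact_measure_compl_le]
  intro ε hε
  obtain ⟨ε', hε', hsum⟩ := ENNReal.exists_pos_sum_of_countable' hε.ne' ℕ
  have hδex := fun l : ℕ => key (1 / ((l : ℝ) + 1)) (by positivity) l (ε' l) (hε' l)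
  choose δ hδ hP using hδex
  refine ⟨_, isCompact_partitioned δ hδ, ?_⟩
  rintro _ ⟨n, rfl⟩
  have : {w : CadlagPath S | ∀ l : ℕ, Partitioned (1 / ((l : ℝ) + 1)) l (δ l) w}ᶜ =
      ⋃ l : ℕ, {w : CadlagPath S | ¬ Partitioned (1 / ((l : ℝ) + 1)) l (δ l) w} := by
    ext w; simp
  rw [this]
  exact ((measure_iUnion_le _).trans (ENNReal.tsum_le_tsum fun l => hP l n)).trans hsum.le

end Tight

/-! ### Oscillations of Markov chains -/

section Chain

variable {S : Type u}

/-- The set of sequences `A` is determined by the first coordinates, up to `N`. -/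
def Determined (N : ℕ) (A : Set (ℕ → S)) : Prop :=
  ∀ y y' : ℕ → S, (∀ i ≤ N, y i = y' i) → y ∈ A → y' ∈ A

theorem Determined.preimage_image {N : ℕ} {A : Set (ℕ → S)} (h : Determined N A) :
    (fun (y : ℕ → S) (i : Fin (N + 1)) => y i) ⁻¹'
      ((fun (y : ℕ → S) (i : Fin (N + 1)) => y i) '' A) = A := by
  ext y
  constructor
  · rintro ⟨y', hy', he⟩
    exact h y' y (fun i hi => congrFun he ⟨i, by omega⟩) hy'
  · exact fun hy => ⟨y, hy, rfl⟩

/-- The sequence from time `s` on. -/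
def shiftSeq (s : ℕ) (y : ℕ → S) (i : ℕ) : S := y (s + i)

/-- The sequences which move away from their starting point by more than `η` at time `s`, for
the first time. -/
def firstExit (ρ : S → S → ℝ) (η : ℝ) (s : ℕ) : Set (ℕ → S) :=
  {y | η < ρ (y 0) (y s) ∧ ∀ i < s, ρ (y 0) (y i) ≤ η}

theorem determined_firstExit (ρ : S → S → ℝ) (η : ℝ) (s : ℕ) :
    Determined s (firstExit ρ η s) := by
  rintro y y' h ⟨h1, h2⟩
  refine ⟨by rw [← h 0 (by omega), ← h s le_rfl]; exact h1, fun i hi => ?_⟩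
  rw [← h 0 (by omega), ← h i hi.le]
  exact h2 i hi

theorem exists_firstExit {ρ : S → S → ℝ} {η : ℝ} {y : ℕ → S} {k : ℕ}
    (h : η < ρ (y 0) (y k)) : ∃ s ≤ k, y ∈ firstExit ρ η s := by
  classical
  have hex : ∃ s, η < ρ (y 0) (y s) := ⟨k, h⟩
  exact ⟨Nat.find hex, Nat.find_min' hex h, Nat.find_spec hex,
    fun i hi => not_lt.1 (Nat.find_min hex hi)⟩

theorem determined_not_gridGood (ρ : S → S → ℝ) (η : ℝ) (D M N : ℕ) :
    Determined N {y | ¬ GridGood ρ η D M N y} := by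
  rintro y y' h hy ⟨L, hL⟩
  refine hy ⟨L, fun i a b h1 h2 h3 h4 h5 h6 => ?_⟩
  rw [h a h5, h b h6]
  exact hL i a b h1 h2 h3 h4 h5 h6

/-- Cut at the first exit from the η-neighbourhood of the starting point. If this happens at a time
`s > D`, the path oscillates by at most `2 * η` before `s`, and a good partition of the path after
`s` would extend to one of the whole path. -/
theorem not_gridGood_subset {ρ : S → S → ℝ} (hsymm : ∀ x y, ρ x y = ρ y x)
    (htri : ∀ x y z, ρ x z ≤ ρ x y + ρ y z) {η : ℝ} {D M N : ℕ} :
    {y | ¬ GridGood ρ (2 * η) D M N y} ⊆ {y | ∃ i ≤ D, η < ρ (y 0) (y i)} ∪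
      ⋃ s ∈ Finset.Ioc D N, (firstExit ρ η s ∩
        shiftSeq s ⁻¹' {y | ¬ GridGood ρ (2 * η) D M (N - s) y}) := by
  intro y hy
  by_cases hD' : ∃ i ≤ D, η < ρ (y 0) (y i)
  · exact Or.inl hD'
  right
  push Not at hD'
  have hpair : ∀ a b, ρ (y 0) (y a) ≤ η → ρ (y 0) (y b) ≤ η → ρ (y a) (y b) ≤ 2 * η := by
    intro a b h1 h2
    have h3 := htri (y a) (y 0) (y b)
    rw [hsymm (y a) (y 0)] at h3
    linarith
  by_cases hN : ∀ i ≤ N, ρ (y 0) (y i) ≤ η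
  -- Without an exit every partition is good.
  · refine absurd ⟨[], fun i a b h1 h2 h3 h4 h5 h6 => ?_⟩ hy
    exact hpair a b (hN a h5) (hN b h6)
  push Not at hN
  obtain ⟨k, hk, hky⟩ := hN
  obtain ⟨s, hs, hys⟩ := exists_firstExit hky
  have hDs : D < s := by
    by_contra hcon
    exact absurd hys.1 (not_lt.2 (hD' s (by omega)))
  refine mem_iUnion₂.2 ⟨s, Finset.mem_Ioc.2 ⟨hDs, by omega⟩, hys, ?_⟩
  rintro ⟨L, hL⟩
  -- The first interval then has length `D + (s - D) = s`.
  refine hy ⟨(s - D) :: L, fun i a b h1 h2 h3 h4 h5 h6 => ?_⟩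
  cases i with
  | zero =>
    rw [cut_cons, cut_zero] at h2 h4
    exact hpair a b (hys.2 a (by omega)) (hys.2 b (by omega))
  | succ i =>
    rw [cut_cons] at h1 h2 h3 h4
    have := hL i (a - s) (b - s) (by omega) (by omega) (by omega) (by omega) (by omega)
      (by omega)
    simp only [shiftSeq] at this
    rwa [show s + (a - s) = a by omega, show s + (b - s) = b by omega] at this

variable [MeasurableSpace S]

theorem measurable_prefix (N : ℕ) :
    Measurable (fun (y : ℕ → S) (i : Fin (N + 1)) => y i) :=
  measurable_pi_lambda _ fun i => measurable_pi_apply (i : ℕ)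

variable [Countable S] [DiscreteMeasurableSpace S]

/-- Finite products of `S` are countable, so every subset of them is measurable. No measurability of
`ρ` is needed. -/
theorem Determined.measurableSet {N : ℕ} {A : Set (ℕ → S)} (h : Determined N A) :
    MeasurableSet A := by
  rw [← h.preimage_image]
  exact measurable_prefix N (Set.to_countable _).measurableSet

/-- The laws `P x` of a time-homogeneous Markov chain started at `x`. -/
structure IsMarkovChain (P : S → Measure (ℕ → S)) : Prop where
  prob : ∀ x, IsProbabilityMeasure (P x)
  start : ∀ x, ∀ᵐ y ∂(P x), y 0 = x
  markov : ∀ (x a : S) (s N : ℕ) (A B : Set (ℕ → S)), Determined s A → Determined N B →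
    P x (A ∩ {y | y s = a} ∩ shiftSeq s ⁻¹' B) = P x (A ∩ {y | y s = a}) * P a B

variable {P : S → Measure (ℕ → S)}

/-- The Markov property is summed over the countably many states at time `s`. -/
theorem IsMarkovChain.measure_inter_shift_le (hP : IsMarkovChain P) {s N : ℕ}
    {A B : Set (ℕ → S)} (hA : Determined s A) (hB : Determined N B) {c : ℝ≥0∞}
    (hc : ∀ x, P x B ≤ c) (x : S) : P x (A ∩ shiftSeq s ⁻¹' B) ≤ P x A * c := by
  have hmeas : ∀ a : S, MeasurableSet {y : ℕ → S | y s = a} := fun a => by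
    have := measurable_pi_apply (X := fun _ : ℕ => S) s (MeasurableSet.of_discrete (s := {a}))
    exact this
  have h1 : ∀ C : Set (ℕ → S), C = ⋃ a : S, C ∩ {y | y s = a} := fun C => by
    ext y; simp
  have hdisj : Pairwise fun a b : S =>
      Disjoint (A ∩ {y : ℕ → S | y s = a}) (A ∩ {y | y s = b}) := by
    intro a b hab
    refine Set.disjoint_left.2 fun y hy hy' => hab ?_
    exact hy.2.symm.trans hy'.2
  calc P x (A ∩ shiftSeq s ⁻¹' B)
      ≤ ∑' a, P x (A ∩ {y | y s = a} ∩ shiftSeq s ⁻¹' B) := by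
        rw [h1 (A ∩ shiftSeq s ⁻¹' B)]
        refine (measure_iUnion_le _).trans (le_of_eq ?_)
        congr 1
        ext a
        congr 1
        ext y
        simp only [mem_inter_iff]
        tauto
    _ = ∑' a, P x (A ∩ {y | y s = a}) * P a B := by
        congr 1; ext a; exact hP.markov x a s N A B hA hB
    _ ≤ ∑' a, P x (A ∩ {y | y s = a}) * c := ENNReal.tsum_le_tsum fun a => by
        gcongr; exact hc a
    _ = P x A * c := by
        rw [ENNReal.tsum_mul_right, ← measure_iUnion hdisj
          (fun a => hA.measurableSet.inter (hmeas a)), ← h1]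

/-- First exits at different times are disjoint events. -/
theorem sum_measure_firstExit_le (μ : Measure (ℕ → S)) (ρ : S → S → ℝ) (η : ℝ)
    (I : Finset ℕ) :
    ∑ s ∈ I, μ (firstExit ρ η s) ≤ μ {y | ∃ s ∈ I, η < ρ (y 0) (y s)} := by
  rw [← measure_biUnion_finset]
  · refine measure_mono (iUnion₂_subset fun s hs y hy => ⟨s, hs, hy.1⟩)
  · intro s _ s' _ hne
    refine Set.disjoint_left.2 fun y hy hy' => hne ?_
    by_contra hcon
    rcases lt_or_gt_of_ne hcon with h | h
    · exact absurd hy.1 (not_lt.2 (hy'.2 s h))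
    · exact absurd hy'.1 (not_lt.2 (hy.2 s' h))
  · exact fun s _ => (determined_firstExit ρ η s).measurableSet

/-- Ottaviani's inequality. -/
theorem IsMarkovChain.measure_exit_le (hP : IsMarkovChain P) {ρ : S → S → ℝ}
    (hsymm : ∀ x y, ρ x y = ρ y x) (htri : ∀ x y z, ρ x z ≤ ρ x y + ρ y z) {η : ℝ} {D : ℕ}
    {a : ℝ≥0∞} (ha : ∀ x, ∀ i ≤ D, P x {y | η / 2 < ρ (y 0) (y i)} ≤ a) (x : S) :
    P x {y | ∃ i ≤ D, η < ρ (y 0) (y i)} ≤ 2 * a := by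
  have := hP.prob x
  set B : ℕ → Set (ℕ → S) := fun k => {y | η / 2 < ρ (y 0) (y k)} with hB
  have hBdet : ∀ k, Determined k (B k) := by
    intro k y y' h hy
    change η / 2 < ρ (y' 0) (y' k)
    rw [← h 0 (by omega), ← h k le_rfl]
    exact hy
  -- After the first exit, either the chain is still more than `η / 2` away from its start at time
  -- `D`, or it has moved by more than `η / 2` since the exit.
  have hsub : {y : ℕ → S | ∃ i ≤ D, η < ρ (y 0) (y i)} ⊆
      B D ∪ ⋃ s ∈ Finset.range (D + 1), (firstExit ρ η s ∩ shiftSeq s ⁻¹' B (D - s)) := by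
    rintro y ⟨i, hi, hy⟩
    obtain ⟨s, hs, hys⟩ := exists_firstExit hy
    by_cases h : y ∈ B D
    · exact Or.inl h
    · refine Or.inr (mem_iUnion₂.2 ⟨s, Finset.mem_range.2 (by omega), hys, ?_⟩)
      have h1 : ρ (y 0) (y D) ≤ η / 2 := not_lt.1 h
      have h2 := htri (y 0) (y D) (y s)
      have h3 := hsymm (y D) (y s)
      have h4 := hys.1
      change η / 2 < ρ (y (s + 0)) (y (s + (D - s)))
      rw [add_zero, show s + (D - s) = D by omega]
      linarith
  refine (measure_mono hsub).trans ((measure_union_le _ _).trans ?_)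
  rw [two_mul]
  refine add_le_add (ha x D le_rfl) ((measure_biUnion_finset_le _ _).trans ?_)
  calc ∑ s ∈ Finset.range (D + 1), P x (firstExit ρ η s ∩ shiftSeq s ⁻¹' B (D - s))
      ≤ ∑ s ∈ Finset.range (D + 1), P x (firstExit ρ η s) * a :=
        Finset.sum_le_sum fun s _ => hP.measure_inter_shift_le (determined_firstExit ρ η s)
          (hBdet (D - s)) (fun x => ha x (D - s) (Nat.sub_le _ _)) x
    _ ≤ 1 * a := by
        rw [← Finset.sum_mul]
        gcongr
        exact (sum_measure_firstExit_le _ _ _ _).trans prob_le_one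
    _ = a := one_mul a

/-- If a chain is unlikely to leave its starting point before time `D₀`, and very unlikely to
leave it before time `D`, then it has a partition into intervals of length `D` with high
probability. -/
theorem IsMarkovChain.measure_not_gridGood_le (hP : IsMarkovChain P) {ρ : S → S → ℝ}
    (hsymm : ∀ x y, ρ x y = ρ y x) (htri : ∀ x y z, ρ x z ≤ ρ x y + ρ y z) {η : ℝ}
    {D D₀ M : ℕ} (hD₀ : 0 < D₀)
    {β : ℝ≥0∞} (hβ : ∀ x, P x {y | ∃ i ≤ D, η < ρ (y 0) (y i)} ≤ β)
    (hβ₀ : ∀ x, P x {y | ∃ i ≤ D₀, η < ρ (y 0) (y i)} ≤ 1 / 4) (N : ℕ) (x : S) :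
    P x {y | ¬ GridGood ρ (2 * η) D M N y} ≤ 4 * β * 2 ^ (N / D₀) := by
  induction N using Nat.strong_induction_on generalizing x with
  | _ N ih =>
    have := hP.prob x
    set b : ℝ≥0∞ := 4 * β * 2 ^ (N / D₀) with hb
    -- An exit up to time `D₀` costs the full bound `b` but has probability at most 1/4. A later
    -- exit shortens the horizon by at least `D₀`, which halves the bound. With `β ≤ b / 4` for
    -- exits up to `D`, the induction closes as `b / 4 + b / 4 + b / 2 = b`.
    have hterm : ∀ s ∈ Finset.Ioc D N, P x (firstExit ρ η s ∩
        shiftSeq s ⁻¹' {y | ¬ GridGood ρ (2 * η) D M (N - s) y}) ≤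
        (if s ≤ D₀ then P x (firstExit ρ η s) else 0) * b + P x (firstExit ρ η s) * (b / 2) := by
      intro s hs
      rw [Finset.mem_Ioc] at hs
      have hle := hP.measure_inter_shift_le (determined_firstExit ρ η s)
        (determined_not_gridGood ρ (2 * η) D M (N - s))
        (fun x => ih (N - s) (by omega) x) x
      refine hle.trans ?_
      by_cases h : s ≤ D₀
      · rw [if_pos h]
        refine le_trans ?_ le_self_add
        rw [hb]
        gcongr
        · norm_num
        · omega
      · rw [if_neg h, zero_mul, zero_add]
        gcongr
        have h1 : (N - s) / D₀ + 1 ≤ N / D₀ := by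
          rw [← Nat.add_div_right _ hD₀]
          exact Nat.div_le_div_right (by omega)
        calc 4 * β * 2 ^ ((N - s) / D₀)
            = 4 * β * 2 ^ ((N - s) / D₀ + 1) / 2 := by
              rw [pow_succ, ← mul_assoc, ENNReal.mul_div_cancel_right (by norm_num) (by norm_num)]
          _ ≤ b / 2 := by
              rw [hb]
              gcongr
              norm_num
    refine (measure_mono (not_gridGood_subset hsymm htri)).trans
      ((measure_union_le _ _).trans ?_)
    have hsum : P x (⋃ s ∈ Finset.Ioc D N, (firstExit ρ η s ∩
        shiftSeq s ⁻¹' {y | ¬ GridGood ρ (2 * η) D M (N - s) y})) ≤ b / 4 + b / 2 := by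
      refine (measure_biUnion_finset_le _ _).trans ((Finset.sum_le_sum hterm).trans ?_)
      rw [Finset.sum_add_distrib, ← Finset.sum_mul, ← Finset.sum_mul]
      refine add_le_add ?_ ?_
      · rw [← Finset.sum_filter]
        calc _ ≤ 1 / 4 * b := by
              gcongr
              refine (sum_measure_firstExit_le _ _ _ _).trans ((measure_mono ?_).trans (hβ₀ x))
              rintro y ⟨s, hs, hy⟩
              exact ⟨s, (Finset.mem_filter.1 hs).2, hy⟩
          _ = b / 4 := by rw [mul_comm, mul_one_div]
      · calc _ ≤ 1 * (b / 2) := by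
              gcongr
              exact (sum_measure_firstExit_le _ _ _ _).trans prob_le_one
          _ = b / 2 := one_mul _
    have hβb : β ≤ b / 4 := by
      rw [ENNReal.le_div_iff_mul_le (by norm_num) (by norm_num), hb, mul_comm β 4]
      exact le_mul_of_one_le_right' (one_le_pow₀ (by norm_num))
    calc P x {y | ∃ i ≤ D, η < ρ (y 0) (y i)} + P x (⋃ s ∈ Finset.Ioc D N, (firstExit ρ η s ∩
          shiftSeq s ⁻¹' {y | ¬ GridGood ρ (2 * η) D M (N - s) y}))
        ≤ b / 4 + (b / 4 + b / 2) := add_le_add ((hβ x).trans hβb) hsum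
      _ = b := by
        have h4 : b / 4 + b / 4 = b / 2 := by
          rw [ENNReal.div_add_div_same, ← two_mul, mul_comm,
            ENNReal.div_eq_div_iff (by norm_num) (by norm_num) (by norm_num) (by norm_num)]
          ring
        rw [← add_assoc, h4, ENNReal.add_halves]

end Chain

/-! ### The chain on a dyadic grid -/

section GridChain

variable {S : Type u} [TopologicalSpace S] [MeasurableSpace S]

theorem measurable_eval (t : ℝ≥0) : Measurable fun w : CadlagPath S => w t :=
  measurable_iff_comap_le.2 (le_iSup (fun t : ℝ≥0 => MeasurableSpace.comap
    (fun w : CadlagPath S => w t) inferInstance) t)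

theorem measurableSet_pathPast {s t : ℝ≥0} (h : t ≤ s) {B : Set S} (hB : MeasurableSet B) :
    MeasurableSet[pathPast S s] {w : CadlagPath S | w t ∈ B} := by
  have : MeasurableSpace.comap (fun w : CadlagPath S => w t) inferInstance ≤ pathPast S s :=
    le_iSup₂ (f := fun (t : ℝ≥0) (_ : t ≤ s) => MeasurableSpace.comap
      (fun w : CadlagPath S => w t) inferInstance) t h
  exact this _ ⟨B, hB, rfl⟩

theorem pathPast_le (s : ℝ≥0) : pathPast S s ≤ (inferInstance : MeasurableSpace (CadlagPath S)) :=
  iSup₂_le fun t _ => (measurable_eval t).comap_le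

theorem measurable_grid (m : ℕ) : Measurable fun w : CadlagPath S => grid m w :=
  measurable_pi_lambda _ fun _ => measurable_eval _

variable [Countable S] [DiscreteMeasurableSpace S]

theorem measurableSet_pathPast_of_determined (m : ℕ) {s : ℕ}
    {A : Set (ℕ → S)} (hA : Determined s A) :
    MeasurableSet[pathPast S (s / 2 ^ m)] {w : CadlagPath S | grid m w ∈ A} := by
  have h1 : {w : CadlagPath S | grid m w ∈ A} =
      (fun (w : CadlagPath S) (i : Fin (s + 1)) => grid m w i) ⁻¹'
        ((fun (y : ℕ → S) (i : Fin (s + 1)) => y i) '' A) := by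
    ext w
    exact (iff_of_eq (congrArg (grid m w ∈ ·) hA.preimage_image)).symm
  rw [h1]
  refine @measurable_pi_lambda _ _ _ (pathPast S (s / 2 ^ m)) _ _ (fun i => ?_) _
    (Set.to_countable _).measurableSet
  intro B hB
  refine measurableSet_pathPast ?_ hB
  gcongr
  exact_mod_cast Nat.lt_succ_iff.1 i.2

/-- The hypothesis concerns one future time only. Induction on the length of a cylinder gives the
finite-dimensional statement, and two measures on a countable product are compared on singletons to
reach all sets determined by finitely many coordinates. -/
theorem isMarkovChain_grid (Q : Kernel S (CadlagPath S)) (hQ : IsMarkovKernel Q)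
    (hstart : ∀ x, ∀ᵐ w ∂(Q x), w 0 = x)
    (hmarkov : ∀ (x : S) (s t : ℝ≥0) (A : Set (CadlagPath S)) (B : Set S),
      MeasurableSet[pathPast S s] A → MeasurableSet B →
      Q x (A ∩ {w | w (s + t) ∈ B}) = ∫⁻ w in A, Q (w s) {w' | w' t ∈ B} ∂(Q x)) (m : ℕ) :
    IsMarkovChain fun x => (Q x).map fun w : CadlagPath S => grid m w := by
  have hstep : ∀ (x a : S) (k : ℕ) (A : Set (CadlagPath S)) (c : S),
      MeasurableSet[pathPast S (k / 2 ^ m)] A → (∀ w ∈ A, w (k / 2 ^ m) = a) →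
      Q x (A ∩ {w | grid m w (k + 1) = c}) = Q x A * Q a {w | w (1 / 2 ^ m) = c} := by
    intro x a k A c hA hAa
    have h := hmarkov x (k / 2 ^ m) (1 / 2 ^ m) A {c} hA MeasurableSet.of_discrete
    have h1 : {w : CadlagPath S | grid m w (k + 1) = c} =
        {w : CadlagPath S | w ((k : ℝ≥0) / 2 ^ m + 1 / 2 ^ m) ∈ ({c} : Set S)} := by
      ext w
      simp only [grid, mem_ofPred_eq, mem_singleton_iff]
      rw [← add_div]
      push_cast
      rfl
    rw [h1, h]
    have h2 : ∫⁻ w in A, Q (w (k / 2 ^ m)) {w' | w' (1 / 2 ^ m) ∈ ({c} : Set S)} ∂(Q x) =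
        ∫⁻ _ in A, Q a {w | w (1 / 2 ^ m) = c} ∂(Q x) :=
      setLIntegral_congr_fun (pathPast_le _ _ hA) fun w hw => by
        simp only [hAa w hw, mem_singleton_iff]
    rw [h2, setLIntegral_const, mul_comm]
  classical
  have hstart0 : ∀ a b : S, Q a {w | grid m w 0 = b} = if a = b then 1 else 0 := by
    intro a b
    have h0 : ∀ w : CadlagPath S, grid m w 0 = w 0 := fun w => by simp [grid]
    split_ifs with h
    · subst h
      refine le_antisymm prob_le_one ?_
      rw [← measure_univ (μ := Q a)]
      refine measure_mono_ae ?_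
      filter_upwards [hstart a] with w hw _
      exact (h0 w).trans hw
    · rw [measure_eq_zero_iff_ae_notMem]
      filter_upwards [hstart a] with w hw hw'
      exact h (hw.symm.trans ((h0 w).symm.trans hw'))
  have hcyl : ∀ (x a : S) (s : ℕ) (A : Set (ℕ → S)), Determined s A → ∀ (b : ℕ → S) (k : ℕ),
      Q x {w | grid m w ∈ A ∧ grid m w s = a ∧ ∀ i ≤ k, grid m w (s + i) = b i} =
        Q x {w | grid m w ∈ A ∧ grid m w s = a} * Q a {w | ∀ i ≤ k, grid m w i = b i} := by
    intro x a s A hA b k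
    induction k with
    | zero =>
      have h1 : {w : CadlagPath S | ∀ i ≤ 0, grid m w i = b i} =
          {w : CadlagPath S | grid m w 0 = b 0} := by
        ext w; simp
      rw [h1, hstart0]
      split_ifs with h
      · rw [mul_one]
        congr 1
        ext w
        simp only [mem_ofPred_eq, nonpos_iff_eq_zero, forall_eq, add_zero, ← h]
        tauto
      · rw [mul_zero]
        convert measure_empty (μ := Q x)
        ext w
        simp only [mem_ofPred_eq, nonpos_iff_eq_zero, forall_eq, add_zero, mem_empty_iff_false,
          iff_false]
        rintro ⟨-, h1, h2⟩
        exact h (h1.symm.trans h2)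
    | succ k ih =>
      set C : Set (CadlagPath S) :=
        {w | grid m w ∈ A ∧ grid m w s = a ∧ ∀ i ≤ k, grid m w (s + i) = b i} with hC
      have hCmeas : MeasurableSet[pathPast S (((s + k : ℕ) : ℝ≥0) / 2 ^ m)] C := by
        refine measurableSet_pathPast_of_determined m
          (A := {y | y ∈ A ∧ y s = a ∧ ∀ i ≤ k, y (s + i) = b i}) ?_
        rintro y y' h ⟨h1, h2, h3⟩
        exact ⟨hA y y' (fun i hi => h i (by omega)) h1, by rw [← h s (by omega)]; exact h2,
          fun i hi => by rw [← h (s + i) (by omega)]; exact h3 i hi⟩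
      set C' : Set (CadlagPath S) := {w | ∀ i ≤ k, grid m w i = b i} with hC'
      have hCmeas' : MeasurableSet[pathPast S ((k : ℝ≥0) / 2 ^ m)] C' := by
        refine measurableSet_pathPast_of_determined m (A := {y | ∀ i ≤ k, y i = b i}) ?_
        exact fun y y' h h1 i hi => by rw [← h i hi]; exact h1 i hi
      have e1 := hstep x (b k) (s + k) C (b (k + 1)) hCmeas fun w hw => hw.2.2 k le_rfl
      have e2 := hstep a (b k) k C' (b (k + 1)) hCmeas' fun w hw => hw k le_rfl
      have s1 : {w : CadlagPath S | grid m w ∈ A ∧ grid m w s = a ∧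
          ∀ i ≤ k + 1, grid m w (s + i) = b i} = C ∩ {w | grid m w (s + k + 1) = b (k + 1)} := by
        ext w
        simp only [hC, mem_inter_iff, mem_ofPred_eq, Nat.le_succ_iff]
        constructor
        · rintro ⟨h1, h2, h3⟩
          exact ⟨⟨h1, h2, fun i hi => h3 i (Or.inl hi)⟩, h3 (k + 1) (Or.inr rfl)⟩
        · rintro ⟨⟨h1, h2, h3⟩, h4⟩
          refine ⟨h1, h2, ?_⟩
          rintro i (hi | rfl)
          · exact h3 i hi
          · exact h4
      have s2 : {w : CadlagPath S | ∀ i ≤ k + 1, grid m w i = b i} =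
          C' ∩ {w | grid m w (k + 1) = b (k + 1)} := by
        ext w
        simp only [hC', mem_inter_iff, mem_ofPred_eq, Nat.le_succ_iff]
        constructor
        · exact fun h => ⟨fun i hi => h i (Or.inl hi), h (k + 1) (Or.inr rfl)⟩
        · rintro ⟨h3, h4⟩ i (hi | rfl)
          · exact h3 i hi
          · exact h4
      rw [s1, s2, e1, e2, ih, mul_assoc]
  refine ⟨fun x => Measure.isProbabilityMeasure_map (measurable_grid m).aemeasurable,
    fun x => ?_, ?_⟩
  · have h0 := measurable_pi_apply (X := fun _ : ℕ => S) 0 (MeasurableSet.of_discrete (s := {x}))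
    refine (ae_map_iff (measurable_grid m).aemeasurable h0).2 ?_
    filter_upwards [hstart x] with w hw
    simpa [grid] using hw
  · intro x a s N A B hA hB
    have hsa : Determined s (A ∩ {y | y s = a}) := fun y y' h hy =>
      ⟨hA y y' h hy.1, by change y' s = a; rw [← h s le_rfl]; exact hy.2⟩
    have hshift : Measurable (shiftSeq (S := S) s) :=
      measurable_pi_lambda _ fun i => measurable_pi_apply (s + i)
    set pre := fun (y : ℕ → S) (i : Fin (N + 1)) => y i with hpre
    set μ₁ : Measure (Fin (N + 1) → S) :=
      (((Q x).map fun w : CadlagPath S => grid m w).restrict (A ∩ {y | y s = a})).map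
        (pre ∘ shiftSeq s) with hμ₁
    set μ₂ : Measure (Fin (N + 1) → S) :=
      ((Q x).map (fun w : CadlagPath S => grid m w) (A ∩ {y | y s = a})) •
        ((Q a).map fun w : CadlagPath S => grid m w).map pre with hμ₂
    have hpm : Measurable (pre ∘ shiftSeq s) := (measurable_prefix N).comp hshift
    have heq : μ₁ = μ₂ := by
      refine Measure.ext_of_singleton fun b => ?_
      rw [hμ₁, hμ₂, Measure.smul_apply, smul_eq_mul, Measure.map_apply hpm (by measurability),
        Measure.restrict_apply (hpm (by measurability)),
        Measure.map_apply (measurable_prefix N) (by measurability),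
        Measure.map_apply (measurable_grid m)
          ((measurable_prefix N) (by measurability)),
        Measure.map_apply (measurable_grid m) hsa.measurableSet,
        Measure.map_apply (measurable_grid m)
          ((hpm (by measurability)).inter hsa.measurableSet)]
      set b' : ℕ → S := fun i => b (Fin.ofNat (N + 1) i) with hb'
      have hb'' : ∀ y : ℕ → S, pre y = b ↔ ∀ i ≤ N, y i = b' i := by
        intro y
        constructor
        · intro h i hi
          rw [hb', ← h]
          simp [hpre, Nat.mod_eq_of_lt (show i < N + 1 by omega)]
        · intro h
          ext i
          have := h i (by omega)
          simp only [hb', Fin.ofNat_eq_cast, Fin.cast_val_eq_self] at this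
          exact this
      have := hcyl x a s A hA b' N
      convert this using 2
      · ext w
        simp only [mem_preimage, mem_inter_iff, Function.comp_apply, mem_singleton_iff, hb'',
          mem_ofPred_eq, shiftSeq]
        tauto
      · congr 1
      · congr 1
        ext w
        exact hb'' (grid m w)
    have hB' := hB.preimage_image
    have hm : MeasurableSet (pre '' B) := (Set.to_countable _).measurableSet
    have h1 := congrArg (fun μ => μ (pre '' B)) heq
    simp only [hμ₁, hμ₂, Measure.smul_apply, smul_eq_mul] at h1
    rw [Measure.map_apply hpm hm, Measure.restrict_apply (hpm hm),
      Measure.map_apply (measurable_prefix N) hm, hB', preimage_comp, hB'] at h1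
    rw [inter_comm]
    exact h1

end GridChain

/-! ### The Cauchy-Schwarz inequality for integrals -/

section CauchySchwarz

variable {α : Type*} [MeasurableSpace α] {μ : Measure α} {f g : α → ℝ}

/-- The quadratic polynomial ∫(f + t g)² in t is nonnegative, so its discriminant is not positive.
-/
theorem sq_integral_mul_le (hf : MemLp f 2 μ) (hg : MemLp g 2 μ) :
    (∫ x, f x * g x ∂μ) ^ 2 ≤ (∫ x, f x ^ 2 ∂μ) * ∫ x, g x ^ 2 ∂μ := by
  have hff := hf.integrable_sq
  have hgg := hg.integrable_sq
  have hfg : Integrable (fun x => f x * g x) μ := hf.integrable_mul hg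
  have h : ∀ t : ℝ, 0 ≤ (∫ x, g x ^ 2 ∂μ) * (t * t) + (2 * ∫ x, f x * g x ∂μ) * t
      + ∫ x, f x ^ 2 ∂μ := by
    intro t
    have h1 : ∫ x, (f x + t * g x) ^ 2 ∂μ = (∫ x, g x ^ 2 ∂μ) * (t * t)
        + (2 * ∫ x, f x * g x ∂μ) * t + ∫ x, f x ^ 2 ∂μ := by
      have : ∀ x, (f x + t * g x) ^ 2 = (t * t) * g x ^ 2 + (2 * t) * (f x * g x) + f x ^ 2 :=
        fun x => by ring
      simp only [this]
      have hi : Integrable (fun x => (t * t) * g x ^ 2 + (2 * t) * (f x * g x)) μ :=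
        (hgg.const_mul _).add (hfg.const_mul _)
      rw [integral_add hi hff,
        integral_add (hgg.const_mul _) (hfg.const_mul _), integral_const_mul, integral_const_mul]
      ring
    rw [← h1]
    exact integral_nonneg fun x => sq_nonneg _
  have := discrim_le_zero h
  rw [discrim] at this
  nlinarith

theorem sq_setIntegral_abs_le (hg : MemLp g 2 μ) {A : Set α} (hA : MeasurableSet A)
    (hA' : μ A ≠ ∞) : (∫ x in A, |g x| ∂μ) ^ 2 ≤ (μ A).toReal * ∫ x, g x ^ 2 ∂μ := by
  have h1 : MemLp (A.indicator fun _ => (1 : ℝ)) 2 μ := memLp_indicator_const 2 hA 1 (Or.inr hA')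
  have h2 := sq_integral_mul_le h1 hg.abs
  have e1 : ∫ x, A.indicator (fun _ => (1 : ℝ)) x * |g| x ∂μ = ∫ x in A, |g x| ∂μ := by
    rw [← integral_indicator hA]
    congr 1
    ext x
    by_cases hx : x ∈ A <;> simp [hx]
  have e2 : ∫ x, A.indicator (fun _ => (1 : ℝ)) x ^ 2 ∂μ = (μ A).toReal := by
    have : ∀ x, A.indicator (fun _ => (1 : ℝ)) x ^ 2 = A.indicator 1 x := fun x => by
      by_cases hx : x ∈ A <;> simp [hx]
    simp only [this]
    rw [integral_indicator_one hA]
    rfl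
  rw [e1, e2] at h2
  simpa using h2

end CauchySchwarz

/-! ### The order of a rooted tree -/

section Tree

variable (𝒳 : RootedMeasureTree.{u})

/-- The distance from the root. -/
abbrev height (x : 𝒳) : ℝ := dist 𝒳.root x

/-- The points between the root and `x`. -/
abbrev ancestors (x : 𝒳) : Set 𝒳 := arc 𝒳.root x

variable {𝒳}

theorem mem_ancestors {a x : 𝒳} : a ∈ ancestors 𝒳 x ↔ height 𝒳 a + dist a x = height 𝒳 x :=
  Iff.rfl

theorem self_mem_ancestors (x : 𝒳) : x ∈ ancestors 𝒳 x := by simp [mem_ancestors]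

theorem root_mem_ancestors (x : 𝒳) : 𝒳.root ∈ ancestors 𝒳 x := by simp [mem_ancestors]

theorem height_le_of_mem_ancestors {a x : 𝒳} (h : a ∈ ancestors 𝒳 x) :
    height 𝒳 a ≤ height 𝒳 x := by
  rw [mem_ancestors] at h
  linarith [dist_nonneg (x := a) (y := x)]

theorem ancestors_trans {a b c : 𝒳} (h : a ∈ ancestors 𝒳 b) (h' : b ∈ ancestors 𝒳 c) :
    a ∈ ancestors 𝒳 c := by
  rw [mem_ancestors] at *
  have h1 := dist_triangle a b c
  have h2 := dist_triangle 𝒳.root a c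
  simp only [height] at *
  linarith

theorem ancestors_subset {a x : 𝒳} (h : a ∈ ancestors 𝒳 x) : ancestors 𝒳 a ⊆ ancestors 𝒳 x :=
  fun _ hb => ancestors_trans hb h

theorem eq_of_mem_ancestors {a x : 𝒳} (h : a ∈ ancestors 𝒳 x)
    (h' : height 𝒳 x ≤ height 𝒳 a) : a = x := by
  rw [mem_ancestors] at h
  have : dist a x ≤ 0 := by linarith
  exact dist_le_zero.1 this

/-- The four-point condition for the root, `x`, `a` and `b` makes the ancestors of `x` a chain
ordered by height. -/
theorem mem_ancestors_of_height_le {a b x : 𝒳} (ha : a ∈ ancestors 𝒳 x)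
    (hb : b ∈ ancestors 𝒳 x) (h : height 𝒳 a ≤ height 𝒳 b) : a ∈ ancestors 𝒳 b := by
  have h4 := 𝒳.four_point 𝒳.root x a b
  rw [mem_ancestors] at *
  simp only [height] at *
  have h2 := dist_triangle 𝒳.root a b
  rw [dist_comm x b, dist_comm x a] at h4
  rcases le_max_iff.1 h4 with h5 | h5 <;> linarith

/-- The branch point of the root, `x` and `y` is their last common ancestor: a higher one would
violate the triangle inequality between `x` and `y`. -/
theorem exists_meet (x y : 𝒳) : ∃ c, c ∈ ancestors 𝒳 x ∧ c ∈ ancestors 𝒳 y ∧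
    dist x c + dist c y = dist x y ∧ ancestors 𝒳 x ∩ ancestors 𝒳 y = ancestors 𝒳 c := by
  obtain ⟨c, h1, h2, h3⟩ := 𝒳.exists_branch_point 𝒳.root x y
  have hx : c ∈ ancestors 𝒳 x := by rw [mem_ancestors, dist_comm c x]; exact h1
  have hy : c ∈ ancestors 𝒳 y := by rw [mem_ancestors, dist_comm c y]; exact h2
  refine ⟨c, hx, hy, by rw [dist_comm c y]; exact h3, ?_⟩
  apply subset_antisymm
  · rintro a ⟨hax, hay⟩
    refine mem_ancestors_of_height_le hax hx ?_
    by_contra hcon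
    have e1 := mem_ancestors.1 hax
    have e2 := mem_ancestors.1 hay
    have t := dist_triangle_left x y a
    simp only [height] at *
    linarith
  · exact subset_inter (ancestors_subset hx) (ancestors_subset hy)

theorem mem_arc_of_mem_ancestors {x y c a : 𝒳} (hc : c ∈ ancestors 𝒳 y)
    (hxy : dist x c + dist c y = dist x y) (ha : a ∈ ancestors 𝒳 y) (hac : a ∉ ancestors 𝒳 c) :
    a ∈ arc x y := by
  have hle : height 𝒳 c ≤ height 𝒳 a := by
    by_contra hcon
    exact hac (mem_ancestors_of_height_le ha hc (not_le.1 hcon).le)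
  have h1 := mem_ancestors.1 (mem_ancestors_of_height_le hc ha hle)
  have h2 := mem_ancestors.1 ha
  have h3 := mem_ancestors.1 hc
  change dist x a + dist a y = dist x y
  have t1 := dist_triangle x c a
  have t2 := dist_triangle x a y
  simp only [height] at *
  linarith

variable {l : Measure 𝒳}

theorem IsLengthMeasure.singleton_root (hl : IsLengthMeasure 𝒳 l) : l {𝒳.root} = 0 := by
  refine measure_mono_null (singleton_subset_iff.2 ?_) hl.2.1
  rintro (h | h)
  · exact h.1 rfl
  · obtain ⟨a, ha⟩ := mem_iUnion.1 h
    exact ha.2 (Or.inl rfl)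

theorem IsLengthMeasure.ancestors (hl : IsLengthMeasure 𝒳 l) (x : 𝒳) :
    l (ancestors 𝒳 x) = ENNReal.ofReal (height 𝒳 x) := by
  rw [← hl.2.2 x, measure_sdiff_null hl.singleton_root]

variable [DiscreteTopology 𝒳]

theorem finite_of_isBounded {s : Set 𝒳} (hs : Bornology.IsBounded s) : s.Finite :=
  (isCompact_iff_finite.1 hs.isCompact_closure).subset subset_closure

theorem finite_height_le (R : ℝ) : {x : 𝒳 | height 𝒳 x ≤ R}.Finite := by
  refine finite_of_isBounded (Metric.isBounded_closedBall (x := 𝒳.root) (r := R) |>.subset ?_)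
  intro x hx
  rw [Metric.mem_closedBall, dist_comm]
  exact hx

theorem finite_ancestors (x : 𝒳) : (ancestors 𝒳 x).Finite :=
  (finite_height_le (height 𝒳 x)).subset fun _ ha => height_le_of_mem_ancestors ha

instance : DiscreteMeasurableSpace 𝒳 := ⟨fun s => (isOpen_discrete s).measurableSet⟩

instance : Countable 𝒳 := TopologicalSpace.separableSpace_iff_countable.1 inferInstance

/-- By the Heine-Borel property a discrete tree has finite balls, so there is a highest proper
ancestor. -/
theorem exists_parent {x : 𝒳} (hx : x ≠ 𝒳.root) : ∃ p ∈ ancestors 𝒳 x, p ≠ x ∧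
    ∀ a ∈ ancestors 𝒳 x, a ≠ x → a ∈ ancestors 𝒳 p := by
  have hfin : (ancestors 𝒳 x \ {x}).Finite := (finite_ancestors x).subset sdiff_subset
  obtain ⟨p, hp, hmax⟩ := hfin.exists_maximalFor (height 𝒳) _
    ⟨𝒳.root, root_mem_ancestors x, fun h => hx (mem_singleton_iff.1 h).symm⟩
  refine ⟨p, hp.1, hp.2, fun a ha hax => ?_⟩
  refine mem_ancestors_of_height_le ha hp.1 ?_
  rcases le_total (height 𝒳 a) (height 𝒳 p) with h | h
  · exact h
  · exact hmax ⟨ha, hax⟩ h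

open Classical in
/-- The neighbour of `x` in the direction of the root. -/
def parent (x : 𝒳) : 𝒳 := if h : x = 𝒳.root then x else (exists_parent h).choose

theorem parent_spec {x : 𝒳} (hx : x ≠ 𝒳.root) : parent x ∈ ancestors 𝒳 x ∧ parent x ≠ x ∧
    ∀ a ∈ ancestors 𝒳 x, a ≠ x → a ∈ ancestors 𝒳 (parent x) := by
  rw [parent, dif_neg hx]
  exact (exists_parent hx).choose_spec

theorem ancestors_eq_insert {x : 𝒳} (hx : x ≠ 𝒳.root) :
    ancestors 𝒳 x = insert x (ancestors 𝒳 (parent x)) := by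
  obtain ⟨h1, -, h3⟩ := parent_spec hx
  ext a
  rw [mem_insert_iff]
  constructor
  · intro ha
    by_cases hax : a = x
    · exact Or.inl hax
    · exact Or.inr (h3 a ha hax)
  · rintro (rfl | ha)
    · exact self_mem_ancestors a
    · exact ancestors_trans ha h1

theorem height_parent_lt {x : 𝒳} (hx : x ≠ 𝒳.root) : height 𝒳 (parent x) < height 𝒳 x := by
  obtain ⟨h1, h2, -⟩ := parent_spec hx
  by_contra hcon
  exact h2 (eq_of_mem_ancestors h1 (not_lt.1 hcon))

theorem notMem_ancestors_parent {x : 𝒳} (hx : x ≠ 𝒳.root) : x ∉ ancestors 𝒳 (parent x) :=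
  fun h => absurd (height_le_of_mem_ancestors h) (not_le.2 (height_parent_lt hx))

theorem dist_parent_pos {x : 𝒳} (hx : x ≠ 𝒳.root) : 0 < dist (parent x) x :=
  dist_pos.2 (parent_spec hx).2.1

theorem isEdge_parent {x : 𝒳} (hx : x ≠ 𝒳.root) : IsEdge (parent x) x := by
  obtain ⟨h1, h2, h3⟩ := parent_spec hx
  refine ⟨h2, ?_⟩
  ext a
  simp only [mem_insert_iff, mem_singleton_iff]
  constructor
  · intro ha
    have ha : dist (parent x) a + dist a x = dist (parent x) x := ha
    have e1 := mem_ancestors.1 h1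
    have t1 := dist_triangle 𝒳.root (parent x) a
    have t2 := dist_triangle 𝒳.root a x
    by_cases hax : a = x
    · exact Or.inr hax
    · left
      have hanc : a ∈ ancestors 𝒳 x := by
        rw [mem_ancestors]
        simp only [height] at *
        linarith
      have h4 := height_le_of_mem_ancestors (h3 a hanc hax)
      rw [mem_ancestors] at hanc
      have : dist a (parent x) ≤ 0 := by
        rw [dist_comm]
        simp only [height] at *
        linarith
      exact dist_le_zero.1 this
  · rintro (rfl | rfl)
    · simp [arc]
    · simp [arc]

/-- Induction on the number of ancestors. -/
theorem tree_induction {p : 𝒳 → Prop} (h0 : p 𝒳.root)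
    (h : ∀ x, x ≠ 𝒳.root → p (parent x) → p x) (x : 𝒳) : p x := by
  have hfin : ∀ x, (ancestors 𝒳 x).Finite := finite_ancestors
  induction hn : (ancestors 𝒳 x).ncard using Nat.strong_induction_on generalizing x with
  | _ n ih =>
    by_cases hx : x = 𝒳.root
    · rw [hx]; exact h0
    · refine h x hx (ih _ ?_ (parent x) rfl)
      rw [← hn]
      refine ncard_lt_ncard ?_ (hfin x)
      rw [ancestors_eq_insert hx]
      exact ssubset_insert (notMem_ancestors_parent hx)

/-! ### Gradients on discrete trees -/

/-- The atom at `x` stands for the edge from `x` to its parent, so the length measure is an explicit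
atomic measure and gradients become difference quotients. -/
theorem IsLengthMeasure.singleton (hl : IsLengthMeasure 𝒳 l) {x : 𝒳} (hx : x ≠ 𝒳.root) :
    l {x} = ENNReal.ofReal (dist (parent x) x) := by
  have h1 := hl.ancestors x
  rw [ancestors_eq_insert hx, insert_eq, measure_union
    (disjoint_singleton_left.2 (notMem_ancestors_parent hx)) MeasurableSet.of_discrete,
    hl.ancestors, ← mem_ancestors.1 (parent_spec hx).1,
    ENNReal.ofReal_add dist_nonneg dist_nonneg, add_comm] at h1
  exact (ENNReal.add_right_inj ENNReal.ofReal_ne_top).1 h1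

theorem IsLengthMeasure.singleton_lt_top (hl : IsLengthMeasure 𝒳 l) (x : 𝒳) : l {x} < ∞ := by
  by_cases hx : x = 𝒳.root
  · rw [hx, hl.singleton_root]; simp
  · rw [hl.singleton hx]; exact ENNReal.ofReal_lt_top

theorem IsLengthMeasure.integrableOn_ancestors (hl : IsLengthMeasure 𝒳 l) (g : 𝒳 → ℝ) (x : 𝒳) :
    IntegrableOn g (SpeedWalk.ancestors 𝒳 x) l := by
  have hs : ∀ x, IntegrableOn g {x} l := fun x =>
    integrableOn_singleton (hx := (hl.singleton_lt_top x))
  induction x using tree_induction with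
  | h0 =>
    have : SpeedWalk.ancestors 𝒳 𝒳.root = {𝒳.root} := by
      ext a
      rw [mem_singleton_iff]
      constructor
      · intro h
        exact eq_of_mem_ancestors h (by simp [height])
      · rintro rfl
        exact self_mem_ancestors _
    rw [this]
    exact hs _
  | h x hx ih =>
    rw [ancestors_eq_insert hx, insert_eq]
    exact (hs x).union ih

theorem IsLengthMeasure.setIntegral_ancestors (hl : IsLengthMeasure 𝒳 l) (g : 𝒳 → ℝ) {x : 𝒳}
    (hx : x ≠ 𝒳.root) : ∫ z in SpeedWalk.ancestors 𝒳 x, g z ∂l =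
      (∫ z in SpeedWalk.ancestors 𝒳 (parent x), g z ∂l) + dist (parent x) x * g x := by
  rw [ancestors_eq_insert hx, insert_eq, setIntegral_union
    (disjoint_singleton_left.2 (notMem_ancestors_parent hx)) MeasurableSet.of_discrete
    (integrableOn_singleton (hx := hl.singleton_lt_top x)) (hl.integrableOn_ancestors g _),
    integral_singleton, add_comm, smul_eq_mul, Measure.real, hl.singleton hx,
    ENNReal.toReal_ofReal dist_nonneg]

/-- The difference quotient along the edge towards the root. -/
def grad (f : 𝒳 → ℝ) (x : 𝒳) : ℝ := (f x - f (parent x)) / dist (parent x) x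

theorem dist_mul_grad (f : 𝒳 → ℝ) {x : 𝒳} (hx : x ≠ 𝒳.root) :
    dist (parent x) x * grad f x = f x - f (parent x) := by
  rw [grad, mul_div_cancel₀ _ (dist_parent_pos hx).ne']

theorem setIntegral_grad (hl : IsLengthMeasure 𝒳 l) (f : 𝒳 → ℝ) (x : 𝒳) :
    ∫ z in ancestors 𝒳 x, grad f z ∂l = f x - f 𝒳.root := by
  induction x using tree_induction with
  | h0 =>
    rw [sub_self, setIntegral_measure_zero]
    rw [hl.ancestors]
    simp [height]
  | h x hx ih => rw [hl.setIntegral_ancestors _ hx, ih, dist_mul_grad f hx]; ring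

theorem isGradient_grad (hl : IsLengthMeasure 𝒳 l) (f : 𝒳 → ℝ) :
    IsGradient 𝒳 l f (grad f) := by
  refine ⟨hl.integrableOn_ancestors _, fun x y => ?_⟩
  rw [setIntegral_grad hl, setIntegral_grad hl]
  ring

theorem IsGradient.eq_grad (hl : IsLengthMeasure 𝒳 l) {f g : 𝒳 → ℝ} (h : IsGradient 𝒳 l f g)
    {x : 𝒳} (hx : x ≠ 𝒳.root) : g x = grad f x := by
  have h1 := h.2 (parent x) x
  rw [hl.setIntegral_ancestors g hx, ← dist_mul_grad f hx] at h1
  have := (dist_parent_pos hx).ne'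
  have h2 : dist (parent x) x * grad f x = dist (parent x) x * g x := by linarith
  exact (mul_left_cancel₀ this h2).symm

/-- A gradient is determined at every vertex other than the root, and the root is a null set. From
here on the chosen gradient is replaced by `grad`. -/
theorem gradient_ae_eq (hl : IsLengthMeasure 𝒳 l) (f : 𝒳 → ℝ) :
    gradient 𝒳 l f =ᵐ[l] grad f := by
  have hex : ∃ g, IsGradient 𝒳 l f g := ⟨_, isGradient_grad hl f⟩
  have hne : ∀ᵐ x ∂l, x ≠ 𝒳.root := by
    rw [ae_iff]
    simpa using hl.singleton_root
  filter_upwards [hne] with x hx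
  rw [gradient, dif_pos hex]
  exact hex.choose_spec.eq_grad hl hx

theorem energy_eq (hl : IsLengthMeasure 𝒳 l) (f g : 𝒳 → ℝ) :
    energy 𝒳 l f g = 1 / 2 * ∫ z, grad f z * grad g z ∂l := by
  rw [energy]
  congr 1
  refine integral_congr_ae ?_
  filter_upwards [gradient_ae_eq hl f, gradient_ae_eq hl g] with z h1 h2
  rw [h1, h2]

theorem grad_sub (f g : 𝒳 → ℝ) : grad (f - g) = grad f - grad g := by
  ext x; simp only [grad, Pi.sub_apply]; ring

theorem grad_smul (c : ℝ) (f : 𝒳 → ℝ) : grad (c • f) = c • grad f := by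
  ext x; simp only [grad, Pi.smul_apply, smul_eq_mul]; ring

/-- The open path between two points, on which differences of functions are the integrals of
their gradients. -/
theorem exists_path_set (hl : IsLengthMeasure 𝒳 l) (x y : 𝒳) : ∃ A ⊆ arc x y,
    l A = ENNReal.ofReal (dist x y) ∧
      ∀ f : 𝒳 → ℝ, IntegrableOn (grad f) A l ∧ |f x - f y| ≤ ∫ z in A, |grad f z| ∂l := by
  obtain ⟨c, hcx, hcy, hd, hinteg⟩ := exists_meet x y
  have hmeas : ∀ {z}, c ∈ ancestors 𝒳 z →
      l (ancestors 𝒳 z \ ancestors 𝒳 c) = ENNReal.ofReal (dist c z) := by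
    intro z hz
    rw [measure_sdiff (ancestors_subset hz) MeasurableSet.of_discrete.nullMeasurableSet
      (by rw [hl.ancestors]; exact ENNReal.ofReal_ne_top), hl.ancestors, hl.ancestors,
      ← ENNReal.ofReal_sub _ dist_nonneg, ← mem_ancestors.1 hz]
    congr 1
    ring
  have hdiff : ∀ {z}, c ∈ ancestors 𝒳 z → ∀ f : 𝒳 → ℝ,
      |f z - f c| ≤ ∫ z in ancestors 𝒳 z \ ancestors 𝒳 c, |grad f z| ∂l := by
    intro z hz f
    have : f z - f c = ∫ z in ancestors 𝒳 z \ ancestors 𝒳 c, grad f z ∂l := by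
      rw [setIntegral_sdiff MeasurableSet.of_discrete (hl.integrableOn_ancestors _ _)
        (ancestors_subset hz), setIntegral_grad hl, setIntegral_grad hl]
      ring
    rw [this]
    exact abs_integral_le_integral_abs
  have hdisj : Disjoint (ancestors 𝒳 x \ ancestors 𝒳 c) (ancestors 𝒳 y \ ancestors 𝒳 c) := by
    refine Set.disjoint_left.2 fun a ha hb => ha.2 ?_
    rw [← hinteg]
    exact ⟨ha.1, hb.1⟩
  have hi : ∀ (f : 𝒳 → ℝ) (z : 𝒳), IntegrableOn (grad f) (ancestors 𝒳 z \ ancestors 𝒳 c) l :=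
    fun f z => (hl.integrableOn_ancestors _ z).mono_set sdiff_subset
  -- The meeting point `c` is left out, because its atom represents the edge from `c` towards the
  -- root, which is not on the path.
  refine ⟨(ancestors 𝒳 x \ ancestors 𝒳 c) ∪ (ancestors 𝒳 y \ ancestors 𝒳 c), ?_, ?_,
    fun f => ⟨(hi f x).union (hi f y), ?_⟩⟩
  · apply union_subset
    · intro a ha
      have hd' : dist y c + dist c x = dist y x := by
        rw [dist_comm y c, dist_comm c x, dist_comm y x]; linarith
      have := mem_arc_of_mem_ancestors hcx hd' ha.1 ha.2
      change dist x a + dist a y = dist x y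
      have h2 : dist y a + dist a x = dist y x := this
      rw [dist_comm x a, dist_comm a y, dist_comm x y]
      linarith
    · exact fun a ha => mem_arc_of_mem_ancestors hcy hd ha.1 ha.2
  · rw [measure_union hdisj MeasurableSet.of_discrete, hmeas hcx, hmeas hcy,
      ← ENNReal.ofReal_add dist_nonneg dist_nonneg, ← hd, dist_comm c x]
  · rw [setIntegral_union hdisj MeasurableSet.of_discrete (hi f x).abs (hi f y).abs]
    have h1 := hdiff hcx f
    have h2 := hdiff hcy f
    have h3 := abs_sub_le (f x) (f c) (f y)
    rw [abs_sub_comm (f c) (f y)] at h3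
    linarith

/-- By Cauchy-Schwarz along the path, functions of finite energy are Hölder continuous of order 1/2.
-/
theorem sq_sub_le (hl : IsLengthMeasure 𝒳 l) {f : 𝒳 → ℝ} (hf : MemLp (grad f) 2 l) (x y : 𝒳) :
    (f x - f y) ^ 2 ≤ dist x y * ∫ z, grad f z ^ 2 ∂l := by
  obtain ⟨A, -, hA, h⟩ := exists_path_set hl x y
  have h1 := sq_setIntegral_abs_le hf (A := A) MeasurableSet.of_discrete
    (by rw [hA]; exact ENNReal.ofReal_ne_top)
  rw [hA, ENNReal.toReal_ofReal dist_nonneg] at h1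
  rw [← sq_abs]
  exact (pow_le_pow_left₀ (abs_nonneg _) (h f).2 2).trans h1

theorem locallyAbsolutelyContinuous_of_memLp (hl : IsLengthMeasure 𝒳 l) {f : 𝒳 → ℝ}
    (hf : MemLp (grad f) 2 l) : LocallyAbsolutelyContinuous 𝒳 l f := by
  intro ε hε S _
  set G := ∫ z, grad f z ^ 2 ∂l with hG
  have hG0 : 0 ≤ G := integral_nonneg fun _ => sq_nonneg _
  -- Cauchy-Schwarz on the union of the paths bounds the squared sum by the total length times `G`;
  -- adding 1 covers `G = 0`.
  refine ⟨ε ^ 2 / (G + 1), by positivity, fun m x y _ hdisj hsum => ?_⟩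
  choose A hAarc hAl hAf using fun i => exists_path_set hl (x i) (y i)
  have hAd : Pairwise (Function.onFun Disjoint A) := fun i j hij =>
    (hdisj hij).mono (hAarc i) (hAarc j)
  have h1 : ∑ i, |f (x i) - f (y i)| ≤ ∫ z in ⋃ i, A i, |grad f z| ∂l := by
    rw [integral_iUnion_fintype (fun _ => MeasurableSet.of_discrete) hAd
      (fun i => (hAf i f).1.abs)]
    exact Finset.sum_le_sum fun i _ => (hAf i f).2
  have hlU : l (⋃ i, A i) = ENNReal.ofReal (∑ i, dist (x i) (y i)) := by
    rw [measure_iUnion hAd (fun _ => MeasurableSet.of_discrete), tsum_fintype,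
      ENNReal.ofReal_sum_of_nonneg fun _ _ => dist_nonneg]
    exact Finset.sum_congr rfl fun i _ => hAl i
  have h2 := sq_setIntegral_abs_le hf (A := ⋃ i, A i) MeasurableSet.of_discrete
    (by rw [hlU]; exact ENNReal.ofReal_ne_top)
  rw [hlU, ENNReal.toReal_ofReal (Finset.sum_nonneg fun _ _ => dist_nonneg)] at h2
  have h0 : 0 ≤ ∑ i, |f (x i) - f (y i)| := Finset.sum_nonneg fun _ _ => abs_nonneg _
  have h3 : (∑ i, |f (x i) - f (y i)|) ^ 2 < ε ^ 2 := by
    rw [lt_div_iff₀ (by positivity)] at hsum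
    have hs0 : 0 ≤ ∑ i, dist (x i) (y i) := Finset.sum_nonneg fun _ _ => dist_nonneg
    calc (∑ i, |f (x i) - f (y i)|) ^ 2 ≤ (∫ z in ⋃ i, A i, |grad f z| ∂l) ^ 2 :=
          pow_le_pow_left₀ h0 h1 2
      _ ≤ (∑ i, dist (x i) (y i)) * G := h2
      _ ≤ (∑ i, dist (x i) (y i)) * (G + 1) := by gcongr; linarith
      _ < ε ^ 2 := hsum
  exact lt_of_pow_lt_pow_left₀ 2 hε.le h3

/-- On a discrete tree continuity and the existence of a gradient are automatic, and finite energy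
implies local absolute continuity. -/
theorem mem_formDomain_iff (hl : IsLengthMeasure 𝒳 l) {f : 𝒳 → ℝ} : f ∈ formDomain 𝒳 l ↔
    Tendsto f (cocompact 𝒳) (𝓝 0) ∧ MemLp f 2 𝒳.ν ∧ MemLp (grad f) 2 l := by
  have h := memLp_congr_ae (p := 2) (gradient_ae_eq hl f)
  constructor
  · rintro ⟨-, -, h1, h2, -, h3⟩
    exact ⟨h1, h2, h.1 h3⟩
  · rintro ⟨h1, h2, h3⟩
    exact ⟨continuous_of_discreteTopology, locallyAbsolutelyContinuous_of_memLp hl h3, h1, h2,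
      ⟨_, isGradient_grad hl f⟩, h.2 h3⟩

end Tree

/-! ### Estimates for the resolvent of the Dirichlet form -/

theorem integral_sq_eq_toReal_eLpNorm {α : Type*} [MeasurableSpace α] {μ : Measure α}
    {f : α → ℝ} (hf : MemLp f 2 μ) : ∫ x, f x ^ 2 ∂μ = (eLpNorm f 2 μ).toReal ^ 2 := by
  rw [hf.eLpNorm_eq_integral_rpow_norm (by norm_num) (by norm_num), ENNReal.toReal_ofReal
    (by positivity)]
  have h0 : 0 ≤ ∫ x, f x ^ 2 ∂μ := integral_nonneg fun _ => sq_nonneg _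
  have : ∀ x, ‖f x‖ ^ (2 : ℝ≥0∞).toReal = f x ^ 2 := fun x => by
    simp
  simp only [this]
  rw [← Real.rpow_natCast, ← Real.rpow_mul h0]
  norm_num

section Form

variable {𝒳 : RootedMeasureTree.{u}} [DiscreteTopology 𝒳] {l : Measure 𝒳}

/-- The Dirichlet integral `∫ |∇f|² dl`. -/
def dirichlet (l : Measure 𝒳) (f : 𝒳 → ℝ) : ℝ := ∫ z, grad f z ^ 2 ∂l

theorem dirichlet_nonneg (l : Measure 𝒳) (f : 𝒳 → ℝ) : 0 ≤ dirichlet l f :=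
  integral_nonneg fun _ => sq_nonneg _

theorem energy_self (hl : IsLengthMeasure 𝒳 l) (f : 𝒳 → ℝ) :
    energy 𝒳 l f f = 1 / 2 * dirichlet l f := by
  rw [energy_eq hl, dirichlet]
  simp only [sq]

/-- Young's inequality with a free weight `s`, which lets later estimates absorb terms linearly,
without square roots. -/
theorem abs_energy_le (hl : IsLengthMeasure 𝒳 l) {f g : 𝒳 → ℝ} (hf : MemLp (grad f) 2 l)
    (hg : MemLp (grad g) 2 l) {s : ℝ} (hs : 0 < s) :
    |energy 𝒳 l f g| ≤ 1 / 4 * (dirichlet l f / s + s * dirichlet l g) := by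
  rw [energy_eq hl, abs_mul, abs_of_pos (by norm_num : (0 : ℝ) < 1 / 2)]
  have hff := hf.integrable_sq
  have hgg := hg.integrable_sq
  have h1 : |∫ z, grad f z * grad g z ∂l| ≤
      ∫ z, 1 / 2 * (grad f z ^ 2 / s + s * grad g z ^ 2) ∂l := by
    refine abs_integral_le_integral_abs.trans (integral_mono (hf.integrable_mul hg).abs
      (((hff.div_const s).add (hgg.const_mul s)).const_mul _) fun z => ?_)
    beta_reduce
    rw [abs_mul, ← sq_abs (grad f z), ← sq_abs (grad g z)]
    set a := |grad f z|
    set b := |grad g z|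
    have : a ^ 2 / s + s * b ^ 2 - 2 * (a * b) = (a - s * b) ^ 2 / s := by
      field_simp
      ring
    have h2 : 0 ≤ (a - s * b) ^ 2 / s := by positivity
    linarith
  have h2 : ∫ z, 1 / 2 * (grad f z ^ 2 / s + s * grad g z ^ 2) ∂l =
      1 / 2 * (dirichlet l f / s + s * dirichlet l g) := by
    rw [integral_const_mul, integral_add (hff.div_const s) (hgg.const_mul s), integral_div,
      integral_const_mul]
    rfl
  rw [h2] at h1
  linarith

theorem energy_sub_left (hl : IsLengthMeasure 𝒳 l) {f g h : 𝒳 → ℝ} (hf : MemLp (grad f) 2 l)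
    (hg : MemLp (grad g) 2 l) (hh : MemLp (grad h) 2 l) :
    energy 𝒳 l (f - g) h = energy 𝒳 l f h - energy 𝒳 l g h := by
  have h1 : Integrable (fun z => grad f z * grad h z) l := hf.integrable_mul hh
  have h2 : Integrable (fun z => grad g z * grad h z) l := hg.integrable_mul hh
  rw [energy_eq hl, energy_eq hl, energy_eq hl, grad_sub, ← mul_sub, ← integral_sub h1 h2]
  simp only [Pi.sub_apply, sub_mul]

theorem energy_smul_left (hl : IsLengthMeasure 𝒳 l) (c : ℝ) (f h : 𝒳 → ℝ) :
    energy 𝒳 l (c • f) h = c * energy 𝒳 l f h := by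
  rw [energy_eq hl, energy_eq hl, grad_smul, mul_left_comm, ← integral_const_mul c]
  simp only [Pi.smul_apply, smul_eq_mul, mul_assoc]

theorem dirichlet_smul (c : ℝ) (f : 𝒳 → ℝ) : dirichlet l (c • f) = c ^ 2 * dirichlet l f := by
  rw [dirichlet, dirichlet, grad_smul, ← integral_const_mul]
  simp only [Pi.smul_apply, smul_eq_mul, mul_pow]

theorem sub_mem_formDomain (hl : IsLengthMeasure 𝒳 l) {f g : 𝒳 → ℝ}
    (hf : f ∈ formDomain 𝒳 l) (hg : g ∈ formDomain 𝒳 l) : f - g ∈ formDomain 𝒳 l := by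
  rw [mem_formDomain_iff hl] at *
  refine ⟨?_, hf.2.1.sub hg.2.1, ?_⟩
  · have := hf.1.sub hg.1
    rwa [sub_zero] at this
  · rw [grad_sub]
    exact hf.2.2.sub hg.2.2

theorem smul_mem_formDomain (hl : IsLengthMeasure 𝒳 l) (c : ℝ) {f : 𝒳 → ℝ}
    (hf : f ∈ formDomain 𝒳 l) : c • f ∈ formDomain 𝒳 l := by
  rw [mem_formDomain_iff hl] at *
  refine ⟨?_, hf.2.1.const_smul c, ?_⟩
  · have := hf.1.const_smul c
    rwa [smul_zero] at this
  · rw [grad_smul]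
    exact hf.2.2.const_smul c

theorem measure_singleton_pos (x : 𝒳) : 0 < 𝒳.ν {x} :=
  𝒳.full_support _ (isOpen_discrete _) (singleton_nonempty x)

/-- Every point has positive mass, so convergence in measure already forces pointwise convergence.
-/
theorem IsFormLimit.tendsto_apply {u : ℕ → 𝒳 → ℝ} {v : 𝒳 → ℝ} (h : IsFormLimit 𝒳 l u v)
    (x : 𝒳) : Tendsto (fun k => u k x) atTop (𝓝 (v x)) := by
  have hm : TendstoInMeasure 𝒳.ν u atTop v :=
    tendstoInMeasure_of_tendsto_eLpNorm (by norm_num)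
      (fun k => (Measurable.of_discrete (f := u k)).aestronglyMeasurable)
      (Measurable.of_discrete (f := v)).aestronglyMeasurable h.2.2
  rw [Metric.tendsto_nhds]
  intro ε hε
  have h1 := tendstoInMeasure_iff_dist.1 hm ε hε
  filter_upwards [h1.eventually (gt_mem_nhds (measure_singleton_pos x))] with k hk
  by_contra hcon
  exact absurd hk (not_lt.2 (measure_mono (singleton_subset_iff.2 (not_lt.1 hcon))))

theorem IsFormLimit.memLp (hl : IsLengthMeasure 𝒳 l) {u : ℕ → 𝒳 → ℝ} {v : 𝒳 → ℝ}
    (h : IsFormLimit 𝒳 l u v) : MemLp v 2 𝒳.ν := by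
  obtain ⟨k, hk⟩ := (h.2.2.eventually (gt_mem_nhds (one_pos (α := ℝ≥0∞)))).exists
  have h1 : MemLp (u k - v) 2 𝒳.ν :=
    ⟨Measurable.of_discrete.aestronglyMeasurable, hk.trans ENNReal.one_lt_top⟩
  have h2 := ((mem_formDomain_iff hl).1 (h.1 k)).2.1.sub h1
  rwa [sub_sub_cancel] at h2

theorem IsFormLimit.tendsto_integral_sq (hl : IsLengthMeasure 𝒳 l) {u : ℕ → 𝒳 → ℝ} {v : 𝒳 → ℝ}
    (h : IsFormLimit 𝒳 l u v) : Tendsto (fun k => ∫ x, (u k - v) x ^ 2 ∂𝒳.ν) atTop (𝓝 0) := by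
  have h1 : ∀ k, ∫ x, (u k - v) x ^ 2 ∂𝒳.ν = (eLpNorm (u k - v) 2 𝒳.ν).toReal ^ 2 := fun k =>
    integral_sq_eq_toReal_eLpNorm (((mem_formDomain_iff hl).1 (h.1 k)).2.1.sub (h.memLp hl))
  simp only [h1]
  have h2 := ((ENNReal.tendsto_toReal ENNReal.zero_ne_top).comp h.2.2).pow 2
  simpa using h2

/-- The function `G` solves `ℰ(G, h) + α ⟨G, h⟩ = ⟨F, h⟩`, where `G` is a limit of the sequence
`u` in the form domain. -/
structure IsWeakResolvent (l : Measure 𝒳) (α : ℝ) (F G : 𝒳 → ℝ) (u : ℕ → 𝒳 → ℝ) : Prop where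
  limit : IsFormLimit 𝒳 l u G
  eqn : ∀ h ∈ formDomain 𝒳 l, Tendsto (fun k => energy 𝒳 l (u k) h + α * ∫ x, G x * h x ∂𝒳.ν)
    atTop (𝓝 (∫ x, F x * h x ∂𝒳.ν))

variable {α : ℝ} {F G : 𝒳 → ℝ} {u : ℕ → 𝒳 → ℝ}

/-- Formally, testing with v = α G - F gives ℰ(v, v) + α∫v² = -ℰ(F, v), and Young's inequality
finishes. As `G` is only a limit of functions in the form domain, the approximants `w j` of v serve
as test functions, at the price of `ε`. -/
theorem IsWeakResolvent.eventually_le (hl : IsLengthMeasure 𝒳 l) (hα : 0 < α)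
    (hF : F ∈ formDomain 𝒳 l) (h : IsWeakResolvent l α F G u) {ε : ℝ} (hε : 0 < ε) :
    ∀ᶠ j in atTop, 1 / 2 * dirichlet l (α • u j - F) + α * ∫ x, (α • G - F) x ^ 2 ∂𝒳.ν ≤
      dirichlet l F + ε := by
  set v := α • G - F with hv
  set w : ℕ → 𝒳 → ℝ := fun j => α • u j - F with hw
  have hwF : ∀ j, w j ∈ formDomain 𝒳 l := fun j =>
    sub_mem_formDomain hl (smul_mem_formDomain hl α (h.limit.1 j)) hF
  have hwg : ∀ j, MemLp (grad (w j)) 2 l := fun j => ((mem_formDomain_iff hl).1 (hwF j)).2.2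
  have hug : ∀ j, MemLp (grad (u j)) 2 l := fun j =>
    ((mem_formDomain_iff hl).1 (h.limit.1 j)).2.2
  have hFm := (mem_formDomain_iff hl).1 hF
  have hGm := h.limit.memLp hl
  have hvm : MemLp v 2 𝒳.ν := (hGm.const_smul α).sub hFm.2.1
  have hwm : ∀ j, MemLp (w j) 2 𝒳.ν := fun j => ((mem_formDomain_iff hl).1 (hwF j)).2.1
  have hsq : ∀ j, ∫ x, (v - w j) x ^ 2 ∂𝒳.ν = α ^ 2 * ∫ x, (u j - G) x ^ 2 ∂𝒳.ν := by
    intro j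
    rw [← integral_const_mul]
    congr 1
    ext x
    simp only [hv, hw, Pi.sub_apply, Pi.smul_apply, smul_eq_mul]
    ring
  have hsq0 : Tendsto (fun j => ∫ x, (v - w j) x ^ 2 ∂𝒳.ν) atTop (𝓝 0) := by
    simp only [hsq]
    simpa using (h.limit.tendsto_integral_sq hl).const_mul (α ^ 2)
  have hε' : 0 < ε / (8 * α ^ 2 + 1) := by positivity
  obtain ⟨N, hN⟩ := h.limit.2.1 (ε / (8 * α ^ 2 + 1)) hε'
  filter_upwards [hsq0.eventually (gt_mem_nhds (show 0 < ε / (2 * α) by positivity)),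
    eventually_ge_atTop N] with j hj hjN
  have hlim := (h.eqn (w j) (hwF j)).const_mul α
  -- Here α ℰ(u k, w j) splits into ℰ(w k - w j, w j), ℰ(w j, w j) and ℰ(F, w j). Young's weights
  -- 1/4 and 1/2 for the first and last term leave a sufficient multiple of the Dirichlet integral
  -- of `w j`.
  have hbound : ∀ᶠ k in atTop, α * (energy 𝒳 l (u k) (w j) + α * ∫ x, G x * w j x ∂𝒳.ν) ≥
      1 / 2 * (7 / 8 * dirichlet l (w j)) - ε / 4 - (dirichlet l F / 2 + 1 / 8 * dirichlet l (w j))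
        + α ^ 2 * ∫ x, G x * w j x ∂𝒳.ν := by
    filter_upwards [eventually_ge_atTop N] with k hk
    have e1 : α * energy 𝒳 l (u k) (w j) =
        energy 𝒳 l (w k - w j) (w j) + energy 𝒳 l (w j) (w j) + energy 𝒳 l F (w j) := by
      rw [energy_sub_left hl (hwg k) (hwg j) (hwg j), ← energy_smul_left hl]
      have : energy 𝒳 l (w k) (w j) = energy 𝒳 l (α • u k) (w j) - energy 𝒳 l F (w j) :=
        energy_sub_left hl (by rw [grad_smul]; exact (hug k).const_smul α) hFm.2.2 (hwg j)
      rw [this]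
      ring
    have e2 : w k - w j = α • (u k - u j) := by
      ext x
      simp only [hw, Pi.sub_apply, Pi.smul_apply, smul_eq_mul]
      ring
    have e3 := abs_energy_le hl (f := w k - w j) (g := w j)
      (by rw [grad_sub]; exact (hwg k).sub (hwg j)) (hwg j) (s := 1 / 4) (by norm_num)
    have e4 := abs_energy_le hl (f := F) (g := w j) hFm.2.2 (hwg j) (s := 1 / 2) (by norm_num)
    have e5 : dirichlet l (w k - w j) ≤ ε / 4 := by
      have := hN k hk j hjN
      rw [energy_self hl] at this
      rw [e2, dirichlet_smul]
      rw [lt_div_iff₀ (by positivity)] at this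
      have hd := dirichlet_nonneg l (u k - u j)
      nlinarith [sq_nonneg α]
    have e6 := energy_self hl (w j)
    have e7 := (abs_le.1 e3).1
    have e8 := (abs_le.1 e4).1
    have hFd := dirichlet_nonneg l F
    have hwd := dirichlet_nonneg l (w j)
    nlinarith
  have hle := ge_of_tendsto hlim hbound
  have i1 : Integrable (fun x => G x * w j x) 𝒳.ν := hGm.integrable_mul (hwm j)
  have i2 : Integrable (fun x => F x * w j x) 𝒳.ν := hFm.2.1.integrable_mul (hwm j)
  have e9 : ∫ x, v x * w j x ∂𝒳.ν = α * (∫ x, G x * w j x ∂𝒳.ν) - ∫ x, F x * w j x ∂𝒳.ν := by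
    rw [← integral_const_mul, ← integral_sub (i1.const_mul α) i2]
    congr 1
    ext x
    simp only [hv, Pi.sub_apply, Pi.smul_apply, smul_eq_mul]
    ring
  have e10 : ∫ x, v x ^ 2 ∂𝒳.ν - ∫ x, (v - w j) x ^ 2 ∂𝒳.ν ≤ 2 * ∫ x, v x * w j x ∂𝒳.ν := by
    rw [← integral_sub hvm.integrable_sq (hvm.sub (hwm j)).integrable_sq, ← integral_const_mul]
    refine integral_mono (hvm.integrable_sq.sub (hvm.sub (hwm j)).integrable_sq)
      ((hvm.integrable_mul (hwm j)).const_mul 2) fun x => ?_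
    simp only [Pi.sub_apply]
    nlinarith [sq_nonneg (w j x)]
  have hj' : α * ∫ x, (v - w j) x ^ 2 ∂𝒳.ν ≤ ε / 2 := by
    rw [lt_div_iff₀ (by positivity)] at hj
    linarith
  have e11 : α * (∫ x, v x ^ 2 ∂𝒳.ν - ∫ x, (v - w j) x ^ 2 ∂𝒳.ν) ≤
      α * (2 * ∫ x, v x * w j x ∂𝒳.ν) := mul_le_mul_of_nonneg_left e10 hα.le
  have hwd := dirichlet_nonneg l (w j)
  rw [e9] at e11
  nlinarith

theorem IsWeakResolvent.integral_sq_le (hl : IsLengthMeasure 𝒳 l) (hα : 0 < α)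
    (hF : F ∈ formDomain 𝒳 l) (h : IsWeakResolvent l α F G u) :
    α * ∫ x, (α • G - F) x ^ 2 ∂𝒳.ν ≤ dirichlet l F := by
  refine le_of_forall_pos_le_add fun ε hε => ?_
  obtain ⟨j, hj⟩ := (h.eventually_le hl hα hF hε).exists
  linarith [dirichlet_nonneg l (α • u j - F)]

theorem IsWeakResolvent.sq_sub_le (hl : IsLengthMeasure 𝒳 l) (hα : 0 < α)
    (hF : F ∈ formDomain 𝒳 l) (h : IsWeakResolvent l α F G u) (x y : 𝒳) :
    ((α • G - F) x - (α • G - F) y) ^ 2 ≤ 2 * dirichlet l F * dist x y := by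
  have hlim : ∀ x, Tendsto (fun j => (α • u j - F) x) atTop (𝓝 ((α • G - F) x)) := fun x => by
    simp only [Pi.sub_apply, Pi.smul_apply, smul_eq_mul]
    exact ((h.limit.tendsto_apply x).const_mul α).sub_const _
  have key : ∀ ε : ℝ, 0 < ε → ((α • G - F) x - (α • G - F) y) ^ 2 ≤
      (2 * dirichlet l F + 2 * ε) * dist x y := by
    intro ε hε
    refine le_of_tendsto (((hlim x).sub (hlim y)).pow 2) ?_
    filter_upwards [h.eventually_le hl hα hF hε] with j hj
    have hm := ((mem_formDomain_iff hl).1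
      (sub_mem_formDomain hl (smul_mem_formDomain hl α (h.limit.1 j)) hF)).2.2
    refine (SpeedWalk.sq_sub_le hl hm x y).trans ?_
    rw [mul_comm]
    gcongr
    have : 0 ≤ ∫ x, (α • G - F) x ^ 2 ∂𝒳.ν := integral_nonneg fun _ => sq_nonneg _
    have h2 : dirichlet l (α • u j - F) = ∫ z, grad (α • u j - F) z ^ 2 ∂l := rfl
    nlinarith
  have hlim2 : Tendsto (fun ε : ℝ => (2 * dirichlet l F + 2 * ε) * dist x y) (𝓝[>] 0)
      (𝓝 ((2 * dirichlet l F + 2 * 0) * dist x y)) := by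
    refine Tendsto.mono_left ?_ nhdsWithin_le_nhds
    exact (Continuous.tendsto (by fun_prop) _)
  rw [mul_zero, add_zero] at hlim2
  exact ge_of_tendsto hlim2 (by filter_upwards [self_mem_nhdsWithin] with ε hε using key ε hε)

/-- Some point `y` of the ball has v(y)² at most the average of v² there, which the bound on α∫v²
and the mass of the ball control. The Hölder estimate carries this from `y` to `x`. -/
theorem IsWeakResolvent.abs_sub_le (hl : IsLengthMeasure 𝒳 l) (hα : 0 < α)
    (hF : F ∈ formDomain 𝒳 l) (h : IsWeakResolvent l α F G u) {x : 𝒳} {δ c : ℝ} (hc : 0 < c)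
    (hcx : ENNReal.ofReal c ≤ 𝒳.ν (Metric.closedBall x δ)) {I : ℝ} (hI : dirichlet l F ≤ I) :
    |α * G x - F x| ≤ √(I / (α * c)) + √(2 * I * δ) := by
  set v := α • G - F with hv
  have hI0 : 0 ≤ I := (dirichlet_nonneg l F).trans hI
  have hvm : MemLp v 2 𝒳.ν :=
    ((h.limit.memLp hl).const_smul α).sub ((mem_formDomain_iff hl).1 hF).2.1
  have hfin : 𝒳.ν (Metric.closedBall x δ) < ∞ := 𝒳.finite_of_isBounded _ Metric.isBounded_closedBall
  have hpos : 0 < 𝒳.ν (Metric.closedBall x δ) := (ENNReal.ofReal_pos.2 hc).trans_le hcx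
  obtain ⟨y, hy, hle⟩ := exists_le_setAverage hpos.ne' hfin.ne
    (hvm.integrable_sq.integrableOn (s := Metric.closedBall x δ))
  have hδ : 0 ≤ δ := dist_nonneg.trans (Metric.mem_closedBall.1 hy)
  have hy2 : v y ^ 2 ≤ I / (α * c) := by
    rw [setAverage_eq, smul_eq_mul] at hle
    have hcr : c ≤ 𝒳.ν.real (Metric.closedBall x δ) :=
      (ENNReal.ofReal_le_iff_le_toReal hfin.ne).1 hcx
    have h1 : ∫ z in Metric.closedBall x δ, v z ^ 2 ∂𝒳.ν ≤ ∫ z, v z ^ 2 ∂𝒳.ν :=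
      setIntegral_le_integral hvm.integrable_sq (Eventually.of_forall fun _ => sq_nonneg _)
    have h2 := h.integral_sq_le hl hα hF
    have h3 : 0 ≤ ∫ z in Metric.closedBall x δ, v z ^ 2 ∂𝒳.ν :=
      integral_nonneg fun _ => sq_nonneg _
    have h4 : ∫ z, v z ^ 2 ∂𝒳.ν ≤ I / α := by
      rw [le_div_iff₀ hα, mul_comm]
      exact h2.trans hI
    calc v y ^ 2 ≤ (𝒳.ν.real (Metric.closedBall x δ))⁻¹ *
          ∫ z in Metric.closedBall x δ, v z ^ 2 ∂𝒳.ν := hle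
      _ ≤ c⁻¹ * (I / α) := by
          gcongr
          exact h1.trans h4
      _ = I / (α * c) := by field_simp
  have hxy : (v x - v y) ^ 2 ≤ 2 * I * δ := by
    refine (h.sq_sub_le hl hα hF x y).trans ?_
    have hd := dirichlet_nonneg l F
    have hdist : dist x y ≤ δ := by rw [dist_comm]; exact hy
    gcongr
  have h1 : |v y| ≤ √(I / (α * c)) := Real.abs_le_sqrt hy2
  have h2 : |v x - v y| ≤ √(2 * I * δ) := Real.abs_le_sqrt hxy
  have h3 : |v x| ≤ |v x - v y| + |v y| := by
    have := abs_add_le (v x - v y) (v y)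
    simpa using this
  have h4 : v x = α * G x - F x := by simp [hv]
  rw [← h4]
  linarith

/-- The maximum principle outside of a ball. -/
theorem IsWeakResolvent.le_of_boundary_le (hl : IsLengthMeasure 𝒳 l) (hα : 0 < α)
    (h : IsWeakResolvent l α F G u) (hG : ∀ x, 0 ≤ G x) {R R' ε : ℝ} (hε : 0 < ε)
    (hFR : ∀ x, R ≤ height 𝒳 x → F x = 0)
    (hbd : ∀ x, x ≠ 𝒳.root → R ≤ height 𝒳 x → height 𝒳 (parent x) < R →
      height 𝒳 x ≤ R' ∧ G x ≤ ε) {x : 𝒳} (hx : R ≤ height 𝒳 x) : G x ≤ ε := by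
  refine le_of_forall_gt_imp_ge_of_dense fun ε' hε' => ?_
  by_contra hcon
  rw [not_le] at hcon
  -- The test function is the positive part of `u k - ε'`, cut off inside radius `R`. The room
  -- between `ε` and `ε'` makes it vanish, for large `k`, at the finitely many vertices where an
  -- edge crosses that radius.
  set ψ : ℕ → 𝒳 → ℝ := fun k y => if R ≤ height 𝒳 y then max (u k y - ε') 0 else 0 with hψ
  have hε0 : 0 < ε' := hε.trans hε'
  have hψ0 : ∀ k y, 0 ≤ ψ k y := fun k y => by
    simp only [hψ]; split_ifs
    · exact le_max_right _ _
    · exact le_rfl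
  have hψu : ∀ k y, ‖ψ k y‖ ≤ ‖u k y‖ := fun k y => by
    rw [Real.norm_eq_abs, Real.norm_eq_abs, abs_of_nonneg (hψ0 k y)]
    simp only [hψ]; split_ifs
    · exact max_le (by linarith [le_abs_self (u k y)]) (abs_nonneg _)
    · exact abs_nonneg _
  have hum : ∀ k, Tendsto (u k) (cocompact 𝒳) (𝓝 0) ∧ MemLp (u k) 2 𝒳.ν ∧
      MemLp (grad (u k)) 2 l := fun k => (mem_formDomain_iff hl).1 (h.limit.1 k)
  have hfin : {y : 𝒳 | height 𝒳 y ≤ R'}.Finite := finite_height_le R'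
  have hev : ∀ᶠ k in atTop, ∀ y ∈ {y : 𝒳 | height 𝒳 y ≤ R'}, G y ≤ ε → u k y < ε' := by
    rw [hfin.eventually_all]
    intro y _
    by_cases hy : G y ≤ ε
    · filter_upwards [(h.limit.tendsto_apply y).eventually (gt_mem_nhds (hy.trans_lt hε'))]
        with k hk _ using hk
    · exact Eventually.of_forall fun _ h => absurd h hy
  -- Truncation contracts differences along edges outside the ball, while on crossing edges `ψ k`
  -- vanishes at both ends.
  have hgrad : ∀ᶠ k in atTop, ∀ y, grad (ψ k) y ^ 2 ≤ grad (u k) y * grad (ψ k) y := by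
    filter_upwards [hev] with k hk y
    have hnum : (ψ k y - ψ k (parent y)) ^ 2 ≤
        (u k y - u k (parent y)) * (ψ k y - ψ k (parent y)) := by
      by_cases hy : y = 𝒳.root
      · have : parent y = y := by rw [parent, dif_pos hy]
        simp [this]
      have hlt := height_parent_lt hy
      by_cases h1 : R ≤ height 𝒳 y
      · by_cases h2 : R ≤ height 𝒳 (parent y)
        · simp only [hψ, if_pos h1, if_pos h2]
          rcases le_total (u k y - ε') 0 with a | a <;>
            rcases le_total (u k (parent y) - ε') 0 with b | b <;>
              simp only [max_eq_left, max_eq_right, a, b] <;> nlinarith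
        · obtain ⟨b1, b2⟩ := hbd y hy h1 (not_le.1 h2)
          have := hk y b1 b2
          simp only [hψ, if_pos h1, if_neg h2]
          rw [max_eq_right (by linarith)]
          simp
      · simp only [hψ, if_neg h1, if_neg (show ¬ R ≤ height 𝒳 (parent y) by linarith)]
        simp
    simp only [grad]
    rw [div_pow, div_mul_div_comm, ← sq]
    gcongr
  have hgabs : ∀ᶠ k in atTop, ∀ y, ‖grad (ψ k) y‖ ≤ ‖grad (u k) y‖ := by
    filter_upwards [hgrad] with k hk y
    rw [Real.norm_eq_abs, Real.norm_eq_abs]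
    have h1 := hk y
    have h2 : |grad (ψ k) y| * |grad (ψ k) y| ≤ |grad (u k) y| * |grad (ψ k) y| := by
      rw [abs_mul_abs_self, ← abs_mul, ← sq]
      exact h1.trans (le_abs_self _)
    rcases (abs_nonneg (grad (ψ k) y)).eq_or_lt with h3 | h3
    · rw [← h3]; exact abs_nonneg _
    · exact le_of_mul_le_mul_right h2 h3
  have hψmem : ∀ᶠ k in atTop, ψ k ∈ formDomain 𝒳 l := by
    filter_upwards [hgabs] with k hk
    rw [mem_formDomain_iff hl]
    refine ⟨squeeze_zero_norm (hψu k) (by simpa using (hum k).1.norm), ?_, ?_⟩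
    · exact (hum k).2.1.mono Measurable.of_discrete.aestronglyMeasurable
        (Eventually.of_forall (hψu k))
    · exact (hum k).2.2.mono Measurable.of_discrete.aestronglyMeasurable
        (Eventually.of_forall hk)
  obtain ⟨N, hN⟩ := h.limit.2.1 1 one_pos
  set C := 4 + 2 * dirichlet l (u N) with hC
  have hdN := dirichlet_nonneg l (u N)
  have hudir : ∀ᶠ k in atTop, dirichlet l (u k) ≤ C := by
    filter_upwards [eventually_ge_atTop N] with k hk
    have h1 := hN k hk N le_rfl
    rw [energy_self hl] at h1
    have h2 : dirichlet l (u k) ≤ 2 * dirichlet l (u k - u N) + 2 * dirichlet l (u N) := by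
      have m1 := (hum k).2.2
      have m2 := (hum N).2.2
      have m3 : MemLp (grad (u k - u N)) 2 l := by rw [grad_sub]; exact m1.sub m2
      simp only [dirichlet]
      rw [← integral_const_mul, ← integral_const_mul,
        ← integral_add (m3.integrable_sq.const_mul 2) (m2.integrable_sq.const_mul 2)]
      refine integral_mono m1.integrable_sq
        ((m3.integrable_sq.const_mul 2).add (m2.integrable_sq.const_mul 2)) fun z => ?_
      simp only [grad_sub, Pi.sub_apply]
      nlinarith [sq_nonneg (grad (u k) z - 2 * grad (u N) z)]
    linarith
  have hψdir : ∀ᶠ k in atTop, dirichlet l (ψ k) ≤ C := by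
    filter_upwards [hudir, hgabs, hψmem] with k hk hk' hk''
    refine le_trans ?_ hk
    refine integral_mono ((mem_formDomain_iff hl).1 hk'').2.2.integrable_sq
      (hum k).2.2.integrable_sq fun z => ?_
    exact sq_le_sq.2 (hk' z)
  have hlim : Tendsto (fun k => α * (G x * max (u k x - ε') 0 * 𝒳.ν.real {x})) atTop
      (𝓝 (α * (G x * max (G x - ε') 0 * 𝒳.ν.real {x}))) := by
    refine Tendsto.const_mul α (Tendsto.mul_const _ (Tendsto.const_mul _ ?_))
    exact ((h.limit.tendsto_apply x).sub_const _).max tendsto_const_nhds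
  have hpos : 0 < α * (G x * max (G x - ε') 0 * 𝒳.ν.real {x}) := by
    have h1 : 0 < G x := hε0.trans hcon
    have h2 : 0 < max (G x - ε') 0 := lt_max_of_lt_left (by linarith)
    have h3 : 0 < 𝒳.ν.real {x} := ENNReal.toReal_pos (measure_singleton_pos x).ne'
      (𝒳.finite_of_isBounded _ Bornology.isBounded_singleton).ne
    positivity
  -- If `G x > ε'`, the term at `x` tends to `2 * τ`. But `F` vanishes on the support of `ψ k` and
  -- ℰ(u k, ψ k) is nonnegative, so the weak equation bounds this term by `τ`.
  set τ := α * (G x * max (G x - ε') 0 * 𝒳.ν.real {x}) / 2 with hτ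
  have hτ0 : 0 < τ := half_pos hpos
  have hCpos : 0 < C := by linarith
  obtain ⟨N', hN'⟩ := h.limit.2.1 (τ * (τ / C)) (by positivity)
  have hsmall : ∀ᶠ k in atTop, α * (G x * max (u k x - ε') 0 * 𝒳.ν.real {x}) ≤ τ := by
    filter_upwards [hψdir, hgrad, hψmem, eventually_ge_atTop N'] with k k1 k2 k3 k4
    have hψm := (mem_formDomain_iff hl).1 k3
    have hFψ : ∫ y, F y * ψ k y ∂𝒳.ν = 0 := by
      rw [← integral_zero 𝒳 ℝ (μ := 𝒳.ν)]
      congr 1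
      ext y
      by_cases hy : R ≤ height 𝒳 y
      · rw [hFR y hy, zero_mul]
      · simp [hψ, if_neg hy]
    have hT := h.eqn (ψ k) k3
    rw [hFψ] at hT
    have hlow : ∀ᶠ j in atTop, energy 𝒳 l (u j) (ψ k) + α * ∫ y, G y * ψ k y ∂𝒳.ν ≥
        -τ + α * ∫ y, G y * ψ k y ∂𝒳.ν := by
      filter_upwards [eventually_ge_atTop N'] with j hj
      have m1 : MemLp (grad (u j - u k)) 2 l := by
        rw [grad_sub]; exact (hum j).2.2.sub (hum k).2.2
      have e1 := energy_sub_left hl (hum j).2.2 (hum k).2.2 hψm.2.2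
      have e2 := (abs_le.1 (abs_energy_le hl m1 hψm.2.2 (s := τ / C) (by positivity))).1
      have e3 : 0 ≤ energy 𝒳 l (u k) (ψ k) := by
        rw [energy_eq hl]
        have : 0 ≤ ∫ z, grad (u k) z * grad (ψ k) z ∂l :=
          integral_nonneg fun z => (sq_nonneg _).trans (k2 z)
        linarith
      have e4 := hN' j hj k k4
      rw [energy_self hl] at e4
      have e5 : dirichlet l (u j - u k) / (τ / C) ≤ 2 * τ := by
        rw [div_le_iff₀ (by positivity)]
        linarith
      have e6 : τ / C * dirichlet l (ψ k) ≤ τ := by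
        calc τ / C * dirichlet l (ψ k) ≤ τ / C * C := by gcongr
          _ = τ := by field_simp
      linarith
    have hle := ge_of_tendsto hT hlow
    have hinteg : Integrable (fun y => G y * ψ k y) 𝒳.ν :=
      (h.limit.memLp hl).integrable_mul hψm.2.1
    have hge : G x * max (u k x - ε') 0 * 𝒳.ν.real {x} ≤ ∫ y, G y * ψ k y ∂𝒳.ν := by
      have h1 := setIntegral_le_integral (s := {x}) hinteg
        (Eventually.of_forall fun y => mul_nonneg (hG y) (hψ0 k y))
      rw [integral_singleton, smul_eq_mul] at h1
      simp only [hψ, if_pos hx] at h1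
      linarith
    have := mul_le_mul_of_nonneg_left hge hα.le
    linarith
  have := le_of_tendsto hlim hsmall
  linarith

/-- The resolvent `α G` is uniformly close to the identity on functions of bounded energy. -/
theorem IsWeakResolvent.abs_sub_le_of_mass_bound (hl : IsLengthMeasure 𝒳 l) (hα : 0 < α)
    (hF : F ∈ formDomain 𝒳 l) (h : IsWeakResolvent l α F G u) (hG : ∀ x, 0 ≤ G x)
    {R R' δ c I : ℝ} (hδ : 0 < δ) (hc : 0 < c) (hI0 : 0 < I)
    (hFR : ∀ x, R ≤ height 𝒳 x → F x = 0)
    (hbd : ∀ x : 𝒳, x ≠ 𝒳.root → R ≤ height 𝒳 x → height 𝒳 (parent x) < R → height 𝒳 x < R')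
    (hRR' : R ≤ R')
    (hmass : ∀ x, height 𝒳 x < R' → ENNReal.ofReal c ≤ 𝒳.ν (Metric.closedBall x δ))
    (hI : dirichlet l F ≤ I) (x : 𝒳) :
    |α * G x - F x| ≤ √(I / (α * c)) + √(2 * I * δ) := by
  set κ := √(I / (α * c)) + √(2 * I * δ) with hκ
  have hκ0 : 0 < κ := by positivity
  have hin : ∀ y, height 𝒳 y < R' → |α * G y - F y| ≤ κ := fun y hy =>
    h.abs_sub_le hl hα hF hc (hmass y hy) hI
  rcases lt_or_ge (height 𝒳 x) R with hx | hx
  · exact hin x (hx.trans_le hRR')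
  -- The first vertices outside radius `R` lie inside `R'`, where the interior estimate with F = 0
  -- gives α G ≤ κ.
  · have hle : G x ≤ κ / α := by
      refine h.le_of_boundary_le hl hα hG (by positivity) hFR (R' := R')
        (fun y h1 h2 h3 => ?_) hx
      have h4 := hbd y h1 h2 h3
      refine ⟨h4.le, ?_⟩
      have := hin y h4
      rw [hFR y h2, sub_zero] at this
      rw [le_div_iff₀ hα, mul_comm]
      exact (le_abs_self _).trans this
    rw [hFR x hx, sub_zero, abs_of_nonneg (mul_nonneg hα.le (hG x))]
    rw [le_div_iff₀ hα] at hle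
    linarith

end Form

/-! ### Approximation by functions of bounded energy -/

section Approximation

variable {𝒳 : RootedMeasureTree.{u}} [DiscreteTopology 𝒳] {l : Measure 𝒳}

/-- The retraction sends `y` to its highest ancestor in `U`. -/
theorem exists_retraction {U : Set 𝒳} (hU : 𝒳.root ∈ U) : ∃ π : 𝒳 → 𝒳,
    (∀ y, π y ∈ ancestors 𝒳 y ∧ π y ∈ U) ∧
      ∀ y, ∀ a ∈ ancestors 𝒳 y, a ∈ U → a ∈ ancestors 𝒳 (π y) := by
  have hex : ∀ y : 𝒳, ∃ p ∈ ancestors 𝒳 y ∩ U,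
      ∀ a ∈ ancestors 𝒳 y, a ∈ U → a ∈ ancestors 𝒳 p := by
    intro y
    have hfin : (ancestors 𝒳 y ∩ U).Finite := (finite_ancestors y).subset inter_subset_left
    obtain ⟨p, hp, hmax⟩ := hfin.exists_maximalFor (height 𝒳) _
      ⟨𝒳.root, root_mem_ancestors y, hU⟩
    refine ⟨p, hp, fun a ha haU => mem_ancestors_of_height_le ha hp.1 ?_⟩
    rcases le_total (height 𝒳 a) (height 𝒳 p) with h | h
    · exact h
    · exact hmax ⟨ha, haU⟩ h
  choose π h1 h2 using hex
  exact ⟨π, h1, h2⟩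

/-- The lowest ancestor above height `R` has its parent below `R`, so the edge bound applies to it.
-/
theorem exists_ancestor_at_height {R R' : ℝ} (hR : 0 < R)
    (hedge : ∀ x : 𝒳, x ≠ 𝒳.root → height 𝒳 (parent x) < R → height 𝒳 x < R') {y : 𝒳}
    (hy : R ≤ height 𝒳 y) : ∃ b ∈ ancestors 𝒳 y, R ≤ height 𝒳 b ∧ height 𝒳 b < R' := by
  have hfin : (ancestors 𝒳 y ∩ {b | R ≤ height 𝒳 b}).Finite :=
    (finite_ancestors y).subset inter_subset_left
  obtain ⟨b, hb, hmin⟩ := hfin.exists_minimalFor (height 𝒳) _ ⟨y, self_mem_ancestors y, hy⟩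
  have hbr : b ≠ 𝒳.root := by
    rintro rfl
    have := hb.2
    simp only [mem_ofPred_eq, height, dist_self] at this
    linarith
  refine ⟨b, hb.1, hb.2, hedge b hbr ?_⟩
  by_contra hcon
  have hlt := height_parent_lt hbr
  have := hmin ⟨ancestors_trans (parent_spec hbr).1 hb.1, not_lt.1 hcon⟩ hlt.le
  linarith

/-- Let F = f ∘ π, where π retracts onto the subtree `U` spanned by the root and the net `S`. Then
`F` is constant along edges off `U` and has slope at most `K` on `U`, whose length is at most
`S.card * R'`. Since `S` is an ε-net, π moves the relevant points by at most ε. -/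
theorem exists_mem_formDomain_near (hl : IsLengthMeasure 𝒳 l) {f : 𝒳 → ℝ} {K M R R' ε : ℝ}
    (hK : ∀ x y, |f x - f y| ≤ K * dist x y) (hK0 : 0 ≤ K) (hM : ∀ x, |f x| ≤ M)
    (hR : 0 < R) (hRR' : R + 1 ≤ R') (hfR : ∀ x, R ≤ height 𝒳 x → f x = 0)
    (hedge : ∀ x : 𝒳, x ≠ 𝒳.root → height 𝒳 (parent x) < R + 1 → height 𝒳 x < R')
    (hε : ε ≤ 1) (hε0 : 0 ≤ ε) {S : Finset 𝒳} (hS : ∀ s ∈ S, height 𝒳 s < R')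
    (hnet : ∀ y, height 𝒳 y < R' → ∃ s ∈ S, dist y s ≤ ε) :
    ∃ F : 𝒳 → ℝ, F ∈ formDomain 𝒳 l ∧ dirichlet l F ≤ K ^ 2 * (S.card * R') ∧
      (∀ x, ∃ y, F x = f y) ∧ (∀ x, R + 1 ≤ height 𝒳 x → F x = 0) ∧
        ∀ x, |F x - f x| ≤ K * ε := by
  set U : Set 𝒳 := insert 𝒳.root (⋃ s ∈ S, ancestors 𝒳 s) with hU
  have hUroot : 𝒳.root ∈ U := mem_insert _ _
  have hUdown : ∀ x, x ≠ 𝒳.root → x ∈ U → parent x ∈ U := by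
    rintro x hx (h | h)
    · exact absurd h hx
    · obtain ⟨s, hs, hxs⟩ := mem_iUnion₂.1 h
      exact Or.inr (mem_iUnion₂.2 ⟨s, hs, ancestors_trans (parent_spec hx).1 hxs⟩)
  have hlU : l U ≤ ENNReal.ofReal (S.card * R') := by
    calc l U ≤ l {𝒳.root} + ∑ s ∈ S, l (ancestors 𝒳 s) := by
          rw [hU, insert_eq]
          refine (measure_union_le _ _).trans ?_
          gcongr
          exact measure_biUnion_finset_le _ _
      _ ≤ 0 + ∑ s ∈ S, ENNReal.ofReal R' := by
          refine add_le_add hl.singleton_root.le (Finset.sum_le_sum fun s hs => ?_)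
          rw [hl.ancestors]
          exact ENNReal.ofReal_le_ofReal (hS s hs).le
      _ = ENNReal.ofReal (S.card * R') := by
          rw [zero_add, Finset.sum_const, nsmul_eq_mul, ENNReal.ofReal_mul (by positivity),
            ENNReal.ofReal_natCast]
  have hlU' : l U ≠ ∞ := (hlU.trans_lt ENNReal.ofReal_lt_top).ne
  obtain ⟨π, hπ, hπmax⟩ := exists_retraction hUroot
  have hπU : ∀ y ∈ U, π y = y := fun y hy => eq_of_mem_ancestors (hπ y).1
    (height_le_of_mem_ancestors (hπmax y y (self_mem_ancestors y) hy))
  have hπU' : ∀ y ∉ U, π y = π (parent y) := by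
    intro y hy
    have hyr : y ≠ 𝒳.root := fun h => hy (h ▸ hUroot)
    have h1 : π y ∈ ancestors 𝒳 (parent y) :=
      (parent_spec hyr).2.2 _ (hπ y).1 fun h => hy (h ▸ (hπ y).2)
    have h2 := hπmax (parent y) (π y) h1 (hπ y).2
    have h3 := hπmax y (π (parent y)) (ancestors_trans (hπ (parent y)).1 (parent_spec hyr).1)
      (hπ (parent y)).2
    exact eq_of_mem_ancestors h2 (height_le_of_mem_ancestors h3)
  set F : 𝒳 → ℝ := fun y => f (π y) with hF
  have hgrad : ∀ y, ‖grad F y‖ ≤ U.indicator (fun _ => K) y := by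
    intro y
    by_cases hy : y ∈ U
    · rw [indicator_of_mem hy]
      by_cases hyr : y = 𝒳.root
      · have : parent y = y := by rw [parent, dif_pos hyr]
        simpa [grad, this] using hK0
      · have hpos := dist_parent_pos hyr
        rw [grad, hF, Real.norm_eq_abs, abs_div, abs_of_pos hpos, div_le_iff₀ hpos]
        beta_reduce
        rw [hπU y hy, hπU _ (hUdown y hyr hy), dist_comm]
        exact hK _ _
    · rw [indicator_of_notMem hy, grad, hF]
      beta_reduce
      rw [hπU' y hy]
      simp
  have hind : MemLp (U.indicator fun _ => K) 2 l :=
    memLp_indicator_const 2 MeasurableSet.of_discrete K (Or.inr hlU')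
  have hgm : MemLp (grad F) 2 l := hind.mono Measurable.of_discrete.aestronglyMeasurable
    (Eventually.of_forall fun y => (hgrad y).trans (le_abs_self _))
  have hnear : ∀ y, height 𝒳 y < R' → ∃ c ∈ ancestors 𝒳 y, c ∈ U ∧ dist c y ≤ ε := by
    intro y hy
    obtain ⟨s, hs, hys⟩ := hnet y hy
    obtain ⟨c, hc1, hc2, hc3, -⟩ := exists_meet y s
    refine ⟨c, hc1, Or.inr (mem_iUnion₂.2 ⟨s, hs, hc2⟩), ?_⟩
    rw [dist_comm]
    linarith [dist_nonneg (x := c) (y := s)]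
  -- Such an `x` has an ancestor `b` between heights `R + 1` and `R'`, hence one in `U` within
  -- distance `ε ≤ 1` of `b`. So the retraction of `x` is still at height at least `R`.
  have hzero : ∀ x, R + 1 ≤ height 𝒳 x → F x = 0 := by
    intro x hx
    obtain ⟨b, hb1, hb2, hb3⟩ := exists_ancestor_at_height (by linarith) hedge hx
    obtain ⟨c, hc1, hc2, hc3⟩ := hnear b hb3
    have h1 := height_le_of_mem_ancestors (hπmax x c (ancestors_trans hc1 hb1) hc2)
    have h2 := mem_ancestors.1 hc1
    exact hfR _ (by linarith)
  have hfin : {x : 𝒳 | height 𝒳 x ≤ R + 1}.Finite := finite_height_le _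
  refine ⟨F, (mem_formDomain_iff hl).2 ⟨?_, ?_, hgm⟩, ?_, fun x => ⟨π x, rfl⟩, hzero, ?_⟩
  · rw [cocompact_eq_cofinite]
    refine tendsto_const_nhds.congr' ?_
    filter_upwards [hfin.compl_mem_cofinite] with x hx
    have hx : ¬ height 𝒳 x ≤ R + 1 := hx
    exact (hzero x (not_le.1 hx).le).symm
  · have hB : 𝒳.ν {x : 𝒳 | height 𝒳 x ≤ R + 1} ≠ ∞ :=
      (𝒳.finite_of_isBounded _ hfin.isBounded).ne
    have := memLp_indicator_const (μ := 𝒳.ν) 2 (MeasurableSet.of_discrete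
      (s := {x : 𝒳 | height 𝒳 x ≤ R + 1})) M (Or.inr hB)
    refine this.mono Measurable.of_discrete.aestronglyMeasurable (Eventually.of_forall fun x => ?_)
    by_cases hx : height 𝒳 x ≤ R + 1
    · rw [indicator_of_mem (show x ∈ {x : 𝒳 | height 𝒳 x ≤ R + 1} from hx)]
      exact (hM _).trans (le_abs_self _)
    · rw [hzero x (not_le.1 hx).le, norm_zero]
      exact norm_nonneg _
  · have h1 : dirichlet l F ≤ ∫ y, U.indicator (fun _ => K) y ^ 2 ∂l :=
      integral_mono hgm.integrable_sq hind.integrable_sq fun y => by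
        have := hgrad y
        rw [Real.norm_eq_abs] at this
        beta_reduce
        rw [← sq_abs]
        exact pow_le_pow_left₀ (abs_nonneg _) this 2
    have h2 : ∀ y, U.indicator (fun _ => K) y ^ 2 = U.indicator (fun _ => K ^ 2) y := fun y => by
      by_cases hy : y ∈ U <;> simp [hy]
    simp only [h2] at h1
    rw [integral_indicator_const _ MeasurableSet.of_discrete, smul_eq_mul, mul_comm] at h1
    refine h1.trans ?_
    gcongr
    have := ENNReal.toReal_mono ENNReal.ofReal_ne_top hlU
    rwa [ENNReal.toReal_ofReal (mul_nonneg (Nat.cast_nonneg _) (by linarith))] at this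
  · intro x
    rcases lt_or_ge (height 𝒳 x) (R + 1) with hx | hx
    · obtain ⟨c, hc1, hc2, hc3⟩ := hnear x (hx.trans_le hRR')
      have h1 := height_le_of_mem_ancestors (hπmax x c hc1 hc2)
      have h2 := mem_ancestors.1 hc1
      have h3 := mem_ancestors.1 (hπ x).1
      refine (hK _ _).trans ?_
      gcongr
      linarith
    · rw [hzero x hx, hfR x (by linarith), sub_zero, abs_zero]
      positivity

/-- A separated set of maximal size is a net, and the disjoint balls of radius `ε / 3` around its
points share the total mass. -/
theorem exists_net {R ε c M : ℝ} (hε : 0 < ε) (hM : 0 ≤ M)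
    (hmass : ∀ x, height 𝒳 x < R → ENNReal.ofReal c ≤ 𝒳.ν (Metric.closedBall x (ε / 3)))
    (htot : 𝒳.ν (Metric.closedBall 𝒳.root (R + ε)) ≤ ENNReal.ofReal M) :
    ∃ S : Finset 𝒳, (∀ s ∈ S, height 𝒳 s < R) ∧
      (∀ y, height 𝒳 y < R → ∃ s ∈ S, dist y s ≤ ε) ∧ S.card * c ≤ M := by
  classical
  have hfin : {x : 𝒳 | height 𝒳 x < R}.Finite :=
    (finite_height_le R).subset fun x (hx : height 𝒳 x < R) => hx.le
  set Z : Finset (Finset 𝒳) := hfin.toFinset.powerset.filter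
    fun S => ∀ a ∈ S, ∀ b ∈ S, a ≠ b → ε < dist a b with hZ
  obtain ⟨S, hS, hmax⟩ := Z.exists_max_image Finset.card ⟨∅, by simp [hZ]⟩
  have hS' := Finset.mem_filter.1 hS
  have hSR : ∀ s ∈ S, height 𝒳 s < R := fun s hs =>
    hfin.mem_toFinset.1 (Finset.mem_powerset.1 hS'.1 hs)
  refine ⟨S, hSR, fun y hy => ?_, ?_⟩
  · by_contra hcon
    push Not at hcon
    have hyS : y ∉ S := fun h => by
      have := hcon y h
      rw [dist_self] at this
      linarith
    have hmem : insert y S ∈ Z := by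
      rw [hZ, Finset.mem_filter, Finset.mem_powerset]
      refine ⟨Finset.insert_subset (hfin.mem_toFinset.2 hy) (Finset.mem_powerset.1 hS'.1), ?_⟩
      intro a ha b hb hab
      rcases Finset.mem_insert.1 ha with ha' | ha' <;>
        rcases Finset.mem_insert.1 hb with hb' | hb'
      · exact absurd (ha'.trans hb'.symm) hab
      · rw [ha']; exact hcon b hb'
      · rw [hb', dist_comm]; exact hcon a ha'
      · exact hS'.2 a ha' b hb' hab
    have := hmax _ hmem
    rw [Finset.card_insert_of_notMem hyS] at this
    omega
  · have h1 : ∑ s ∈ S, 𝒳.ν (Metric.closedBall s (ε / 3)) ≤ ENNReal.ofReal M := by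
      rw [← measure_biUnion_finset]
      · refine (measure_mono ?_).trans htot
        refine iUnion₂_subset fun s hs z hz => ?_
        rw [Metric.mem_closedBall] at hz ⊢
        have := hSR s hs
        rw [height, dist_comm] at this
        linarith [dist_triangle z s 𝒳.root]
      · intro a ha b hb hab
        refine Metric.closedBall_disjoint_closedBall ?_
        have := hS'.2 a ha b hb hab
        linarith
      · exact fun _ _ => MeasurableSet.of_discrete
    have h2 : ENNReal.ofReal (S.card * c) ≤ ENNReal.ofReal M := by
      refine le_trans ?_ h1
      rw [ENNReal.ofReal_mul (by positivity), ENNReal.ofReal_natCast, ← nsmul_eq_mul]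
      exact Finset.card_nsmul_le_sum _ _ _ fun s hs => hmass s (hSR s hs)
    exact (ENNReal.ofReal_le_ofReal_iff hM).1 h2

end Approximation

/-! ### The transition semigroup and its Laplace transform -/

theorem measurable_of_rightContinuous {h : ℝ≥0 → ℝ}
    (hr : ∀ t, ContinuousWithinAt h (Ici t) t) : Measurable h := by
  refine measurable_of_tendsto_metrizable
    (f := fun (m : ℕ) (t : ℝ≥0) => h (((⌈t * 2 ^ m⌉₊ : ℕ) : ℝ≥0) / 2 ^ m)) (fun m => ?_) ?_
  · have h1 : Measurable fun t : ℝ≥0 => ⌈t * 2 ^ m⌉₊ :=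
      Nat.measurable_ceil.comp (measurable_id.mul_const _)
    exact (Measurable.of_discrete (f := fun k : ℕ => h ((k : ℝ≥0) / 2 ^ m))).comp h1
  · rw [tendsto_pi_nhds]
    intro t
    exact (hr t).tendsto.comp (tendsto_ceil_div_pow t)

section Semigroup

variable {S : Type u} [TopologicalSpace S] [MeasurableSpace S]

/-- The transition semigroup of a Markov process. -/
def semigroup (Q : Kernel S (CadlagPath S)) (t : ℝ≥0) (g : S → ℝ) (x : S) : ℝ :=
  ∫ w, g (w t) ∂(Q x)

/-- The Laplace transform of the transition semigroup. -/
def laplace (Q : Kernel S (CadlagPath S)) (α : ℝ) (g : S → ℝ) (x : S) : ℝ :=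
  ∫ t in Ioi (0 : ℝ), Real.exp (-α * t) * semigroup Q t.toNNReal g x

variable {Q : Kernel S (CadlagPath S)} {g : S → ℝ} {M : ℝ}

theorem laplace_nonneg (α : ℝ) (hg : ∀ x, 0 ≤ g x) (x : S) : 0 ≤ laplace Q α g x :=
  integral_nonneg fun _ => mul_nonneg (Real.exp_pos _).le (integral_nonneg fun _ => hg _)

variable [IsMarkovKernel Q]

theorem abs_semigroup_le (hM : ∀ x, |g x| ≤ M) (t : ℝ≥0) (x : S) : |semigroup Q t g x| ≤ M := by
  have := norm_integral_le_of_norm_le_const (μ := Q x) (f := fun w : CadlagPath S => g (w t))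
    (Eventually.of_forall fun w => hM (w t))
  rw [probReal_univ, mul_one] at this
  exact this

theorem integral_exp_neg_mul_Ioi {α : ℝ} (hα : 0 < α) (a : ℝ) :
    ∫ t in Ioi a, Real.exp (-α * t) = Real.exp (-α * a) / α := by
  rw [integral_exp_mul_Ioi (by linarith), neg_div_neg_eq]

theorem abs_setIntegral_exp_mul_le {α : ℝ} (hα : 0 < α) {h : ℝ → ℝ} (hM : ∀ t, |h t| ≤ M)
    (a : ℝ) : |∫ t in Ioi a, Real.exp (-α * t) * h t| ≤ Real.exp (-α * a) / α * M := by
  rw [← integral_exp_neg_mul_Ioi hα a, ← integral_mul_const, ← Real.norm_eq_abs]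
  refine norm_integral_le_of_norm_le ((exp_neg_integrableOn_Ioi a hα).mul_const M)
    (Eventually.of_forall fun t => ?_)
  rw [norm_mul, Real.norm_eq_abs, Real.norm_eq_abs, abs_of_pos (Real.exp_pos _)]
  gcongr
  exact hM t

theorem abs_mul_laplace_le {α : ℝ} (hα : 0 < α) (hM : ∀ x, |g x| ≤ M) (x : S) :
    |α * laplace Q α g x| ≤ M := by
  have := abs_setIntegral_exp_mul_le hα (h := fun t => semigroup Q t.toNNReal g x)
    (fun t => abs_semigroup_le hM _ _) 0
  rw [mul_zero, Real.exp_zero] at this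
  rw [abs_mul, abs_of_pos hα]
  calc α * |laplace Q α g x| ≤ α * (1 / α * M) := by gcongr; exact this
    _ = M := by field_simp

variable [DiscreteMeasurableSpace S]

theorem integrable_eval (hM : ∀ x, |g x| ≤ M) (t : ℝ≥0) (x : S) :
    Integrable (fun w : CadlagPath S => g (w t)) (Q x) :=
  Integrable.of_bound ((Measurable.of_discrete (f := g)).comp
    (measurable_eval t)).aestronglyMeasurable M (Eventually.of_forall fun w => hM (w t))

theorem measurable_semigroup (hg : Continuous g) (hM : ∀ x, |g x| ≤ M) (x : S) :
    Measurable fun t => semigroup Q t g x := by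
  refine measurable_of_rightContinuous fun t => ?_
  refine tendsto_integral_filter_of_dominated_convergence (fun _ => M)
    (Eventually.of_forall fun s => (integrable_eval hM s x).aestronglyMeasurable)
    (Eventually.of_forall fun s => Eventually.of_forall fun w => hM (w s))
    (integrable_const M) (Eventually.of_forall fun w => ?_)
  exact (hg.tendsto _).comp (w.rightCts t)

theorem integrableOn_exp_mul {α : ℝ} (hα : 0 < α) {h : ℝ → ℝ} (hh : Measurable h)
    (hM : ∀ t, |h t| ≤ M) (a : ℝ) : IntegrableOn (fun t => Real.exp (-α * t) * h t) (Ioi a) :=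
  Integrable.mul_bdd (exp_neg_integrableOn_Ioi a hα) hh.aestronglyMeasurable
    (Eventually.of_forall hM)

theorem laplace_sub {α : ℝ} (hα : 0 < α) {g' : S → ℝ} (hg : Continuous g) (hg' : Continuous g')
    (hM : ∀ x, |g x| ≤ M) (hM' : ∀ x, |g' x| ≤ M) (x : S) :
    laplace Q α (fun y => g y - g' y) x = laplace Q α g x - laplace Q α g' x := by
  have hi : ∀ {k : S → ℝ}, Continuous k → (∀ x, |k x| ≤ M) →
      IntegrableOn (fun t : ℝ => Real.exp (-α * t) * semigroup Q t.toNNReal k x) (Ioi 0) :=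
    fun hk hk' => integrableOn_exp_mul hα
      ((measurable_semigroup hk hk' x).comp measurable_real_toNNReal)
      (fun t => abs_semigroup_le hk' _ _) 0
  rw [laplace, laplace, laplace, ← integral_sub (hi hg hM) (hi hg' hM')]
  congr 1
  ext t
  rw [← mul_sub]
  congr 1
  exact integral_sub (integrable_eval hM _ x) (integrable_eval hM' _ x)

/-- The simple Markov property of the process with laws `Q`. -/
def HasMarkovProperty (Q : Kernel S (CadlagPath S)) : Prop :=
  ∀ (x : S) (s t : ℝ≥0) (A : Set (CadlagPath S)) (B : Set S),
    MeasurableSet[pathPast S s] A → MeasurableSet B →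
      Q x (A ∩ {w | w (s + t) ∈ B}) = ∫⁻ w in A, Q (w s) {w' | w' t ∈ B} ∂(Q x)

/-- Chapman-Kolmogorov: the Markov property with the trivial past event says that the transition
kernels compose. -/
theorem semigroup_add (hQ : HasMarkovProperty Q) (hM : ∀ x, |g x| ≤ M) (s t : ℝ≥0) (x : S) :
    semigroup Q (s + t) g x = semigroup Q s (semigroup Q t g) x := by
  have hk : Q.map (fun w => w (s + t)) = (Q.map fun w => w t) ∘ₖ (Q.map fun w => w s) := by
    ext y B hB
    rw [Kernel.comp_apply' _ _ _ hB, Kernel.map_apply' _ (measurable_eval _) _ hB,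
      Kernel.map_apply _ (measurable_eval _),
      lintegral_map (Measurable.of_discrete) (measurable_eval _)]
    have := hQ y s t univ B MeasurableSet.univ hB
    rw [univ_inter, Measure.restrict_univ] at this
    simp only [Kernel.map_apply' _ (measurable_eval _) _ hB]
    exact this
  have h1 : ∀ (r : ℝ≥0) (y : S), semigroup Q r g y = ∫ z, g z ∂(Q.map (fun w => w r) y) := by
    intro r y
    rw [Kernel.map_apply _ (measurable_eval _), integral_map (measurable_eval _).aemeasurable
      (Measurable.of_discrete).aestronglyMeasurable]
    rfl
  have : IsMarkovKernel (Q.map fun w : CadlagPath S => w t) :=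
    Kernel.IsMarkovKernel.map _ (measurable_eval t)
  have : IsMarkovKernel (Q.map fun w : CadlagPath S => w s) :=
    Kernel.IsMarkovKernel.map _ (measurable_eval s)
  rw [h1, hk, Kernel.integral_comp]
  · rw [Kernel.map_apply _ (measurable_eval s), integral_map (measurable_eval _).aemeasurable
      (Measurable.of_discrete).aestronglyMeasurable]
    simp only [← h1]
    rfl
  · exact Integrable.of_bound (Measurable.of_discrete).aestronglyMeasurable M
      (Eventually.of_forall hM)

/-- Chebyshev's inequality: the second moment of g(x) - g(X_s) is a combination of P_s g - g and P_s
g² - g² at `x`. -/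
theorem measure_lt_abs_sub_le (hM : ∀ x, |g x| ≤ M) {θ θ' γ : ℝ} {s : ℝ≥0} {x : S}
    (hγ : 0 < γ) (hθ : |semigroup Q s g x - g x| ≤ θ)
    (hθ' : |semigroup Q s (fun y => g y ^ 2) x - g x ^ 2| ≤ θ') :
    Q x {w | γ < |g x - g (w s)|} ≤ ENNReal.ofReal ((θ' + 2 * M * θ) / γ ^ 2) := by
  have hM2 : ∀ y, |g y ^ 2| ≤ M ^ 2 := fun y => by
    rw [abs_pow]
    exact pow_le_pow_left₀ (abs_nonneg _) (hM y) 2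
  have hM0 : 0 ≤ M := (abs_nonneg _).trans (hM x)
  have i1 := integrable_eval (Q := Q) hM s x
  have i2 := integrable_eval (Q := Q) hM2 s x
  have hinteg : Integrable (fun w : CadlagPath S => (g x - g (w s)) ^ 2) (Q x) := by
    have : (fun w : CadlagPath S => (g x - g (w s)) ^ 2) =
        fun w => g (w s) ^ 2 - 2 * g x * g (w s) + g x ^ 2 := by ext w; ring
    rw [this]
    exact (i2.sub (i1.const_mul _)).add (integrable_const _)
  have heq : ∫ w, (g x - g (w s)) ^ 2 ∂(Q x) =
      (semigroup Q s (fun y => g y ^ 2) x - g x ^ 2) - 2 * g x * (semigroup Q s g x - g x) := by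
    have : (fun w : CadlagPath S => (g x - g (w s)) ^ 2) =
        fun w => g (w s) ^ 2 - 2 * g x * g (w s) + g x ^ 2 := by ext w; ring
    rw [this]
    have i3 : Integrable (fun w : CadlagPath S => g (w s) ^ 2 - 2 * g x * g (w s)) (Q x) :=
      i2.sub (i1.const_mul _)
    rw [integral_add i3 (integrable_const _), integral_sub i2 (i1.const_mul _),
      integral_const_mul, integral_const]
    simp only [semigroup, probReal_univ, smul_eq_mul]
    ring
  have hle : ∫ w, (g x - g (w s)) ^ 2 ∂(Q x) ≤ θ' + 2 * M * θ := by
    rw [heq]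
    have h1 := (abs_le.1 hθ').2
    have h2 : |2 * g x * (semigroup Q s g x - g x)| ≤ 2 * M * θ := by
      rw [abs_mul, abs_mul, abs_of_pos (by norm_num : (0 : ℝ) < 2)]
      gcongr
      exact hM x
    have h3 := (abs_le.1 h2).1
    linarith
  have hcheb := mul_meas_ge_le_integral_of_nonneg (μ := Q x)
    (f := fun w : CadlagPath S => (g x - g (w s)) ^ 2)
    (Eventually.of_forall fun _ => sq_nonneg _) hinteg (γ ^ 2)
  have hsub : {w : CadlagPath S | γ < |g x - g (w s)|} ⊆
      {w | γ ^ 2 ≤ (g x - g (w s)) ^ 2} := by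
    intro w hw
    have hw : γ < |g x - g (w s)| := hw
    change γ ^ 2 ≤ (g x - g (w s)) ^ 2
    rw [← sq_abs (g x - g (w s))]
    exact pow_le_pow_left₀ hγ.le hw.le 2
  have hreal : (Q x).real {w : CadlagPath S | γ < |g x - g (w s)|} ≤
      (θ' + 2 * M * θ) / γ ^ 2 := by
    rw [le_div_iff₀ (by positivity), mul_comm]
    calc γ ^ 2 * (Q x).real {w : CadlagPath S | γ < |g x - g (w s)|}
        ≤ γ ^ 2 * (Q x).real {w | γ ^ 2 ≤ (g x - g (w s)) ^ 2} := by
          gcongr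
          exact measure_ne_top _ _
      _ ≤ _ := hcheb.trans hle
  rw [← ENNReal.ofReal_toReal (measure_ne_top (Q x) _)]
  exact ENNReal.ofReal_le_ofReal hreal

variable [Countable S]

theorem semigroup_laplace (hQ : HasMarkovProperty Q) {α : ℝ} (hα : 0 < α) (hg : Continuous g)
    (hM : ∀ x, |g x| ≤ M) (s : ℝ≥0) (x : S) : semigroup Q s (laplace Q α g) x =
      ∫ t in Ioi (0 : ℝ), Real.exp (-α * t) * semigroup Q (s + t.toNNReal) g x := by
  have hmeas : Measurable fun p : CadlagPath S × ℝ =>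
      Real.exp (-α * p.2) * semigroup Q p.2.toNNReal g (p.1 s) := by
    have h1 : Measurable fun p : S × ℝ => semigroup Q p.2.toNNReal g p.1 :=
      measurable_from_prod_countable_right fun y =>
        (measurable_semigroup hg hM y).comp measurable_real_toNNReal
    have h2 : Measurable fun p : CadlagPath S × ℝ => semigroup Q p.2.toNNReal g (p.1 s) :=
      h1.comp (((measurable_eval s).comp measurable_fst).prodMk measurable_snd)
    exact (Real.measurable_exp.comp (measurable_snd.const_mul _)).mul h2
  have hinteg : Integrable (Function.uncurry fun (w : CadlagPath S) (t : ℝ) =>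
      Real.exp (-α * t) * semigroup Q t.toNNReal g (w s))
      ((Q x).prod (volume.restrict (Ioi 0))) := by
    have h1 : Integrable (fun p : CadlagPath S × ℝ => (1 : ℝ) * (Real.exp (-α * p.2) * M))
        ((Q x).prod (volume.restrict (Ioi 0))) :=
      (integrable_const (1 : ℝ)).mul_prod ((exp_neg_integrableOn_Ioi 0 hα).mul_const M)
    refine h1.mono' hmeas.aestronglyMeasurable (Eventually.of_forall fun p => ?_)
    simp only [Function.uncurry]
    rw [norm_mul, Real.norm_eq_abs, Real.norm_eq_abs, abs_of_pos (Real.exp_pos _), one_mul]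
    gcongr
    exact abs_semigroup_le hM _ _
  rw [semigroup]
  simp only [laplace]
  rw [integral_integral_swap hinteg]
  congr 1
  ext t
  rw [integral_const_mul, semigroup_add hQ hM]
  rfl

/-- Shifting time turns P_s G into exp(α s) times the part of the Laplace integral beyond `s`. The
missing part and the factor contribute at most M s each. -/
theorem abs_semigroup_laplace_sub_le (hQ : HasMarkovProperty Q) {α : ℝ} (hα : 0 < α)
    (hg : Continuous g) (hM : ∀ x, |g x| ≤ M) (s : ℝ≥0) (x : S) :
    |semigroup Q s (laplace Q α g) x - laplace Q α g x| ≤ 2 * M * s := by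
  have hM0 : 0 ≤ M := (abs_nonneg _).trans (hM x)
  set h : ℝ → ℝ := fun t => semigroup Q t.toNNReal g x with hh
  have hhm : Measurable h := (measurable_semigroup hg hM x).comp measurable_real_toNNReal
  have hhM : ∀ t, |h t| ≤ M := fun t => abs_semigroup_le hM _ _
  have hs0 : (0 : ℝ) ≤ s := s.2
  have hi := integrableOn_exp_mul hα hhm hhM
  have e1 : semigroup Q s (laplace Q α g) x =
      Real.exp (α * s) * ∫ t in Ioi (s : ℝ), Real.exp (-α * t) * h t := by
    rw [semigroup_laplace hQ hα hg hM, ← integral_const_mul, ← integral_indicator measurableSet_Ioi,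
      ← integral_indicator measurableSet_Ioi]
    refine Eq.trans ?_ (integral_add_right_eq_self _ (s : ℝ))
    congr 1
    ext t
    by_cases ht : 0 < t
    · rw [indicator_of_mem (show t ∈ Ioi (0 : ℝ) from ht),
        indicator_of_mem (show t + s ∈ Ioi (s : ℝ) by simpa using ht), ← mul_assoc, ← Real.exp_add,
        hh]
      congr 1
      · congr 1
        ring
      · simp only
        congr 1
        rw [Real.toNNReal_add ht.le hs0, Real.toNNReal_coe, add_comm]
    · rw [indicator_of_notMem (show t ∉ Ioi (0 : ℝ) from ht),
        indicator_of_notMem (show t + s ∉ Ioi (s : ℝ) by simpa using ht)]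
  have e2 : laplace Q α g x = (∫ t in Ioc (0 : ℝ) s, Real.exp (-α * t) * h t) +
      ∫ t in Ioi (s : ℝ), Real.exp (-α * t) * h t := by
    rw [← setIntegral_union (Ioc_disjoint_Ioi le_rfl) measurableSet_Ioi
      ((hi 0).mono_set Ioc_subset_Ioi_self) (hi s), Ioc_union_Ioi_eq_Ioi hs0]
    rfl
  have b1 : |∫ t in Ioc (0 : ℝ) s, Real.exp (-α * t) * h t| ≤ M * s := by
    have := norm_setIntegral_le_of_norm_le_const (μ := volume) (s := Ioc (0 : ℝ) s)
      (f := fun t => Real.exp (-α * t) * h t) (C := M) (by simp) fun t ht => ?_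
    · rw [Real.norm_eq_abs, Real.volume_real_Ioc_of_le hs0, sub_zero] at this
      exact this
    · rw [norm_mul, Real.norm_eq_abs, Real.norm_eq_abs, abs_of_pos (Real.exp_pos _)]
      have : Real.exp (-α * t) ≤ 1 := Real.exp_le_one_iff.2 (by nlinarith [ht.1])
      calc Real.exp (-α * t) * |h t| ≤ 1 * M := by gcongr; exact hhM t
        _ = M := one_mul M
  have b2 := abs_setIntegral_exp_mul_le hα hhM s
  rw [e1, e2]
  set J := ∫ t in Ioi (s : ℝ), Real.exp (-α * t) * h t
  set J' := ∫ t in Ioc (0 : ℝ) s, Real.exp (-α * t) * h t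
  have hexp : 1 ≤ Real.exp (α * s) := Real.one_le_exp (by positivity)
  have b3 : (Real.exp (α * s) - 1) * |J| ≤ M * s := by
    have h1 : (Real.exp (α * s) - 1) * Real.exp (-α * s) ≤ α * s := by
      rw [sub_mul, ← Real.exp_add, one_mul]
      have : α * s + -α * s = 0 := by ring
      rw [this, Real.exp_zero]
      have := Real.add_one_le_exp (-α * s)
      linarith
    calc (Real.exp (α * s) - 1) * |J|
        ≤ (Real.exp (α * s) - 1) * (Real.exp (-α * s) / α * M) :=
          mul_le_mul_of_nonneg_left b2 (by linarith)
      _ = ((Real.exp (α * s) - 1) * Real.exp (-α * s)) * (M / α) := by ring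
      _ ≤ (α * s) * (M / α) := by gcongr
      _ = M * s := by field_simp
  have : Real.exp (α * s) * J - (J' + J) = (Real.exp (α * s) - 1) * J - J' := by ring
  rw [this]
  refine (abs_sub _ _).trans ?_
  rw [abs_mul, abs_of_nonneg (by linarith : (0 : ℝ) ≤ Real.exp (α * s) - 1)]
  linarith

/-- Insert α G g: the contraction P_s preserves the error κ, which occurs twice, and P_s moves α G g
by at most 2 M α s. -/
theorem abs_semigroup_sub_le (hQ : HasMarkovProperty Q) {α κ : ℝ} (hα : 0 < α)
    (hg : Continuous g) (hM : ∀ x, |g x| ≤ M) (hκ : ∀ x, |α * laplace Q α g x - g x| ≤ κ)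
    (s : ℝ≥0) (x : S) : |semigroup Q s g x - g x| ≤ 2 * κ + 2 * M * α * s := by
  have h1 : ∀ y, |g y - α * laplace Q α g y| ≤ κ := fun y => by rw [abs_sub_comm]; exact hκ y
  have h2 := abs_semigroup_le (Q := Q) h1 s x
  have h3 := abs_semigroup_laplace_sub_le hQ hα hg hM s x
  have h4 : semigroup Q s (fun y => g y - α * laplace Q α g y) x =
      semigroup Q s g x - α * semigroup Q s (laplace Q α g) x := by
    have hi := integrable_eval (Q := Q) (abs_mul_laplace_le (Q := Q) hα hM) s x
    simp only [semigroup]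
    rw [integral_sub (integrable_eval hM s x) hi, integral_const_mul]
  have h5 : semigroup Q s g x - g x = semigroup Q s (fun y => g y - α * laplace Q α g y) x +
      α * (semigroup Q s (laplace Q α g) x - laplace Q α g x) + (α * laplace Q α g x - g x) := by
    rw [h4]; ring
  rw [h5]
  have h6 : |α * (semigroup Q s (laplace Q α g) x - laplace Q α g x)| ≤ α * (2 * M * s) := by
    rw [abs_mul, abs_of_pos hα]
    gcongr
  refine (abs_add_three _ _ _).trans ?_
  have := hκ x
  linarith

end Semigroup

/-! ### Uniform continuity of the semigroup of a speed motion -/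

theorem extendZero_coe {T : Type u} (f : T → ℝ) (x : T) : extendZero f (x : OnePoint T) = f x :=
  rfl

theorem extendZero_infty {T : Type u} (f : T → ℝ) : extendZero f (OnePoint.infty) = 0 := rfl

theorem abs_extendZero_le {T : Type u} {f : T → ℝ} {M : ℝ} (hM0 : 0 ≤ M) (hM : ∀ x, |f x| ≤ M)
    (x : OnePoint T) : |extendZero f x| ≤ M := by
  induction x using OnePoint.rec with
  | infty => rw [extendZero_infty, abs_zero]; exact hM0
  | coe x => exact hM x

theorem extendZero_sub {T : Type u} (f f' : T → ℝ) :
    extendZero (fun y => f y - f' y) = fun y => extendZero f y - extendZero f' y := by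
  ext x
  induction x using OnePoint.rec with
  | infty => simp [extendZero_infty]
  | coe x => rfl

theorem extendZero_sq {T : Type u} (f : T → ℝ) :
    extendZero (fun y => f y ^ 2) = fun y => extendZero f y ^ 2 := by
  ext x
  induction x using OnePoint.rec with
  | infty => simp [extendZero_infty]
  | coe x => rfl

theorem continuous_extendZero {T : Type u} [TopologicalSpace T] [T2Space T] {f : T → ℝ}
    (hf : Continuous f) (h : Tendsto f (cocompact T) (𝓝 0)) : Continuous (extendZero f) := by
  rw [OnePoint.continuous_iff, coclosedCompact_eq_cocompact]
  exact ⟨h, hf⟩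

theorem IsSpeedMotion.laplace_infty {𝒳 : RootedMeasureTree.{u}}
    {Q : Kernel (OnePoint 𝒳) (CadlagPath (OnePoint 𝒳))} (hQ : IsSpeedMotion 𝒳 Q)
    (α : ℝ) (f : 𝒳 → ℝ) :
    laplace Q α (extendZero f) OnePoint.infty = 0 := by
  have : ∀ t, semigroup Q t (extendZero f) OnePoint.infty = 0 := by
    intro t
    rw [semigroup]
    refine integral_eq_zero_of_ae ?_
    filter_upwards [hQ.absorbed] with w hw
    rw [hw t]
    rfl
  rw [laplace]
  simp [this]

section OneTree

variable {𝒳 : RootedMeasureTree.{u}} [DiscreteTopology 𝒳]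

instance : Countable (OnePoint 𝒳) := inferInstanceAs (Countable (Option 𝒳))

instance : DiscreteMeasurableSpace (OnePoint 𝒳) :=
  MeasurableSingletonClass.toDiscreteMeasurableSpace

theorem tendsto_cocompact_of_height {f : 𝒳 → ℝ} {R : ℝ} (hf : ∀ x, R ≤ height 𝒳 x → f x = 0) :
    Tendsto f (cocompact 𝒳) (𝓝 0) := by
  rw [cocompact_eq_cofinite]
  refine tendsto_const_nhds.congr' ?_
  filter_upwards [(finite_height_le R).compl_mem_cofinite] with x hx
  have hx : ¬ height 𝒳 x ≤ R := hx
  exact (hf x (not_le.1 hx).le).symm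

variable {Q : Kernel (OnePoint 𝒳) (CadlagPath (OnePoint 𝒳))}

/-- The function `f` is exchanged for its finite-energy approximation `F`. This costs `K * ε` twice,
once directly and once under the contraction α G; the remaining terms are the resolvent estimate for
`F`. -/
theorem IsSpeedMotion.abs_mul_laplace_sub_le (hQ : IsSpeedMotion 𝒳 Q) {f : 𝒳 → ℝ}
    {K M R R' ε δ c c' M' α : ℝ} (hf0 : ∀ x, 0 ≤ f x)
    (hK : ∀ x y, |f x - f y| ≤ K * dist x y) (hK0 : 0 ≤ K) (hM : ∀ x, |f x| ≤ M)
    (hR : 0 < R) (hRR' : R + 1 ≤ R') (hfR : ∀ x, R ≤ height 𝒳 x → f x = 0)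
    (hedge : ∀ x : 𝒳, x ≠ 𝒳.root → height 𝒳 (parent x) < R + 1 → height 𝒳 x < R')
    (hε : ε ≤ 1) (hε0 : 0 < ε) (hδ : 0 < δ) (hc : 0 < c) (hc' : 0 < c') (hM' : 0 ≤ M')
    (hα : 0 < α)
    (hmass' : ∀ x, height 𝒳 x < R' → ENNReal.ofReal c' ≤ 𝒳.ν (Metric.closedBall x (ε / 3)))
    (hmass : ∀ x, height 𝒳 x < R' → ENNReal.ofReal c ≤ 𝒳.ν (Metric.closedBall x δ))
    (htot : 𝒳.ν (Metric.closedBall 𝒳.root (R' + ε)) ≤ ENNReal.ofReal M') (x : OnePoint 𝒳) :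
    |α * laplace Q α (extendZero f) x - extendZero f x| ≤
      2 * (K * ε) + (√((K ^ 2 * (M' / c' * R') + 1) / (α * c)) +
        √(2 * (K ^ 2 * (M' / c' * R') + 1) * δ)) := by
  have := hQ.isMarkovKernel
  set I := K ^ 2 * (M' / c' * R') + 1 with hI
  have hM0 : 0 ≤ M := (abs_nonneg _).trans (hM 𝒳.root)
  induction x using OnePoint.rec with
  | infty =>
    rw [hQ.laplace_infty, extendZero_infty, mul_zero, sub_zero, abs_zero]
    positivity
  | coe x =>
    obtain ⟨l, hl, hass⟩ := hQ.associated
    obtain ⟨S, hS, hnet, hcard⟩ := exists_net hε0 hM' hmass' htot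
    obtain ⟨F, hF, hFI, hFval, hFR, hFf⟩ := exists_mem_formDomain_near hl hK hK0 hM hR hRR' hfR
      hedge hε hε0.le hS hnet
    have hFM : ∀ x, |F x| ≤ M := fun x => by
      obtain ⟨y, hy⟩ := hFval x
      rw [hy]
      exact hM y
    obtain ⟨u, hu1, hu2⟩ := hass α F hα Measurable.of_discrete ⟨M, hFM⟩
      ((mem_formDomain_iff hl).1 hF).2.1
    have hF0 : ∀ x, 0 ≤ extendZero F x := by
      intro x
      induction x using OnePoint.rec with
      | infty => exact le_rfl
      | coe x =>
        obtain ⟨y, hy⟩ := hFval x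
        rw [extendZero_coe, hy]
        exact hf0 y
    have hFI' : dirichlet l F ≤ I := by
      refine hFI.trans ?_
      have : (S.card : ℝ) ≤ M' / c' := (le_div_iff₀ hc').2 hcard
      have h2 : K ^ 2 * (S.card * R') ≤ K ^ 2 * (M' / c' * R') := by
        gcongr
        linarith
      linarith
    have hI0 : 0 < I := by
      have : 0 ≤ R' := by linarith
      positivity
    have h1 := IsWeakResolvent.abs_sub_le_of_mass_bound hl hα hF ⟨hu1, hu2⟩
      (fun x => laplace_nonneg α hF0 x) hδ hc hI0 hFR (fun y hy _ hy' => hedge y hy hy')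
      hRR' hmass hFI' x
    have h2 : |α * laplace Q α (fun y => extendZero f y - extendZero F y) x| ≤ K * ε := by
      rw [← extendZero_sub]
      refine abs_mul_laplace_le hα (abs_extendZero_le (by positivity) fun y => ?_) _
      rw [abs_sub_comm]
      exact hFf y
    rw [laplace_sub hα (continuous_extendZero continuous_of_discreteTopology
      (tendsto_cocompact_of_height hfR)) (continuous_extendZero continuous_of_discreteTopology
      (tendsto_cocompact_of_height hFR)) (abs_extendZero_le hM0 hM)
      (abs_extendZero_le hM0 hFM)] at h2
    have h3 := hFf x
    rw [extendZero_coe]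
    have h4 : α * laplace Q α (extendZero f) x - f x =
        α * (laplace Q α (extendZero f) x - laplace Q α (extendZero F) x) +
          (α * laplace Q α (extendZero F) x - F x) + (F x - f x) := by ring
    rw [h4]
    refine (abs_add_three _ _ _).trans ?_
    have h5 : |α * laplace Q α (extendZero F) x - F x| ≤ √(I / (α * c)) + √(2 * I * δ) := h1
    linarith

end OneTree

/-! ### Uniform bounds along the sequence -/

section Sequence

variable {𝒳 : ℕ → RootedMeasureTree.{u}}

theorem LocalLowerMassBound.exists_pos (h : LocalLowerMassBound 𝒳) {δ R : ℝ} (hδ : 0 < δ)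
    (hR : 0 < R) : ∃ c : ℝ, 0 < c ∧ ∀ n, ∀ x : 𝒳 n, height (𝒳 n) x < R →
      ENNReal.ofReal c ≤ (𝒳 n).ν (Metric.closedBall x δ) := by
  obtain ⟨c, hc0, hc⟩ := ENNReal.lt_iff_exists_nnreal_btwn.1 (h δ R hδ hR)
  refine ⟨c, by exact_mod_cast hc0, fun n x hx => ?_⟩
  rw [ENNReal.ofReal_coe_nnreal]
  refine hc.le.trans ((iInf_le _ n).trans (iInf₂_le x ?_))
  rw [Metric.mem_ball, dist_comm]
  exact hx

theorem EdgeLengthBound.exists_bound [∀ n, DiscreteTopology (𝒳 n)] (h : EdgeLengthBound 𝒳)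
    {R : ℝ} (hR : 0 < R) : ∃ R' : ℝ, R ≤ R' ∧ ∀ᶠ n in atTop, ∀ x : 𝒳 n, x ≠ (𝒳 n).root →
      height (𝒳 n) (parent x) < R → height (𝒳 n) x < R' := by
  obtain ⟨c, hc0, hc⟩ := ENNReal.lt_iff_exists_nnreal_btwn.1 (h R hR)
  refine ⟨R + c, by simp, ?_⟩
  filter_upwards [eventually_lt_of_limsup_lt hc0] with n hn x hx hpx
  have h1 : edist (parent x) x ≤ _ := le_iSup₂_of_le (f := fun (x : 𝒳 n)
    (_ : x ∈ Metric.ball (𝒳 n).root R) => ⨆ z : 𝒳 n, ⨆ _ : IsEdge x z, edist x z) (parent x)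
    (by rw [Metric.mem_ball, dist_comm]; exact hpx)
    (le_iSup₂_of_le (f := fun (z : 𝒳 n) (_ : IsEdge (parent x) z) => edist (parent x) z) x
      (isEdge_parent hx) le_rfl)
  have h2 := h1.trans_lt hn
  rw [edist_nndist, ENNReal.coe_lt_coe, ← NNReal.coe_lt_coe, coe_nndist] at h2
  have := dist_triangle (𝒳 n).root (parent x) x
  simp only [height] at hpx ⊢
  linarith

/-- Weak convergence is tested against the constant 1 on a larger ball whose radius avoids the
exceptional set. -/
theorem VagueConvergence.exists_mass_le {𝒴 : RootedMeasureTree.{u}} {E : Type u} [MetricSpace E]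
    {ρE : E} {φ : ∀ n, 𝒳 n → E} {φ' : 𝒴 → E} (h : VagueConvergence ρE 𝒳 𝒴 φ φ')
    (hφ : ∀ n, Isometry (φ n)) (hroot : ∀ n, φ n (𝒳 n).root = ρE) (R : ℝ) :
    ∃ M : ℝ, 0 ≤ M ∧ ∀ᶠ n in atTop,
      (𝒳 n).ν (Metric.closedBall (𝒳 n).root R) ≤ ENNReal.ofReal M := by
  let : MeasurableSpace E := borel E
  have : BorelSpace E := ⟨rfl⟩
  obtain ⟨C, hC, hlim⟩ := h
  obtain ⟨R₁, hR₁C, hR₁⟩ := (hC.dense_compl ℝ).exists_gt (max R 0)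
  have h1 := hlim R₁ ((le_max_right _ _).trans_lt hR₁) hR₁C (BoundedContinuousFunction.const E 1)
  set a := ∫ y in Metric.closedBall ρE R₁, BoundedContinuousFunction.const E (1 : ℝ) y
    ∂(𝒴.ν.map φ')
  refine ⟨max (a + 1) 0, le_max_right _ _, ?_⟩
  filter_upwards [h1.eventually_lt_const (lt_add_one a)] with n hn
  have hfin : (𝒳 n).ν (Metric.closedBall (𝒳 n).root R₁) < ∞ :=
    (𝒳 n).finite_of_isBounded _ Metric.isBounded_closedBall
  have hmap : (𝒳 n).ν.map (φ n) (Metric.closedBall ρE R₁) =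
      (𝒳 n).ν (Metric.closedBall (𝒳 n).root R₁) := by
    rw [Measure.map_apply (hφ n).continuous.measurable Metric.isClosed_closedBall.measurableSet,
      ← hroot n, (hφ n).preimage_closedBall]
  simp only [BoundedContinuousFunction.const_apply, setIntegral_const, smul_eq_mul, mul_one,
    Measure.real, hmap] at hn
  calc (𝒳 n).ν (Metric.closedBall (𝒳 n).root R)
      ≤ (𝒳 n).ν (Metric.closedBall (𝒳 n).root R₁) :=
        measure_mono (Metric.closedBall_subset_closedBall ((le_max_left _ _).trans hR₁.le))
    _ = ENNReal.ofReal ((𝒳 n).ν (Metric.closedBall (𝒳 n).root R₁)).toReal :=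
        (ENNReal.ofReal_toReal hfin.ne).symm
    _ ≤ _ := ENNReal.ofReal_le_ofReal (hn.le.trans (le_max_left _ _))

/-- For every `R`, the masses of the `R`-balls around the roots are eventually bounded. -/
def EventuallyMassBound (𝒳 : ℕ → RootedMeasureTree.{u}) : Prop :=
  ∀ R : ℝ, ∃ M : ℝ, 0 ≤ M ∧ ∀ᶠ n in atTop,
    (𝒳 n).ν (Metric.closedBall (𝒳 n).root R) ≤ ENNReal.ofReal M

/-- The nonnegative `K`-Lipschitz functions bounded by `M` which vanish off the `R`-ball. -/
structure IsBump (𝒳 : RootedMeasureTree.{u}) (K M R : ℝ) (f : 𝒳 → ℝ) : Prop where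
  nonneg : ∀ x, 0 ≤ f x
  lipschitz : ∀ x y, |f x - f y| ≤ K * dist x y
  bound : ∀ x, |f x| ≤ M
  eq_zero : ∀ x, R ≤ height 𝒳 x → f x = 0

/-- Chebyshev's inequality uses the square of a bump, which must belong to a class with equally
uniform constants. -/
theorem IsBump.sq {𝒳 : RootedMeasureTree.{u}} {K M R : ℝ} {f : 𝒳 → ℝ} (h : IsBump 𝒳 K M R f) :
    IsBump 𝒳 (2 * M * K) (M ^ 2) R fun x => f x ^ 2 where
  nonneg x := sq_nonneg _
  lipschitz x y := by
    have : f x ^ 2 - f y ^ 2 = (f x + f y) * (f x - f y) := by ring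
    rw [this, abs_mul, mul_assoc]
    have h1 : |f x + f y| ≤ 2 * M := by linarith [abs_add_le (f x) (f y), h.bound x, h.bound y]
    have h2 := h.lipschitz x y
    exact mul_le_mul h1 h2 (abs_nonneg _) ((abs_nonneg _).trans h1)
  bound x := by
    rw [abs_pow]
    exact pow_le_pow_left₀ (abs_nonneg _) (h.bound x) 2
  eq_zero x hx := by rw [h.eq_zero x hx]; norm_num

variable [∀ n, DiscreteTopology (𝒳 n)]

/-- The order of choices matters: `ε` fixes the net and the energy bound `I`, then `I` fixes `δ`,
then `δ` fixes the mass bound `c`, and finally `α` is chosen. Each of the three error terms is then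
at most `κ / 3`. -/
theorem exists_forall_abs_mul_laplace_sub_le (hA0 : EdgeLengthBound 𝒳)
    (hA1 : EventuallyMassBound 𝒳) (hA2 : LocalLowerMassBound 𝒳) {K R κ : ℝ} (M : ℝ)
    (hK : 0 ≤ K) (hR : 0 < R) (hκ : 0 < κ) : ∃ α : ℝ, 0 < α ∧ ∀ᶠ n in atTop,
      ∀ Q, IsSpeedMotion (𝒳 n) Q → ∀ f, IsBump (𝒳 n) K M R f → ∀ x,
        |α * laplace Q α (extendZero f) x - extendZero f x| ≤ κ := by
  obtain ⟨R', hRR', hedge⟩ := hA0.exists_bound (show 0 < R + 1 by linarith)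
  have hR'0 : 0 < R' := by linarith
  obtain ⟨ε, hε0, hε1, hεκ⟩ : ∃ ε : ℝ, 0 < ε ∧ ε ≤ 1 ∧ 2 * (K * ε) ≤ κ / 3 := by
    refine ⟨min 1 (κ / 6 / (K + 1)), by positivity, min_le_left _ _, ?_⟩
    calc 2 * (K * min 1 (κ / 6 / (K + 1))) ≤ 2 * ((K + 1) * (κ / 6 / (K + 1))) := by
          gcongr
          · linarith
          · exact min_le_right _ _
      _ = κ / 3 := by field_simp; norm_num
  obtain ⟨c', hc', hmass'⟩ := hA2.exists_pos (show 0 < ε / 3 by positivity) hR'0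
  obtain ⟨M', hM', htot⟩ := hA1 (R' + ε)
  set I := K ^ 2 * (M' / c' * R') + 1 with hI
  have hI0 : 0 < I := by positivity
  set δ := (κ / 3) ^ 2 / (2 * I) with hδ
  have hδ0 : 0 < δ := by positivity
  obtain ⟨c, hc, hmass⟩ := hA2.exists_pos hδ0 hR'0
  set α := I / (c * (κ / 3) ^ 2) with hα
  have hα0 : 0 < α := by positivity
  refine ⟨α, hα0, ?_⟩
  filter_upwards [hedge, htot] with n hn1 hn2 Q hQ f hf x
  refine (hQ.abs_mul_laplace_sub_le hf.nonneg hf.lipschitz hK hf.bound hR hRR' hf.eq_zero hn1 hε1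
    hε0 hδ0 hc hc' hM' hα0 (hmass' n) (hmass n) hn2 x).trans ?_
  have h1 : I / (α * c) = (κ / 3) ^ 2 := by rw [hα]; field_simp
  have h2 : 2 * I * δ = (κ / 3) ^ 2 := by rw [hδ]; field_simp
  rw [← hI, h1, h2, Real.sqrt_sq (by positivity)]
  linarith

theorem exists_forall_abs_semigroup_sub_le (hA0 : EdgeLengthBound 𝒳)
    (hA1 : EventuallyMassBound 𝒳) (hA2 : LocalLowerMassBound 𝒳) {K M R κ : ℝ}
    (hK : 0 ≤ K) (hM : 0 ≤ M) (hR : 0 < R) (hκ : 0 < κ) : ∃ s₀ : ℝ≥0, 0 < s₀ ∧ ∀ᶠ n in atTop,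
      ∀ Q, IsSpeedMotion (𝒳 n) Q → ∀ f, IsBump (𝒳 n) K M R f → ∀ x, ∀ s ≤ s₀,
        |semigroup Q s (extendZero f) x - extendZero f x| ≤ κ := by
  obtain ⟨α, hα, h⟩ := exists_forall_abs_mul_laplace_sub_le hA0 hA1 hA2 M hK hR
    (show 0 < κ / 4 by positivity)
  have hs : 0 < κ / 2 / (2 * (M + 1) * α) := by positivity
  refine ⟨⟨κ / 2 / (2 * (M + 1) * α), hs.le⟩, hs, ?_⟩
  filter_upwards [h] with n hn Q hQ f hf x s hss
  have := hQ.isMarkovKernel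
  refine (abs_semigroup_sub_le hQ.markov hα (continuous_extendZero continuous_of_discreteTopology
    (tendsto_cocompact_of_height hf.eq_zero)) (abs_extendZero_le hM hf.bound) (hn Q hQ f hf)
    s x).trans ?_
  have h1 : (s : ℝ) ≤ κ / 2 / (2 * (M + 1) * α) := hss
  have h2 : 2 * M * α * s ≤ κ / 2 := by
    calc 2 * M * α * s ≤ 2 * (M + 1) * α * (κ / 2 / (2 * (M + 1) * α)) := by
          gcongr
          linarith
      _ = κ / 2 := by field_simp
  linarith

theorem exists_forall_measure_lt_abs_sub_le (hA0 : EdgeLengthBound 𝒳)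
    (hA1 : EventuallyMassBound 𝒳) (hA2 : LocalLowerMassBound 𝒳) {K M R γ ε : ℝ}
    (hK : 0 ≤ K) (hM : 0 ≤ M) (hR : 0 < R) (hγ : 0 < γ) (hε : 0 < ε) :
    ∃ s₀ : ℝ≥0, 0 < s₀ ∧ ∀ᶠ n in atTop,
      ∀ Q, IsSpeedMotion (𝒳 n) Q → ∀ f, IsBump (𝒳 n) K M R f → ∀ x, ∀ s ≤ s₀,
        Q x {w | γ < |extendZero f x - extendZero f (w s)|} ≤ ENNReal.ofReal ε := by
  obtain ⟨s₁, hs₁, h₁⟩ := exists_forall_abs_semigroup_sub_le hA0 hA1 hA2 hK hM hR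
    (show 0 < ε * γ ^ 2 / (2 * (2 * M + 1)) by positivity)
  obtain ⟨s₂, hs₂, h₂⟩ := exists_forall_abs_semigroup_sub_le hA0 hA1 hA2 (K := 2 * M * K)
    (M := M ^ 2) (by positivity) (by positivity) hR (show 0 < ε * γ ^ 2 / 2 by positivity)
  refine ⟨min s₁ s₂, lt_min hs₁ hs₂, ?_⟩
  filter_upwards [h₁, h₂] with n hn₁ hn₂ Q hQ f hf x s hs
  have := hQ.isMarkovKernel
  have h3 := hn₂ Q hQ _ hf.sq x s (hs.trans (min_le_right _ _))
  rw [extendZero_sq] at h3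
  refine (measure_lt_abs_sub_le (abs_extendZero_le hM hf.bound) hγ
    (hn₁ Q hQ f hf x s (hs.trans (min_le_left _ _))) h3).trans (ENNReal.ofReal_le_ofReal ?_)
  rw [div_le_iff₀ (by positivity)]
  have h4 : 2 * M * (ε * γ ^ 2 / (2 * (2 * M + 1))) ≤ ε * γ ^ 2 / 2 := by
    calc 2 * M * (ε * γ ^ 2 / (2 * (2 * M + 1)))
        ≤ (2 * M + 1) * (ε * γ ^ 2 / (2 * (2 * M + 1))) := by gcongr; linarith
      _ = ε * γ ^ 2 / 2 := by field_simp
  linarith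

end Sequence

/-! ### The common Heine-Borel space -/

theorem setIntegral_closedBall_map {𝒳 : RootedMeasureTree.{u}} {E : Type u} [MetricSpace E]
    [MeasurableSpace E] [BorelSpace E] {ψ : 𝒳 → E} (hψ : Isometry ψ) {f : E → ℝ}
    (hf : Continuous f) (R : ℝ) :
    ∫ y in Metric.closedBall (ψ 𝒳.root) R, f y ∂(𝒳.ν.map ψ) =
      ∫ x in Metric.closedBall 𝒳.root R, f (ψ x) ∂𝒳.ν := by
  rw [setIntegral_map Metric.isClosed_closedBall.measurableSet hf.aestronglyMeasurable
    hψ.continuous.aemeasurable, hψ.preimage_closedBall]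

section Space

variable {𝒳 : ℕ → RootedMeasureTree.{u}} {𝒴 : RootedMeasureTree.{u}} {E : Type u}
  [MetricSpace E] {ρE : E} {φ : ∀ n, 𝒳 n → E} {φ' : 𝒴 → E}

theorem VagueConvergence.tendsto {ψ : ∀ n, 𝒳 n → E} {ψ' : 𝒴 → E}
    (h : VagueConvergence ρE 𝒳 𝒴 ψ ψ') (hψ : ∀ n, Isometry (ψ n)) (hψ' : Isometry ψ')
    (hroot : ∀ n, ψ n (𝒳 n).root = ρE) (hroot' : ψ' 𝒴.root = ρE) :
    ∃ C : Set ℝ, C.Countable ∧ ∀ R : ℝ, 0 < R → R ∉ C → ∀ f : E →ᵇ ℝ,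
      Tendsto (fun n => ∫ x in Metric.closedBall (𝒳 n).root R, f (ψ n x) ∂(𝒳 n).ν) atTop
        (𝓝 (∫ x in Metric.closedBall 𝒴.root R, f (ψ' x) ∂𝒴.ν)) := by
  let : MeasurableSpace E := borel E
  have : BorelSpace E := ⟨rfl⟩
  obtain ⟨C, hC, hlim⟩ := h
  refine ⟨C, hC, fun R hR hRC f => ?_⟩
  have h1 := hlim R hR hRC f
  rw [← hroot', setIntegral_closedBall_map hψ' f.continuous] at h1
  refine h1.congr fun n => ?_
  rw [hroot', ← hroot n, setIntegral_closedBall_map (hψ n) f.continuous]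

theorem vagueConvergence_of_tendsto {ψ : ∀ n, 𝒳 n → E} {ψ' : 𝒴 → E}
    (hψ : ∀ n, Isometry (ψ n)) (hψ' : Isometry ψ') (hroot : ∀ n, ψ n (𝒳 n).root = ρE)
    (hroot' : ψ' 𝒴.root = ρE) {C : Set ℝ} (hC : C.Countable)
    (h : ∀ R : ℝ, 0 < R → R ∉ C → ∀ f : E →ᵇ ℝ,
      Tendsto (fun n => ∫ x in Metric.closedBall (𝒳 n).root R, f (ψ n x) ∂(𝒳 n).ν) atTop
        (𝓝 (∫ x in Metric.closedBall 𝒴.root R, f (ψ' x) ∂𝒴.ν))) :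
    VagueConvergence ρE 𝒳 𝒴 ψ ψ' := by
  let : MeasurableSpace E := borel E
  have : BorelSpace E := ⟨rfl⟩
  refine ⟨C, hC, fun R hR hRC f => ?_⟩
  have h1 := h R hR hRC f
  rw [← setIntegral_closedBall_map hψ' f.continuous, hroot'] at h1
  refine h1.congr fun n => ?_
  rw [← setIntegral_closedBall_map (hψ n) f.continuous, hroot n]

/-- Otherwise the δ-ball around `x`, of mass at least `c`, would stay at distance more than δ from
the compact set `K`. Then the function `g`, which vanishes on `K` and equals 1 at distance at least
δ, would have integrals at least `c`, whereas they tend to 0. -/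
theorem eventually_infDist_le (h : VagueConvergence ρE 𝒳 𝒴 φ φ') (hφ : ∀ n, Isometry (φ n))
    (hφ' : Isometry φ') (hroot : ∀ n, φ n (𝒳 n).root = ρE) (hroot' : φ' 𝒴.root = ρE)
    (hA2 : LocalLowerMassBound 𝒳) {R δ : ℝ} (hR : 0 < R) (hδ : 0 < δ) :
    ∃ R₁ : ℝ, 0 < R₁ ∧ ∀ᶠ n in atTop, ∀ x : 𝒳 n, height (𝒳 n) x < R →
      Metric.infDist (φ n x) (φ' '' Metric.closedBall 𝒴.root R₁) ≤ 2 * δ := by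
  obtain ⟨C, hC, hlim⟩ := h.tendsto hφ hφ' hroot hroot'
  obtain ⟨R₁, hR₁C, hR₁⟩ := (hC.dense_compl ℝ).exists_gt (R + δ)
  obtain ⟨c, hc, hmass⟩ := hA2.exists_pos hδ hR
  refine ⟨R₁, by linarith, ?_⟩
  set K := φ' '' Metric.closedBall 𝒴.root R₁ with hK
  have hcont : Continuous fun y : E => min 1 (Metric.infDist y K / δ) :=
    continuous_const.min ((Metric.continuous_infDist_pt K).div_const δ)
  have hg0 : ∀ y : E, 0 ≤ min 1 (Metric.infDist y K / δ) := fun y =>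
    le_min zero_le_one (div_nonneg Metric.infDist_nonneg hδ.le)
  let g : E →ᵇ ℝ := BoundedContinuousFunction.ofNormedAddCommGroup _ hcont 1 fun y => by
    rw [Real.norm_eq_abs, abs_of_nonneg (hg0 y)]
    exact min_le_left _ _
  have hg : ∀ y, g y = min 1 (Metric.infDist y K / δ) := fun _ => rfl
  have h1 := hlim R₁ (by linarith) hR₁C g
  have h2 : ∫ x in Metric.closedBall 𝒴.root R₁, g (φ' x) ∂𝒴.ν = 0 := by
    refine setIntegral_eq_zero_of_forall_eq_zero fun x hx => ?_
    rw [hg, Metric.infDist_zero_of_mem (mem_image_of_mem φ' hx), zero_div]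
    exact min_eq_right zero_le_one
  rw [h2] at h1
  filter_upwards [h1.eventually_lt_const hc] with n hn x hx
  by_contra hcon
  push Not at hcon
  have hfin : (𝒳 n).ν (Metric.closedBall (𝒳 n).root R₁) ≠ ∞ :=
    ((𝒳 n).finite_of_isBounded _ Metric.isBounded_closedBall).ne
  have hsub : Metric.closedBall x δ ⊆ Metric.closedBall (𝒳 n).root R₁ := by
    refine Metric.closedBall_subset_closedBall' ?_
    rw [dist_comm]
    simp only [height] at hx
    linarith
  have hgx : ∀ z ∈ Metric.closedBall x δ, g (φ n z) = 1 := by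
    intro z hz
    rw [hg]
    refine min_eq_left ((one_le_div hδ).2 ?_)
    have h3 := Metric.infDist_le_infDist_add_dist (s := K) (x := φ n x) (y := φ n z)
    rw [(hφ n).dist_eq, dist_comm] at h3
    have := Metric.mem_closedBall.1 hz
    linarith
  have hinteg : IntegrableOn (fun z => g (φ n z)) (Metric.closedBall (𝒳 n).root R₁) (𝒳 n).ν := by
    refine Measure.integrableOn_of_bounded (M := 1) hfin
      (g.continuous.comp (hφ n).continuous).aestronglyMeasurable (Eventually.of_forall fun z => ?_)
    rw [Real.norm_eq_abs, hg, abs_of_nonneg (hg0 _)]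
    exact min_le_left _ _
  have h3 : c ≤ ∫ z in Metric.closedBall x δ, g (φ n z) ∂(𝒳 n).ν := by
    rw [setIntegral_congr_fun Metric.isClosed_closedBall.measurableSet hgx, setIntegral_const,
      smul_eq_mul, mul_one]
    have := ENNReal.toReal_mono ((measure_mono hsub).trans_lt hfin.lt_top).ne (hmass n x hx)
    rwa [ENNReal.toReal_ofReal hc.le] at this
  have h4 : ∫ z in Metric.closedBall x δ, g (φ n z) ∂(𝒳 n).ν ≤
      ∫ z in Metric.closedBall (𝒳 n).root R₁, g (φ n z) ∂(𝒳 n).ν :=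
    setIntegral_mono_set hinteg (Eventually.of_forall fun z => hg0 _) (Eventually.of_forall hsub)
  linarith

theorem totallyBounded_of_infDist_le {A : Set E}
    (h : ∀ δ > 0, ∃ K B : Set E, TotallyBounded K ∧ K.Nonempty ∧ TotallyBounded B ∧
      ∀ x ∈ A, x ∈ B ∨ Metric.infDist x K ≤ δ) : TotallyBounded A := by
  refine Metric.totallyBounded_iff.2 fun ε hε => ?_
  obtain ⟨K, B, hK, hne, hB, hA⟩ := h (ε / 3) (by positivity)
  obtain ⟨t, ht, hcov⟩ := Metric.totallyBounded_iff.1 (hK.union hB) (ε / 2) (by positivity)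
  refine ⟨t, ht, fun x hx => ?_⟩
  obtain ⟨z, hz, hxz⟩ : ∃ z ∈ K ∪ B, dist x z < ε / 2 := by
    rcases hA x hx with hxB | hxK
    · exact ⟨x, Or.inr hxB, by rw [dist_self]; positivity⟩
    · obtain ⟨z, hz, hxz⟩ := (Metric.infDist_lt_iff hne).1
        (hxK.trans_lt (by linarith : ε / 3 < ε / 2))
      exact ⟨z, Or.inl hz, hxz⟩
  obtain ⟨y, hy, hzy⟩ := mem_iUnion₂.1 (hcov hz)
  refine mem_iUnion₂.2 ⟨y, hy, ?_⟩
  rw [Metric.mem_ball] at hzy ⊢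
  linarith [dist_triangle x z y]

/-- The union of the images of the trees. -/
def imageUnion (φ : ∀ n, 𝒳 n → E) (φ' : 𝒴 → E) : Set E := range φ' ∪ ⋃ n, range (φ n)

/-- Late trees are close to a compact part of the limit tree, and each of the finitely many early
trees contributes a compact ball. -/
theorem totallyBounded_imageUnion_inter_ball (h : VagueConvergence ρE 𝒳 𝒴 φ φ')
    (hφ : ∀ n, Isometry (φ n)) (hφ' : Isometry φ') (hroot : ∀ n, φ n (𝒳 n).root = ρE)
    (hroot' : φ' 𝒴.root = ρE) (hA2 : LocalLowerMassBound 𝒳) {R : ℝ} (hR : 0 < R) :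
    TotallyBounded (imageUnion φ φ' ∩ Metric.ball ρE R) := by
  refine totallyBounded_of_infDist_le fun δ hδ => ?_
  obtain ⟨R₁, hR₁, hev⟩ := eventually_infDist_le h hφ hφ' hroot hroot' hA2 hR
    (show 0 < δ / 2 by positivity)
  obtain ⟨N, hN⟩ := eventually_atTop.1 hev
  have hcpt : ∀ r, IsCompact (φ' '' Metric.closedBall 𝒴.root r) := fun r =>
    (isCompact_closedBall _ _).image hφ'.continuous
  refine ⟨φ' '' Metric.closedBall 𝒴.root R₁,
    φ' '' Metric.closedBall 𝒴.root R ∪ ⋃ n ∈ Finset.range N, φ n '' Metric.closedBall (𝒳 n).root R,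
    (hcpt _).totallyBounded,
    ⟨_, mem_image_of_mem _ (Metric.mem_closedBall_self hR₁.le)⟩,
    (hcpt R).totallyBounded.union
      ((Finset.range N).isCompact_biUnion fun n _ =>
        (isCompact_closedBall _ _).image (hφ n).continuous).totallyBounded, ?_⟩
  rintro y ⟨⟨x, rfl⟩ | hy, hyR⟩
  · left
    left
    refine mem_image_of_mem _ ?_
    rw [← hroot', Metric.mem_ball, hφ'.dist_eq] at hyR
    exact hyR.le
  · obtain ⟨n, x, rfl⟩ := mem_iUnion.1 hy
    rw [← hroot n, Metric.mem_ball, (hφ n).dist_eq] at hyR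
    by_cases hn : n < N
    · exact Or.inl (Or.inr (mem_iUnion₂.2 ⟨n, Finset.mem_range.2 hn, mem_image_of_mem _ hyR.le⟩))
    · right
      have h1 := hN n (not_lt.1 hn) x (by rw [height, dist_comm]; exact hyR)
      linarith

theorem properSpace_closure_imageUnion [CompleteSpace E] (h : VagueConvergence ρE 𝒳 𝒴 φ φ')
    (hφ : ∀ n, Isometry (φ n)) (hφ' : Isometry φ') (hroot : ∀ n, φ n (𝒳 n).root = ρE)
    (hroot' : φ' 𝒴.root = ρE) (hA2 : LocalLowerMassBound 𝒳) :
    ProperSpace (closure (imageUnion φ φ')) := by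
  refine ⟨fun x r => ?_⟩
  set R := max (dist (x : E) ρE + r) 0 + 1 with hR
  have hR0 : 0 < R := by positivity
  have htb := (totallyBounded_imageUnion_inter_ball h hφ hφ' hroot hroot' hA2 hR0).closure
  have hcpt : IsCompact (closure (imageUnion φ φ' ∩ Metric.ball ρE R)) :=
    htb.isCompact_of_isClosed isClosed_closure
  have hemb := (isClosed_closure (s := imageUnion φ φ')).isClosedEmbedding_subtypeVal
  refine (hemb.isCompact_preimage hcpt).of_isClosed_subset Metric.isClosed_closedBall fun y hy => ?_
  have h1 : dist (y : E) ρE < R := by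
    have h2 : dist (y : E) x ≤ r := hy
    have := dist_triangle (y : E) x ρE
    have := le_max_left (dist (x : E) ρE + r) 0
    linarith
  rw [inter_comm]
  exact Metric.isOpen_ball.inter_closure ⟨h1, y.2⟩

end Space

theorem TendstoGromovVague.exists_properSpace {𝒳 : ℕ → RootedMeasureTree.{u}}
    {𝒴 : RootedMeasureTree.{u}} (h : TendstoGromovVague 𝒳 𝒴) (hA2 : LocalLowerMassBound 𝒳) :
    ∃ (E : Type u) (_ : MetricSpace E) (_ : ProperSpace E) (ρE : E)
      (φ : ∀ n, 𝒳 n → E) (φ' : 𝒴 → E), (∀ n, Isometry (φ n)) ∧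
      Isometry φ' ∧ (∀ n, φ n (𝒳 n).root = ρE) ∧ φ' 𝒴.root = ρE ∧
        VagueConvergence ρE 𝒳 𝒴 φ φ' := by
  obtain ⟨E, _, _, _, ρE, φ, φ', hφr, hφ', hroot', hvague⟩ := h
  have hφ : ∀ n, Isometry (φ n) := fun n => (hφr n).1
  have hroot : ∀ n, φ n (𝒳 n).root = ρE := fun n => (hφr n).2
  have hsub : imageUnion φ φ' ⊆ closure (imageUnion φ φ') := subset_closure
  have hmem' : ∀ x, φ' x ∈ closure (imageUnion φ φ') := fun x => hsub (Or.inl ⟨x, rfl⟩)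
  have hmem : ∀ n x, φ n x ∈ closure (imageUnion φ φ') := fun n x =>
    hsub (Or.inr (mem_iUnion.2 ⟨n, x, rfl⟩))
  have hψ : ∀ n, Isometry fun x => (⟨φ n x, hmem n x⟩ : closure (imageUnion φ φ')) :=
    fun n x y => hφ n x y
  have hψ' : Isometry fun x => (⟨φ' x, hmem' x⟩ : closure (imageUnion φ φ')) :=
    fun x y => hφ' x y
  have hr' : (⟨φ' 𝒴.root, hmem' _⟩ : closure (imageUnion φ φ')) = ⟨ρE, hroot' ▸ hmem' _⟩ :=
    Subtype.ext hroot'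
  have hr : ∀ n, (⟨φ n (𝒳 n).root, hmem n _⟩ : closure (imageUnion φ φ')) =
      ⟨ρE, hroot' ▸ hmem' _⟩ := fun n => Subtype.ext (hroot n)
  refine ⟨closure (imageUnion φ φ'), inferInstance,
    properSpace_closure_imageUnion hvague hφ hφ' hroot hroot' hA2, ⟨ρE, hroot' ▸ hmem' _⟩,
    fun n x => ⟨φ n x, hmem n x⟩, fun x => ⟨φ' x, hmem' x⟩, hψ, hψ', hr, hr', ?_⟩
  obtain ⟨C, hC, hlim⟩ := hvague.tendsto hφ hφ' hroot hroot'
  refine vagueConvergence_of_tendsto hψ hψ' hr hr' hC fun R hR hRC f => ?_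
  -- By Tietze's theorem, test functions on the closed subspace extend to the ambient space, so the
  -- vague convergence is inherited.
  obtain ⟨g, -, hg⟩ := BoundedContinuousFunction.exists_extension_norm_eq_of_isClosedEmbedding f
    (isClosed_closure (s := imageUnion φ φ')).isClosedEmbedding_subtypeVal
  have hg' : ∀ y, f y = g y := fun y => (congrFun hg y).symm
  simp only [hg']
  exact hlim R hR hRC g

/-! ### The one-point compactification -/

section Separating

variable {E : Type u} [MetricSpace E]

/-- The tent functions `y ↦ (k + 1 - d(y, e))⁺`. -/
def tent (e : E) (k : ℕ) (y : E) : ℝ := max 0 (k + 1 - dist y e)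

theorem continuous_tent (e : E) (k : ℕ) : Continuous (tent e k) :=
  continuous_const.max (continuous_const.sub (continuous_id.dist continuous_const))

theorem tent_nonneg (e : E) (k : ℕ) (y : E) : 0 ≤ tent e k y := le_max_left _ _

theorem tent_le (e : E) (k : ℕ) (y : E) : tent e k y ≤ k + 1 :=
  max_le (by positivity) (by linarith [dist_nonneg (x := y) (y := e)])

theorem tent_eq_zero {e : E} {k : ℕ} {y : E} (h : k + 1 ≤ dist y e) : tent e k y = 0 :=
  max_eq_left (by linarith)

theorem abs_tent_sub_le (e : E) (k : ℕ) (x y : E) : |tent e k x - tent e k y| ≤ dist x y := by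
  have h1 : ∀ a b : ℝ, |max 0 a - max 0 b| ≤ |a - b| := fun a b => by
    simpa using abs_max_sub_max_le_max 0 a 0 b
  refine (h1 _ _).trans ?_
  rw [sub_sub_sub_cancel_left, dist_comm x y]
  exact abs_dist_sub_le y x e

/-- A tent centred close to `x` is strictly larger at `x` than at `y`, and tents vanish at ∞. -/
theorem exists_extendZero_tent_ne (e : ℕ → E) (he : DenseRange e) {x y : OnePoint E}
    (hxy : x ≠ y) : ∃ p : ℕ × ℕ, extendZero (tent (e p.1) p.2) x ≠
      extendZero (tent (e p.1) p.2) y := by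
  have hinf : ∀ x : E, ∃ p : ℕ × ℕ, extendZero (tent (e p.1) p.2) x ≠
      extendZero (tent (e p.1) p.2) OnePoint.infty := by
    intro x
    obtain ⟨k, hk⟩ := exists_nat_gt (dist x (e 0))
    refine ⟨(0, k), ?_⟩
    rw [extendZero_coe, extendZero_infty]
    exact (lt_max_of_lt_right (by linarith)).ne'
  induction x using OnePoint.rec with
  | infty =>
    induction y using OnePoint.rec with
    | infty => exact absurd rfl hxy
    | coe y =>
      obtain ⟨p, hp⟩ := hinf y
      exact ⟨p, hp.symm⟩
  | coe x =>
    induction y using OnePoint.rec with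
    | infty => exact hinf x
    | coe y =>
      have hd : 0 < dist x y := dist_pos.2 fun h => hxy (congrArg _ h)
      obtain ⟨i, hi⟩ := he.exists_dist_lt x (show 0 < dist x y / 2 by positivity)
      obtain ⟨k, hk⟩ := exists_nat_gt (dist x (e i))
      refine ⟨(i, k), ?_⟩
      rw [extendZero_coe, extendZero_coe]
      have h1 := dist_triangle_right x y (e i)
      have h2 : tent (e i) k y < tent (e i) k x :=
        lt_max_of_lt_right (max_lt (by linarith) (by linarith))
      exact h2.ne'

variable [ProperSpace E]

theorem continuous_extendZero_tent (e : E) (k : ℕ) : Continuous (extendZero (tent e k)) := by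
  refine continuous_extendZero (continuous_tent e k) ?_
  refine tendsto_const_nhds.congr' ?_
  filter_upwards [(isCompact_closedBall e (k + 1)).compl_mem_cocompact] with y hy
  rw [mem_compl_iff, Metric.mem_closedBall, not_le] at hy
  exact (tent_eq_zero hy.le).symm

/-- Countably many separating continuous functions embed a compact space into a countable product of
lines. -/
theorem metrizableSpace_onePoint (e : ℕ → E) (he : DenseRange e) :
    TopologicalSpace.MetrizableSpace (OnePoint E) := by
  have hc : Continuous fun (x : OnePoint E) (p : ℕ × ℕ) => extendZero (tent (e p.1) p.2) x :=
    continuous_pi fun p => continuous_extendZero_tent _ _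
  have hinj : Function.Injective
      fun (x : OnePoint E) (p : ℕ × ℕ) => extendZero (tent (e p.1) p.2) x := by
    intro x y hxy
    by_contra hne
    obtain ⟨p, hp⟩ := exists_extendZero_tent_ne e he hne
    exact hp (congrFun hxy p)
  exact (hc.isClosedEmbedding hinj).isEmbedding.metrizableSpace

end Separating

/-- The compact set of pairs at distance at least η is covered by finitely many of the open sets on
which some `f i` separates the pair by a definite amount. -/
theorem exists_finset_forall_dist_le {S ι : Type*} [MetricSpace S] [CompactSpace S]
    {f : ι → S → ℝ} (hf : ∀ i, Continuous (f i)) (hsep : ∀ x y, x ≠ y → ∃ i, f i x ≠ f i y)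
    {η : ℝ} (hη : 0 < η) : ∃ (F : Finset ι) (γ : ℝ), 0 < γ ∧
      ∀ x y, (∀ i ∈ F, |f i x - f i y| ≤ γ) → dist x y ≤ η := by
  classical
  have hK : IsCompact {p : S × S | η ≤ dist p.1 p.2} :=
    (isClosed_le continuous_const continuous_dist).isCompact
  obtain ⟨t, ht⟩ := hK.elim_finite_subcover
    (fun q : ι × ℕ => {p : S × S | 1 / ((q.2 : ℝ) + 1) < |f q.1 p.1 - f q.1 p.2|})
    (fun q => isOpen_lt continuous_const
      (((hf q.1).comp continuous_fst).sub ((hf q.1).comp continuous_snd)).abs) (by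
      intro p hp
      have hp : η ≤ dist p.1 p.2 := hp
      obtain ⟨i, hi⟩ := hsep p.1 p.2 (dist_pos.1 (hη.trans_le hp))
      obtain ⟨k, hk⟩ := exists_nat_one_div_lt (abs_pos.2 (sub_ne_zero.2 hi))
      exact mem_iUnion.2 ⟨(i, k), hk⟩)
  refine ⟨t.image Prod.fst, 1 / ((t.sup Prod.snd : ℕ) + 1), by positivity, fun x y hxy => ?_⟩
  by_contra hcon
  push Not at hcon
  obtain ⟨q, hq, hlt⟩ := mem_iUnion₂.1 (ht (show (x, y) ∈ {p : S × S | η ≤ dist p.1 p.2} from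
    hcon.le))
  have hlt : 1 / ((q.2 : ℝ) + 1) < |f q.1 x - f q.1 y| := hlt
  have h1 := hxy q.1 (Finset.mem_image_of_mem _ hq)
  have h2 : 1 / (((t.sup Prod.snd : ℕ) : ℝ) + 1) ≤ 1 / ((q.2 : ℝ) + 1) := by
    gcongr
    exact_mod_cast Finset.le_sup (f := Prod.snd) hq
  linarith

/-! ### Tightness of the random walks -/

section Grid

variable {S : Type u} [TopologicalSpace S] [MeasurableSpace S] [Countable S]
  [DiscreteMeasurableSpace S]

theorem eventually_forall_div_le {s : ℝ≥0} (hs : 0 < s) : ∀ᶠ m : ℕ in atTop,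
    ∀ i ≤ ⌈s / 2 * 2 ^ m⌉₊, (i : ℝ≥0) / 2 ^ m ≤ s := by
  have h1 := (tendsto_ceil_div_pow (s / 2)).mono_right nhdsWithin_le_nhds
  filter_upwards [h1.eventually_lt_const (NNReal.half_lt_self hs.ne')] with m hm i hi
  refine le_trans ?_ hm.le
  gcongr

/-- This makes the exponent in the partition bound independent of the mesh. -/
theorem ceil_div_ceil_le {s : ℝ≥0} (hs : 0 < s) (T : ℝ≥0) (m : ℕ) :
    ⌈T * 2 ^ m⌉₊ / ⌈s * 2 ^ m⌉₊ ≤ ⌊(T + 1) / s⌋₊ := by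
  refine Nat.le_floor (Nat.cast_div_le.trans ?_)
  have h1 : (⌈T * 2 ^ m⌉₊ : ℝ≥0) ≤ (T + 1) * 2 ^ m := by
    refine (Nat.ceil_lt_add_one (zero_le)).le.trans ?_
    rw [add_mul, one_mul]
    gcongr
    exact one_le_pow₀ one_le_two
  calc (⌈T * 2 ^ m⌉₊ : ℝ≥0) / ⌈s * 2 ^ m⌉₊ ≤ (T + 1) * 2 ^ m / (s * 2 ^ m) := by
        gcongr
        exact Nat.le_ceil _
    _ = (T + 1) / s := mul_div_mul_right _ _ (by positivity)

/-- Halving `s₀` and `s₁` leaves room for rounding times up to the grid. Ottaviani's factor 2 turns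
1/8 into the required 1/4 and `4 * β` into `8 * a`. -/
theorem eventually_measure_not_gridGood_le {Q : Kernel S (CadlagPath S)} (hQ : IsMarkovKernel Q)
    (hstart : ∀ x, ∀ᵐ w ∂(Q x), w 0 = x) (hmarkov : HasMarkovProperty Q) {ρ : S → S → ℝ}
    (hsymm : ∀ x y, ρ x y = ρ y x) (htri : ∀ x y z, ρ x z ≤ ρ x y + ρ y z) {η : ℝ}
    {s₀ s₁ : ℝ≥0} (hs₀ : 0 < s₀) (hs₁ : 0 < s₁) {a : ℝ≥0∞}
    (h₀ : ∀ x, ∀ s ≤ s₀, Q x {w | η / 2 < ρ x (w s)} ≤ 1 / 8)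
    (h₁ : ∀ x, ∀ s ≤ s₁, Q x {w | η / 2 < ρ x (w s)} ≤ a) (T : ℝ≥0) :
    ∀ᶠ m : ℕ in atTop, ∀ x, Q x {w | ¬ GridGood ρ (2 * η) ⌈s₁ / 2 * 2 ^ m⌉₊ ⌈T * 2 ^ m⌉₊
      ⌈T * 2 ^ m⌉₊ (grid m w)} ≤ 8 * a * 2 ^ ⌊(T + 1) / (s₀ / 2)⌋₊ := by
  filter_upwards [eventually_forall_div_le hs₀, eventually_forall_div_le hs₁] with m hm₀ hm₁ x
  have hP := isMarkovChain_grid Q hQ hstart hmarkov m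
  have hmeas : ∀ i, MeasurableSet {y : ℕ → S | η / 2 < ρ (y 0) (y i)} := fun i =>
    (measurable_pi_apply (X := fun _ : ℕ => S) 0).prodMk (measurable_pi_apply i)
      (MeasurableSet.of_discrete (s := {p : S × S | η / 2 < ρ p.1 p.2}))
  have hstep : ∀ (x : S) (i : ℕ), (Q x).map (fun w : CadlagPath S => grid m w)
      {y | η / 2 < ρ (y 0) (y i)} ≤ Q x {w : CadlagPath S | η / 2 < ρ x (w (i / 2 ^ m))} := by
    intro x i
    rw [Measure.map_apply (measurable_grid m) (hmeas i)]
    refine measure_mono_ae ?_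
    filter_upwards [hstart x] with w hw h
    have h : η / 2 < ρ (w ((0 : ℕ) / 2 ^ m)) (w (i / 2 ^ m)) := h
    rwa [Nat.cast_zero, zero_div, hw] at h
  have e₀ := fun x => hP.measure_exit_le hsymm htri (D := ⌈s₀ / 2 * 2 ^ m⌉₊)
    (fun x i hi => (hstep x i).trans (h₀ x _ (hm₀ i hi))) x
  have e₁ := fun x => hP.measure_exit_le hsymm htri (D := ⌈s₁ / 2 * 2 ^ m⌉₊)
    (fun x i hi => (hstep x i).trans (h₁ x _ (hm₁ i hi))) x
  have h8 : (2 : ℝ≥0∞) * (1 / 8) = 1 / 4 := by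
    rw [← ENNReal.toReal_eq_toReal_iff' (by finiteness) (by finiteness)]
    norm_num
  rw [h8] at e₀
  have key := hP.measure_not_gridGood_le hsymm htri (M := ⌈T * 2 ^ m⌉₊)
    (Nat.ceil_pos.2 (by positivity)) e₁ e₀ ⌈T * 2 ^ m⌉₊ x
  rw [Measure.map_apply (measurable_grid m) (determined_not_gridGood _ _ _ _ _).measurableSet]
    at key
  refine le_trans key ?_
  rw [← mul_assoc, show (4 : ℝ≥0∞) * 2 = 8 by norm_num]
  gcongr
  · exact one_le_two
  · exact ceil_div_ceil_le (by positivity) T m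

end Grid

theorem extendZero_map {T E : Type u} (f : E → ℝ) (φ : T → E) (x : OnePoint T) :
    extendZero f (OnePoint.map φ x) = extendZero (fun y => f (φ y)) x := by
  induction x using OnePoint.rec with
  | infty => rfl
  | coe x => rfl

section TentDist

variable {E : Type u} [MetricSpace E]

/-- The pseudo-distance given by finitely many tent functions. -/
def tentDist (e : ℕ → E) (F : Finset (ℕ × ℕ)) (x y : OnePoint E) : ℝ :=
  ∑ p ∈ F, |extendZero (tent (e p.1) p.2) x - extendZero (tent (e p.1) p.2) y|

theorem tentDist_comm (e : ℕ → E) (F : Finset (ℕ × ℕ)) (x y : OnePoint E) :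
    tentDist e F x y = tentDist e F y x := by
  simp only [tentDist, abs_sub_comm]

theorem tentDist_triangle (e : ℕ → E) (F : Finset (ℕ × ℕ)) (x y z : OnePoint E) :
    tentDist e F x z ≤ tentDist e F x y + tentDist e F y z := by
  rw [tentDist, tentDist, tentDist, ← Finset.sum_add_distrib]
  exact Finset.sum_le_sum fun p _ => abs_sub_le _ _ _

theorem isBump_tent {𝒳 : RootedMeasureTree.{u}} {φ : 𝒳 → E} (hφ : Isometry φ) (e : E) (k : ℕ) :
    IsBump 𝒳 1 (k + 1) (k + 1 + dist (φ 𝒳.root) e) fun x => tent e k (φ x) where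
  nonneg x := tent_nonneg e k _
  lipschitz x y := by
    rw [one_mul, ← hφ.dist_eq]
    exact abs_tent_sub_le e k _ _
  bound x := by
    rw [abs_of_nonneg (tent_nonneg e k _)]
    exact tent_le e k _
  eq_zero x hx := by
    refine tent_eq_zero ?_
    have h1 := dist_triangle_right (φ 𝒳.root) (φ x) e
    rw [hφ.dist_eq] at h1
    rw [height] at hx
    linarith

end TentDist

section Walks

variable {𝒳 : ℕ → RootedMeasureTree.{u}} {E : Type u} [MetricSpace E] {ρE : E}
  {φ : ∀ n, 𝒳 n → E} [∀ n, DiscreteTopology (𝒳 n)]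

/-- A union bound over the finitely many tents, by induction with `γ` and `ε` halved at each step.
-/
theorem exists_forall_measure_lt_tentDist_le (hA0 : EdgeLengthBound 𝒳)
    (hA1 : EventuallyMassBound 𝒳) (hA2 : LocalLowerMassBound 𝒳) (hφ : ∀ n, Isometry (φ n))
    (hroot : ∀ n, φ n (𝒳 n).root = ρE) (e : ℕ → E) (F : Finset (ℕ × ℕ)) {γ ε : ℝ} (hγ : 0 < γ)
    (hε : 0 < ε) : ∃ s₀ : ℝ≥0, 0 < s₀ ∧ ∀ᶠ n in atTop, ∀ Q, IsSpeedMotion (𝒳 n) Q →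
      ∀ x, ∀ s ≤ s₀, Q x {w | γ < tentDist e F (OnePoint.map (φ n) x)
        (OnePoint.map (φ n) (w s))} ≤ ENNReal.ofReal ε := by
  classical
  induction F using Finset.induction_on generalizing γ ε with
  | empty =>
    refine ⟨1, one_pos, Eventually.of_forall fun n Q _ x s _ => ?_⟩
    simp [tentDist, not_lt.2 hγ.le]
  | insert p F hp ih =>
    obtain ⟨s₁, hs₁, h₁⟩ := ih (half_pos hγ) (half_pos hε)
    obtain ⟨s₂, hs₂, h₂⟩ := exists_forall_measure_lt_abs_sub_le hA0 hA1 hA2 zero_le_one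
      (show (0 : ℝ) ≤ p.2 + 1 by positivity)
      (show (0 : ℝ) < p.2 + 1 + dist ρE (e p.1) by positivity) (half_pos hγ) (half_pos hε)
    refine ⟨min s₁ s₂, lt_min hs₁ hs₂, ?_⟩
    filter_upwards [h₁, h₂] with n hn₁ hn₂ Q hQ x s hs
    have k₁ := hn₁ Q hQ x s (hs.trans (min_le_left _ _))
    have hb := isBump_tent (hφ n) (e p.1) p.2
    rw [hroot n] at hb
    have k₂ := hn₂ Q hQ _ hb x s (hs.trans (min_le_right _ _))
    rw [← add_halves ε, ENNReal.ofReal_add (half_pos hε).le (half_pos hε).le]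
    refine le_trans (measure_mono ?_) ((measure_union_le _ _).trans (add_le_add k₁ k₂))
    intro w hw
    have hw : γ < tentDist e (insert p F) (OnePoint.map (φ n) x) (OnePoint.map (φ n) (w s)) := hw
    rw [tentDist, Finset.sum_insert hp, extendZero_map, extendZero_map] at hw
    by_contra hcon
    rw [mem_union, not_or] at hcon
    have c₁ := not_lt.1 (show ¬ γ / 2 < tentDist e F (OnePoint.map (φ n) x)
      (OnePoint.map (φ n) (w s)) from hcon.1)
    have c₂ := not_lt.1 (show ¬ γ / 2 < |extendZero (fun y => tent (e p.1) p.2 (φ n y)) x -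
      extendZero (fun y => tent (e p.1) p.2 (φ n y)) (w s)| from hcon.2)
    rw [tentDist] at c₁
    linarith

theorem walkLaw_apply_le {𝒳 : RootedMeasureTree.{u}}
    {Q : Kernel (OnePoint 𝒳) (CadlagPath (OnePoint 𝒳))} {μ : Measure 𝒳} [IsProbabilityMeasure μ]
    {A : Set (CadlagPath (OnePoint 𝒳))} (hA : MeasurableSet A) {c : ℝ≥0∞} (h : ∀ x, Q x A ≤ c) :
    walkLaw 𝒳 Q μ A ≤ c := by
  have hm : Measurable fun x : 𝒳 => (x : OnePoint 𝒳) := OnePoint.continuous_coe.measurable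
  have := Measure.isProbabilityMeasure_map (μ := μ) hm.aemeasurable
  rw [walkLaw, Measure.bind_apply hA Q.aemeasurable]
  refine (lintegral_mono h).trans ?_
  rw [lintegral_const, measure_univ, mul_one]

theorem isTightMeasureSet_walkLaw [ProperSpace E] (hA0 : EdgeLengthBound 𝒳)
    (hA1 : EventuallyMassBound 𝒳) (hA2 : LocalLowerMassBound 𝒳) (hφ : ∀ n, Isometry (φ n))
    (hroot : ∀ n, φ n (𝒳 n).root = ρE)
    (Q : ∀ n, Kernel (OnePoint (𝒳 n)) (CadlagPath (OnePoint (𝒳 n))))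
    (μ : ∀ n, Measure (𝒳 n)) (hQ : ∀ n, IsSpeedMotion (𝒳 n) (Q n))
    (hμ : ∀ n, IsProbabilityMeasure (μ n)) :
    IsTightMeasureSet (range fun n => (walkLaw (𝒳 n) (Q n) (μ n)).map (mapPath (φ n) (hφ n))) := by
  have : Nonempty E := ⟨ρE⟩
  have he := TopologicalSpace.denseRange_denseSeq E
  set e := TopologicalSpace.denseSeq E
  have := metrizableSpace_onePoint e he
  let : MetricSpace (OnePoint E) := TopologicalSpace.metrizableSpaceMetric (OnePoint E)
  have hfin : ∀ n, IsFiniteMeasure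
      ((walkLaw (𝒳 n) (Q n) (μ n)).map (mapPath (φ n) (hφ n))) := by
    intro n
    have := (hQ n).isMarkovKernel
    have : IsFiniteMeasure (walkLaw (𝒳 n) (Q n) (μ n)) :=
      ⟨(walkLaw_apply_le MeasurableSet.univ fun x => prob_le_one).trans_lt ENNReal.one_lt_top⟩
    infer_instance
  refine isTightMeasureSet_of_dyadicGood _ fun η hη T ε hε => ?_
  obtain ⟨F, γ, hγ, hF⟩ := exists_finset_forall_dist_le
    (f := fun p : ℕ × ℕ => extendZero (tent (e p.1) p.2))
    (fun p => continuous_extendZero_tent _ _)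
    (fun x y hxy => exists_extendZero_tent_ne e he hxy) hη
  have hγ4 : 0 < γ / 2 / 2 := by positivity
  -- The exponent `B` depends on `s₀` and `T` only, so the error `a`, and then `s₁`, can be chosen
  -- afterwards. The partition estimate is used at oscillation level `γ / 2`: it yields oscillation
  -- `γ` and needs displacement `γ / 2 / 2`.
  obtain ⟨s₀, hs₀, h₀⟩ := exists_forall_measure_lt_tentDist_le hA0 hA1 hA2 hφ hroot e F hγ4
    (show (0 : ℝ) < 1 / 8 by norm_num)
  set B := ⌊(T + 1) / (s₀ / 2)⌋₊ with hB
  obtain ⟨a, ha, haε⟩ : ∃ a : ℝ, 0 < a ∧ 8 * ENNReal.ofReal a * 2 ^ B ≤ ε := by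
    obtain ⟨ε', hε'0, hε'⟩ := ENNReal.lt_iff_exists_nnreal_btwn.1 hε
    have hε'1 : (0 : ℝ) < ε' := by exact_mod_cast hε'0
    refine ⟨ε' / (8 * 2 ^ B), by positivity, le_trans (le_of_eq ?_) hε'.le⟩
    rw [← ENNReal.ofReal_coe_nnreal (p := ε'), show (8 : ℝ≥0∞) = ENNReal.ofReal 8 by simp,
      show (2 : ℝ≥0∞) ^ B = ENNReal.ofReal (2 ^ B) by rw [ENNReal.ofReal_pow] <;> simp,
      ← ENNReal.ofReal_mul (by norm_num), ← ENNReal.ofReal_mul (by positivity)]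
    congr 1
    field_simp
  obtain ⟨s₁, hs₁, h₁⟩ := exists_forall_measure_lt_tentDist_le hA0 hA1 hA2 hφ hroot e F hγ4 ha
  refine ⟨s₁ / 2, by positivity, ?_⟩
  filter_upwards [h₀, h₁] with n hn₀ hn₁
  have h8 : ENNReal.ofReal (1 / 8) = 1 / 8 := by
    rw [ENNReal.ofReal_div_of_pos (by norm_num)]; simp
  have key := eventually_measure_not_gridGood_le (hQ n).isMarkovKernel (hQ n).initial
    (hQ n).markov (ρ := fun x y => tentDist e F (OnePoint.map (φ n) x) (OnePoint.map (φ n) y))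
    (fun x y => tentDist_comm e F _ _) (fun x y z => tentDist_triangle e F _ _ _)
    (η := γ / 2) hs₀ hs₁ (fun x s hs => h8 ▸ hn₀ (Q n) (hQ n) x s hs)
    (hn₁ (Q n) (hQ n)) T
  filter_upwards [key] with m hm
  have hmeas : MeasurableSet {w : CadlagPath (OnePoint E) | ¬ DyadicGood η T (s₁ / 2) m w} :=
    (measurableSet_dyadicGood η T (s₁ / 2) m).compl
  rw [Measure.map_apply (measurable_mapPath _ _) hmeas]
  refine walkLaw_apply_le (measurable_mapPath _ _ hmeas) fun x => ?_
  refine (measure_mono ?_).trans ((hm x).trans haε)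
  intro w hw hgood
  refine hw (hgood.imp fun a b hab => hF _ _ fun p hp => ?_)
  refine le_trans ?_ (hab.trans_eq (by ring))
  exact Finset.single_le_sum (f := fun p : ℕ × ℕ =>
    |extendZero (tent (e p.1) p.2) (OnePoint.map (φ n) (grid m w a)) -
      extendZero (tent (e p.1) p.2) (OnePoint.map (φ n) (grid m w b))|)
    (fun _ _ => abs_nonneg _) hp

end Walks

end SpeedWalk

end

/-! ### The tightness theorem -/

theorem mainTheorem4
    (𝒳 : ℕ → SpeedWalk.RootedMeasureTree) (𝒴 : SpeedWalk.RootedMeasureTree)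
    (hdiscrete : ∀ n, DiscreteTopology (𝒳 n))
    (hA0 : SpeedWalk.EdgeLengthBound 𝒳)
    (hA1 : SpeedWalk.TendstoGromovVague 𝒳 𝒴)
    (hA2 : SpeedWalk.LocalLowerMassBound 𝒳) :
    ∃ (E : Type _) (_ : MetricSpace E) (_ : ProperSpace E) (ρE : E)
      (φ : ∀ n, 𝒳 n → E) (φ' : 𝒴 → E) (hφ : ∀ n, Isometry (φ n)),
      Isometry φ' ∧ (∀ n, φ n (𝒳 n).root = ρE) ∧ φ' 𝒴.root = ρE ∧
      SpeedWalk.VagueConvergence ρE 𝒳 𝒴 φ φ' ∧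
      ∀ (Q : ∀ n, Kernel (OnePoint (𝒳 n)) (SpeedWalk.CadlagPath (OnePoint (𝒳 n))))
        (μ : ∀ n, Measure (𝒳 n)),
        (∀ n, SpeedWalk.IsSpeedMotion (𝒳 n) (Q n)) → (∀ n, IsProbabilityMeasure (μ n)) →
        IsTightMeasureSet (Set.range fun n =>
          (SpeedWalk.walkLaw (𝒳 n) (Q n) (μ n)).map (SpeedWalk.mapPath (φ n) (hφ n))) := by
  obtain ⟨E, _, _, ρE, φ, φ', hφ, hφ', hroot, hroot', hvague⟩ := hA1.exists_properSpace hA2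
  exact ⟨E, _, _, ρE, φ, φ', hφ, hφ', hroot, hroot', hvague, fun Q μ hQ hμ =>
    SpeedWalk.isTightMeasureSet_walkLaw hA0 (fun R => hvague.exists_mass_le hφ hroot R) hA2 hφ
      hroot Q μ hQ hμ⟩
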